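/- Let $K$ be a commutative ring. A tensor category is a symmetric monoidal category, a tensor functor is a strong symmetric monoidal functor, and morphisms of tensor functors are monoidal natural transformations. All categories are assumed essentially small. A finitely cocomplete tensor category is a tensor category with finite colimits such that $\otimes$ preserves finite colimits in each variable; a $K$-linear tensor category is a tensor category enriched in $K$-modules such that $\otimes$ is $K$-linear in each variable. Let $\mathrm{Cat}_{\otimes}$, $\mathrm{Cat}_{fc\otimes}$, $\mathrm{Cat}_{\otimes/K}$ and $\mathrm{Cat}_{fc\otimes/K}$ be the $2$-categories of tensor categories, of finitely cocomplete tensor categories, of $K$-linear tensor categories and of finitely cocomplete $K$-linear tensor categories, whose morphisms are the tensor functors which are (in the second and fourth case) finitely cocontinuous and (in the third and fourth case) $K$-linear, and whose $2$-morphisms are all monoidal natural transformations. A binary bicategorical coproduct of objects $A,B$ of a $2$-category is an object $A\sqcup B$ with morphisms $\iota_A\colon A\to A\sqcup B$ and $\iota_B\colon B\to A\sqcup B$ such that for every object $T$ restriction along $\iota_A,\iota_B$ is an equivalence of categories $\mathrm{Hom}(A\sqcup B,T)\simeq \mathrm{Hom}(A,T)\times\mathrm{Hom}(B,T)$. **Proposition.**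 The $2$-categories $\mathrm{Cat}_{\otimes}$, $\mathrm{Cat}_{fc\otimes}$, $\mathrm{Cat}_{\otimes/K}$ and $\mathrm{Cat}_{fc\otimes/K}$ have binary bicategorical coproducts. More precisely: 1. For $A,B\in\mathrm{Cat}_{\otimes}$, the product $A\times B$ with the componentwise tensor structure, together with the tensor functors $a\mapsto (a,1)$ and $b\mapsto(1,b)$, is a bicategorical coproduct of $A$ and $B$ in $\mathrm{Cat}_\otimes$. 2. For $A,B\in\mathrm{Cat}_{fc\otimes}$, let $A\boxtimes B$ be the tensor product of the underlying finitely cocomplete categories: it is finitely cocomplete and has a functor $\boxtimes\colon A\times B\to A\boxtimes B$, finitely cocontinuous in each variable, such that for every finitely cocomplete category $C$ restriction along it is an equivalence between the category of finitely cocontinuous functors $A\boxtimes B\to C$ and the category of functors $A\times B\to C$ which are finitely cocontinuous in each variable. Then $A\boxtimes B$ (which is unique up to equivalence) exists and can be given the structure of a finitely cocomplete tensor category for which $\boxtimes\colon A\times B\to A\boxtimes B$ is a tensor functor (so that $1\cong 1\boxtimes 1$ and $(a\boxtimes b)\otimes(a'\boxtimes b')\cong(a\otimes a')\boxtimes(b\otimes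 b')$). With any such structure, $A\boxtimes B$ together with $a\mapsto a\boxtimes 1$ and $b\mapsto 1\boxtimes b$ is a bicategorical coproduct of $A$ and $B$ in $\mathrm{Cat}_{fc\otimes}$. 3. For $A,B\in\mathrm{Cat}_{\otimes/K}$, let $A\otimes_K B$ be the $K$-linear category with objects the pairs $(a,b)$ and $\mathrm{Hom}((a,b),(a',b'))=\mathrm{Hom}_A(a,a')\otimes_K\mathrm{Hom}_B(b,b')$, with the tensor structure induced componentwise. Together with $a\mapsto(a,1)$, $f\mapsto f\otimes\mathrm{id}$ and $b\mapsto (1,b)$, $g\mapsto \mathrm{id}\otimes g$ it is a bicategorical coproduct of $A$ and $B$ in $\mathrm{Cat}_{\otimes/K}$. 4. For $A,B\in\mathrm{Cat}_{fc\otimes/K}$, let $A\boxtimes_K B$ be the finitely cocomplete $K$-linear category which classifies, as in 2, functors on $A\times B$ which are finitely cocontinuous and $K$-linear in each variable. Then $A\boxtimes_K B$ exists and can be given the structure of a finitely cocomplete $K$-linear tensor category for which $A\times B\to A\boxtimes_K B$ is a tensor functor. With any such structure, $A\boxtimes_K B$ together with $a\mapsto a\boxtimes 1$ and $b\mapsto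 1\boxtimes b$ is a bicategorical coproduct of $A$ and $B$ in $\mathrm{Cat}_{fc\otimes/K}$. -/

import Mathlib

open CategoryTheory MonoidalCategory Limits

universe v

namespace TensorCats

section Tensor

/-- A tensor category: an essentially small (locally small) symmetric monoidal category. -/
structure TensorCat : Type (v + 2) where
  carrier : Type (v + 1)
  [category : Category.{v} carrier]
  [monoidal : MonoidalCategory carrier]
  [symmetric : SymmetricCategory carrier]
  [essentiallySmall : EssentiallySmall.{v} carrier]

attribute [instance] TensorCat.category TensorCat.monoidal TensorCat.symmetric
  TensorCat.essentiallySmall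

/-- A tensor functor: a strong symmetric monoidal functor. -/
structure TensorFunctor (A B : TensorCat.{v}) where
  functor : A.carrier ⥤ B.carrier
  [braided : functor.Braided]

attribute [instance] TensorFunctor.braided

/-- A morphism of tensor functors: a monoidal natural transformation. -/
@[ext]
structure TensorTrans {A B : TensorCat.{v}} (F G : TensorFunctor A B) where
  natTrans : F.functor ⟶ G.functor
  [isMonoidal : NatTrans.IsMonoidal natTrans]

attribute [instance] TensorTrans.isMonoidal

/-- The category of tensor functors from `A` to `B`. -/
instance TensorFunctor.instCategory (A B : TensorCat.{v}) : Category (TensorFunctor A B) where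
  Hom F G := TensorTrans F G
  id F := { natTrans := 𝟙 F.functor }
  comp α β := { natTrans := α.natTrans ≫ β.natTrans }

@[ext]
lemma TensorFunctor.hom_ext {A B : TensorCat.{v}} {F G : TensorFunctor A B} {α β : F ⟶ G}
    (h : α.natTrans = β.natTrans) : α = β := TensorTrans.ext h

@[simp]
lemma TensorFunctor.id_natTrans {A B : TensorCat.{v}} (F : TensorFunctor A B) :
    TensorTrans.natTrans (𝟙 F) = 𝟙 F.functor := rfl

@[simp]
lemma TensorFunctor.comp_natTrans {A B : TensorCat.{v}} {F G H : TensorFunctor A B}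
    (α : F ⟶ G) (β : G ⟶ H) : (α ≫ β).natTrans = α.natTrans ≫ β.natTrans := rfl

/-- An isomorphism of tensor functors from a monoidal natural isomorphism. -/
@[simps]
def TensorFunctor.isoMk {A B : TensorCat.{v}} {F G : TensorFunctor A B}
    (e : F.functor ≅ G.functor) [NatTrans.IsMonoidal e.hom] : F ≅ G where
  hom := { natTrans := e.hom }
  inv := { natTrans := e.inv }

/-- The 2-category of tensor categories, tensor functors and monoidal natural transformations. -/
instance TensorCat.instBicategory : Bicategory TensorCat.{v} where
  Hom A B := TensorFunctor A B
  id A := { functor := 𝟭 A.carrier }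
  comp F G := { functor := F.functor ⋙ G.functor }
  homCategory A B := TensorFunctor.instCategory A B
  whiskerLeft F _ _ α := { natTrans := Functor.whiskerLeft F.functor α.natTrans }
  whiskerRight α G := { natTrans := Functor.whiskerRight α.natTrans G.functor }
  associator F G H := TensorFunctor.isoMk (Functor.associator F.functor G.functor H.functor)
  leftUnitor F := TensorFunctor.isoMk F.functor.leftUnitor
  rightUnitor F := TensorFunctor.isoMk F.functor.rightUnitor

end Tensor

section Bicategorical

open Bicategory

universe w₁ w₂ w₃ w₄

/-- The morphisms `i : A ⟶ P` and `j : B ⟶ P` exhibit `P` as a binary bicategorical coproduct of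
`A` and `B`: for all objects `T`, restriction along `i` and `j` is an equivalence of categories
`Hom(P, T) ≃ Hom(A, T) × Hom(B, T)`. -/
def IsBicategoricalCoproduct {C : Type w₁} [Bicategory.{w₂, w₃} C] {A B P : C}
    (i : A ⟶ P) (j : B ⟶ P) : Prop :=
  ∀ T : C, ((precomp T i).prod' (precomp T j)).IsEquivalence

/-- Every two objects have a binary bicategorical coproduct. -/
def HasBinaryBicategoricalCoproducts (C : Type w₁) [Bicategory.{w₂, w₃} C] : Prop :=
  ∀ A B : C, ∃ (P : C) (i : A ⟶ P) (j : B ⟶ P), IsBicategoricalCoproduct i j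

/-- Data defining a locally full sub-2-category: objects are objects of `C` with additional
structure, morphisms are the morphisms of `C` with a property stable under composition, and
2-morphisms are all 2-morphisms of `C`. -/
structure LocallyFull (C : Type w₁) [Bicategory.{w₂, w₃} C] (S : Type w₄) where
  obj : S → C
  mor : ∀ {X Y : S}, (obj X ⟶ obj Y) → Prop
  id_mem : ∀ X : S, mor (𝟙 (obj X))
  comp_mem : ∀ {X Y Z : S} (f : obj X ⟶ obj Y) (g : obj Y ⟶ obj Z), mor f → mor g → mor (f ≫ g)

namespace LocallyFull

variable {C : Type w₁} [Bicategory.{w₂, w₃} C] {S : Type w₄} (D : LocallyFull C S)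

/-- A morphism: a morphism of the ambient 2-category with the required property. -/
structure Mor (X Y : S) where
  hom : D.obj X ⟶ D.obj Y
  mem : D.mor hom

/-- A 2-morphism: any 2-morphism of the ambient 2-category. -/
@[ext]
structure Mor₂ {X Y : S} (f g : D.Mor X Y) where
  hom : f.hom ⟶ g.hom

instance instCategoryMor (X Y : S) : Category (D.Mor X Y) where
  Hom f g := D.Mor₂ f g
  id f := ⟨𝟙 f.hom⟩
  comp α β := ⟨α.hom ≫ β.hom⟩

variable {D}

@[ext]
lemma hom_ext {X Y : S} {f g : D.Mor X Y} {α β : f ⟶ g} (h : α.hom = β.hom) : α = β :=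
  Mor₂.ext h

@[simp]
lemma id_hom {X Y : S} (f : D.Mor X Y) : Mor₂.hom (𝟙 f) = 𝟙 f.hom := rfl

@[simp]
lemma comp_hom {X Y : S} {f g h : D.Mor X Y} (α : f ⟶ g) (β : g ⟶ h) :
    (α ≫ β).hom = α.hom ≫ β.hom := rfl

/-- An invertible 2-morphism from an invertible 2-morphism of the ambient 2-category. -/
@[simps]
def isoMk {X Y : S} {f g : D.Mor X Y} (e : f.hom ≅ g.hom) : f ≅ g where
  hom := ⟨e.hom⟩
  inv := ⟨e.inv⟩

variable (D)

/-- The locally full sub-2-category. -/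
abbrev bicategory : Bicategory S where
  Hom X Y := D.Mor X Y
  id X := ⟨𝟙 (D.obj X), D.id_mem X⟩
  comp f g := ⟨f.hom ≫ g.hom, D.comp_mem _ _ f.mem g.mem⟩
  homCategory X Y := D.instCategoryMor X Y
  whiskerLeft f _ _ α := ⟨f.hom ◁ α.hom⟩
  whiskerRight α g := ⟨α.hom ▷ g.hom⟩
  associator f g h := isoMk (α_ f.hom g.hom h.hom)
  leftUnitor f := isoMk (λ_ f.hom)
  rightUnitor f := isoMk (ρ_ f.hom)
  whisker_exchange α β := by ext; exact whisker_exchange α.hom β.hom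

end LocallyFull

end Bicategorical

section Structured

/-- A finitely cocomplete tensor category: the underlying category has finite colimits, and the
tensor product preserves finite colimits in each variable. -/
structure FcTensorCat : Type (v + 2) extends TensorCat.{v} where
  [hasFiniteColimits : HasFiniteColimits carrier]
  [tensorLeft_cocontinuous : ∀ X : carrier, PreservesFiniteColimits (tensorLeft X)]
  [tensorRight_cocontinuous : ∀ X : carrier, PreservesFiniteColimits (tensorRight X)]

attribute [instance] FcTensorCat.hasFiniteColimits FcTensorCat.tensorLeft_cocontinuous
  FcTensorCat.tensorRight_cocontinuous

/-- A `K`-linear tensor category: the underlying category is `K`-linear (enriched in `K`-modules),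
and the tensor product is `K`-linear in each variable. -/
structure LinTensorCat (K : Type v) [CommRing K] : Type (v + 2) extends TensorCat.{v} where
  [preadditive : Preadditive carrier]
  [linear : Linear K carrier]
  [monoidalPreadditive : MonoidalPreadditive carrier]
  [monoidalLinear : MonoidalLinear K carrier]

attribute [instance] LinTensorCat.preadditive LinTensorCat.linear
  LinTensorCat.monoidalPreadditive LinTensorCat.monoidalLinear

/-- A finitely cocomplete `K`-linear tensor category. -/
structure FcLinTensorCat (K : Type v) [CommRing K] : Type (v + 2)
    extends LinTensorCat.{v} K, FcTensorCat.{v}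

attribute [instance] FcLinTensorCat.hasFiniteColimits FcLinTensorCat.tensorLeft_cocontinuous
  FcLinTensorCat.tensorRight_cocontinuous

/-- The 2-category of finitely cocomplete tensor categories and finitely cocontinuous tensor
functors, as a locally full sub-2-category of all tensor categories. -/
def FcTensorCat.locallyFull : LocallyFull TensorCat.{v} FcTensorCat.{v} where
  obj A := A.toTensorCat
  mor F := PreservesFiniteColimits F.functor
  id_mem A := inferInstanceAs (PreservesFiniteColimits (𝟭 A.carrier))
  comp_mem F G _ _ := comp_preservesFiniteColimits F.functor G.functor

instance FcTensorCat.instBicategory : Bicategory FcTensorCat.{v} :=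
  FcTensorCat.locallyFull.bicategory

variable (K : Type v) [CommRing K]

/-- The 2-category of `K`-linear tensor categories and `K`-linear tensor functors. -/
def LinTensorCat.locallyFull : LocallyFull TensorCat.{v} (LinTensorCat.{v} K) where
  obj A := A.toTensorCat
  mor F := F.functor.Additive ∧ F.functor.Linear K
  id_mem A := ⟨inferInstanceAs (𝟭 A.carrier).Additive, inferInstanceAs ((𝟭 A.carrier).Linear K)⟩
  comp_mem F G := fun ⟨_, _⟩ ⟨_, _⟩ =>
    ⟨inferInstanceAs (F.functor ⋙ G.functor).Additive,
      inferInstanceAs ((F.functor ⋙ G.functor).Linear K)⟩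

instance LinTensorCat.instBicategory : Bicategory (LinTensorCat.{v} K) :=
  (LinTensorCat.locallyFull K).bicategory

/-- The 2-category of finitely cocomplete `K`-linear tensor categories and finitely cocontinuous
`K`-linear tensor functors. -/
def FcLinTensorCat.locallyFull : LocallyFull TensorCat.{v} (FcLinTensorCat.{v} K) where
  obj A := A.toTensorCat
  mor F := PreservesFiniteColimits F.functor ∧ F.functor.Additive ∧ F.functor.Linear K
  id_mem A := ⟨inferInstanceAs (PreservesFiniteColimits (𝟭 A.carrier)),
    inferInstanceAs (𝟭 A.carrier).Additive, inferInstanceAs ((𝟭 A.carrier).Linear K)⟩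
  comp_mem F G := fun ⟨_, _, _⟩ ⟨_, _, _⟩ =>
    ⟨comp_preservesFiniteColimits F.functor G.functor,
      inferInstanceAs (F.functor ⋙ G.functor).Additive,
      inferInstanceAs ((F.functor ⋙ G.functor).Linear K)⟩

instance FcLinTensorCat.instBicategory : Bicategory (FcLinTensorCat.{v} K) :=
  (FcLinTensorCat.locallyFull K).bicategory

end Structured

section Product

universe u₁ u₂

variable {A : Type u₁} [Category.{v} A] [MonoidalCategory A] [SymmetricCategory A]
  {B : Type u₂} [Category.{v} B] [MonoidalCategory B] [SymmetricCategory B]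

/-- The componentwise symmetry on the product of two symmetric monoidal categories. -/
instance prodSymmetric : SymmetricCategory (A × B) where
  braiding X Y := Iso.prod (β_ X.1 Y.1) (β_ X.2 Y.2)
  braiding_naturality_right _ _ _ _ := by ext <;> simp
  braiding_naturality_left _ _ := by ext <;> simp
  hexagon_forward _ _ _ := by ext <;> simp
  hexagon_reverse _ _ _ := by ext <;> simp
  symmetry _ _ := by ext <;> simp

variable (A B)

/-- The functor `a ↦ (a, 1)` is strong monoidal, with structure isomorphisms the identity of
`(1, 1)` and `(a ⊗ a', 1 ⊗ 1) ≅ (a ⊗ a', 1)`. -/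
instance sectLMonoidal : (Prod.sectL A (𝟙_ B)).Monoidal :=
  Functor.CoreMonoidal.toMonoidal
    { εIso := Iso.refl _
      μIso := fun X Y => Iso.prod (Iso.refl (X ⊗ Y)) (λ_ (𝟙_ B))
      μIso_hom_natural_left := fun {X Y} f X' => Prod.ext
        (show f ▷ X' ≫ 𝟙 _ = 𝟙 _ ≫ f ▷ X' by simp)
        (show 𝟙 (𝟙_ B) ▷ 𝟙_ B ≫ (λ_ (𝟙_ B)).hom = (λ_ (𝟙_ B)).hom ≫ 𝟙 _ by simp)
      μIso_hom_natural_right := fun {X Y} X' f => Prod.ext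
        (show X' ◁ f ≫ 𝟙 _ = 𝟙 _ ≫ X' ◁ f by simp)
        (show 𝟙_ B ◁ 𝟙 (𝟙_ B) ≫ (λ_ (𝟙_ B)).hom = (λ_ (𝟙_ B)).hom ≫ 𝟙 _ by simp)
      associativity := fun X Y Z => Prod.ext
        (show 𝟙 (X ⊗ Y) ▷ Z ≫ 𝟙 ((X ⊗ Y) ⊗ Z) ≫ (α_ X Y Z).hom =
          (α_ X Y Z).hom ≫ X ◁ 𝟙 (Y ⊗ Z) ≫ 𝟙 (X ⊗ (Y ⊗ Z)) by simp)
        (show (λ_ (𝟙_ B)).hom ▷ 𝟙_ B ≫ (λ_ (𝟙_ B)).hom ≫ 𝟙 (𝟙_ B) =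
          (α_ (𝟙_ B) (𝟙_ B) (𝟙_ B)).hom ≫ 𝟙_ B ◁ (λ_ (𝟙_ B)).hom ≫ (λ_ (𝟙_ B)).hom by monoidal)
      left_unitality := fun X => Prod.ext
        (show (λ_ X).hom = 𝟙 (𝟙_ A) ▷ X ≫ 𝟙 (𝟙_ A ⊗ X) ≫ (λ_ X).hom by simp)
        (show (λ_ (𝟙_ B)).hom = 𝟙 (𝟙_ B) ▷ 𝟙_ B ≫ (λ_ (𝟙_ B)).hom ≫ 𝟙 (𝟙_ B) by simp)
      right_unitality := fun X => Prod.ext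
        (show (ρ_ X).hom = X ◁ 𝟙 (𝟙_ A) ≫ 𝟙 (X ⊗ 𝟙_ A) ≫ (ρ_ X).hom by simp)
        (show (ρ_ (𝟙_ B)).hom = 𝟙_ B ◁ 𝟙 (𝟙_ B) ≫ (λ_ (𝟙_ B)).hom ≫ 𝟙 (𝟙_ B) by monoidal) }

instance sectLBraided : (Prod.sectL A (𝟙_ B)).Braided where
  braided X Y := Prod.ext
    (show 𝟙 (X ⊗ Y) ≫ (β_ X Y).hom = (β_ X Y).hom ≫ 𝟙 (Y ⊗ X) by simp)
    (show (λ_ (𝟙_ B)).hom ≫ 𝟙 (𝟙_ B) = (β_ (𝟙_ B) (𝟙_ B)).hom ≫ (λ_ (𝟙_ B)).hom by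
      simp [← unitors_equal])

/-- The functor `b ↦ (1, b)` is strong monoidal, with structure isomorphisms the identity of
`(1, 1)` and `(1 ⊗ 1, b ⊗ b') ≅ (1, b ⊗ b')`. -/
instance sectRMonoidal : (Prod.sectR (𝟙_ A) B).Monoidal :=
  Functor.CoreMonoidal.toMonoidal
    { εIso := Iso.refl _
      μIso := fun X Y => Iso.prod (λ_ (𝟙_ A)) (Iso.refl (X ⊗ Y))
      μIso_hom_natural_left := fun {X Y} f X' => Prod.ext
        (show 𝟙 (𝟙_ A) ▷ 𝟙_ A ≫ (λ_ (𝟙_ A)).hom = (λ_ (𝟙_ A)).hom ≫ 𝟙 _ by simp)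
        (show f ▷ X' ≫ 𝟙 _ = 𝟙 _ ≫ f ▷ X' by simp)
      μIso_hom_natural_right := fun {X Y} X' f => Prod.ext
        (show 𝟙_ A ◁ 𝟙 (𝟙_ A) ≫ (λ_ (𝟙_ A)).hom = (λ_ (𝟙_ A)).hom ≫ 𝟙 _ by simp)
        (show X' ◁ f ≫ 𝟙 _ = 𝟙 _ ≫ X' ◁ f by simp)
      associativity := fun X Y Z => Prod.ext
        (show (λ_ (𝟙_ A)).hom ▷ 𝟙_ A ≫ (λ_ (𝟙_ A)).hom ≫ 𝟙 (𝟙_ A) =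
          (α_ (𝟙_ A) (𝟙_ A) (𝟙_ A)).hom ≫ 𝟙_ A ◁ (λ_ (𝟙_ A)).hom ≫ (λ_ (𝟙_ A)).hom by monoidal)
        (show 𝟙 (X ⊗ Y) ▷ Z ≫ 𝟙 ((X ⊗ Y) ⊗ Z) ≫ (α_ X Y Z).hom =
          (α_ X Y Z).hom ≫ X ◁ 𝟙 (Y ⊗ Z) ≫ 𝟙 (X ⊗ (Y ⊗ Z)) by simp)
      left_unitality := fun X => Prod.ext
        (show (λ_ (𝟙_ A)).hom = 𝟙 (𝟙_ A) ▷ 𝟙_ A ≫ (λ_ (𝟙_ A)).hom ≫ 𝟙 (𝟙_ A) by simp)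
        (show (λ_ X).hom = 𝟙 (𝟙_ B) ▷ X ≫ 𝟙 (𝟙_ B ⊗ X) ≫ (λ_ X).hom by simp)
      right_unitality := fun X => Prod.ext
        (show (ρ_ (𝟙_ A)).hom = 𝟙_ A ◁ 𝟙 (𝟙_ A) ≫ (λ_ (𝟙_ A)).hom ≫ 𝟙 (𝟙_ A) by monoidal)
        (show (ρ_ X).hom = X ◁ 𝟙 (𝟙_ B) ≫ 𝟙 (X ⊗ 𝟙_ B) ≫ (ρ_ X).hom by simp) }

instance sectRBraided : (Prod.sectR (𝟙_ A) B).Braided where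
  braided X Y := Prod.ext
    (show (λ_ (𝟙_ A)).hom ≫ 𝟙 (𝟙_ A) = (β_ (𝟙_ A) (𝟙_ A)).hom ≫ (λ_ (𝟙_ A)).hom by
      simp [← unitors_equal])
    (show 𝟙 (X ⊗ Y) ≫ (β_ X Y).hom = (β_ X Y).hom ≫ 𝟙 (Y ⊗ X) by simp)

/-- The product of two essentially small categories is essentially small. -/
instance prodEssentiallySmall {C : Type u₁} [Category.{v} C] [EssentiallySmall.{v} C]
    {D : Type u₂} [Category.{v} D] [EssentiallySmall.{v} D] : EssentiallySmall.{v} (C × D) :=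
  EssentiallySmall.mk' ((equivSmallModel.{v} C).prod (equivSmallModel.{v} D))

end Product

/-- The product tensor category `A × B`, with componentwise structure. -/
def TensorCat.prod (A B : TensorCat.{v}) : TensorCat.{v} where
  carrier := A.carrier × B.carrier

/-- The tensor functor `A → A × B`, `a ↦ (a, 1)`. -/
def TensorCat.inl (A B : TensorCat.{v}) : A ⟶ A.prod B :=
  TensorFunctor.mk (B := A.prod B) (Prod.sectL A.carrier (𝟙_ B.carrier))
    (braided := sectLBraided A.carrier B.carrier)

/-- The tensor functor `B → A × B`, `b ↦ (1, b)`. -/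
def TensorCat.inr (A B : TensorCat.{v}) : B ⟶ A.prod B :=
  TensorFunctor.mk (B := A.prod B) (Prod.sectR (𝟙_ A.carrier) B.carrier)
    (braided := sectRBraided A.carrier B.carrier)


section LinearTensor

open scoped TensorProduct

universe u₁ u₂

/-- The objects of the `K`-linear tensor product `A ⊗_K B`: pairs of an object of `A` and an object
of `B`. -/
structure LinProd (K : Type v) (A : Type u₁) (B : Type u₂) where
  fst : A
  snd : B

namespace LinProd

variable (K : Type v) [CommRing K]
  {A : Type u₁} [Category.{v} A] [Preadditive A] [Linear K A]
  {B : Type u₂} [Category.{v} B] [Preadditive B] [Linear K B]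

/-- Composition in `A ⊗_K B` is determined by `(f ⊗ g) ≫ (f' ⊗ g') = (f ≫ f') ⊗ (g ≫ g')`. -/
noncomputable def compMap (X Y Z : LinProd K A B) :
    ((X.fst ⟶ Y.fst) ⊗[K] (X.snd ⟶ Y.snd)) →ₗ[K] ((Y.fst ⟶ Z.fst) ⊗[K] (Y.snd ⟶ Z.snd)) →ₗ[K]
      ((X.fst ⟶ Z.fst) ⊗[K] (X.snd ⟶ Z.snd)) :=
  TensorProduct.map₂ (Linear.comp X.fst Y.fst Z.fst) (Linear.comp X.snd Y.snd Z.snd)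

/-- The category `A ⊗_K B`, with `Hom((a, b), (a', b')) = Hom(a, a') ⊗_K Hom(b, b')`. -/
noncomputable instance instCategory : Category.{v} (LinProd K A B) where
  Hom X Y := (X.fst ⟶ Y.fst) ⊗[K] (X.snd ⟶ Y.snd)
  id X := 𝟙 X.fst ⊗ₜ[K] 𝟙 X.snd
  comp {X Y Z} f g := compMap K X Y Z f g
  id_comp {X Y} f := by
    induction f using TensorProduct.induction_on with
    | zero => simp
    | tmul f g => simp [compMap]
    | add f g hf hg => rw [map_add, hf, hg]
  comp_id {X Y} f := by
    induction f using TensorProduct.induction_on with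
    | zero => simp
    | tmul f g => simp [compMap]
    | add f g hf hg => rw [map_add, LinearMap.add_apply, hf, hg]
  assoc {W X Y Z} f g h := by
    induction f using TensorProduct.induction_on with
    | zero => simp
    | add f f' hf hf' => simp only [map_add, LinearMap.add_apply, hf, hf']
    | tmul f₁ f₂ =>
      induction g using TensorProduct.induction_on with
      | zero => simp
      | add g g' hg hg' => simp only [map_add, LinearMap.add_apply, hg, hg']
      | tmul g₁ g₂ =>
        induction h using TensorProduct.induction_on with
        | zero => simp
        | add h h' hh hh' => simp only [map_add, hh, hh']
        | tmul h₁ h₂ => simp [compMap]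

noncomputable instance instPreadditive : Preadditive (LinProd K A B) where
  homGroup X Y := inferInstanceAs (AddCommGroup ((X.fst ⟶ Y.fst) ⊗[K] (X.snd ⟶ Y.snd)))
  add_comp X Y Z f f' g := LinearMap.map_add₂ (compMap K X Y Z) f f' g
  comp_add X Y Z f g g' := (compMap K X Y Z f).map_add g g'

noncomputable instance instLinear : Linear K (LinProd K A B) where
  homModule X Y := inferInstanceAs (Module K ((X.fst ⟶ Y.fst) ⊗[K] (X.snd ⟶ Y.snd)))
  smul_comp X Y Z r f g := LinearMap.map_smul₂ (compMap K X Y Z) r f g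
  comp_smul X Y Z f r g := (compMap K X Y Z f).map_smul r g

/-- The morphism `f ⊗ g` of `A ⊗_K B`. -/
noncomputable def tmul {X Y : LinProd K A B} (f : X.fst ⟶ Y.fst) (g : X.snd ⟶ Y.snd) : X ⟶ Y :=
  TensorProduct.tmul K f g

variable {K}

@[simp]
lemma tmul_id (X : LinProd K A B) : tmul K (𝟙 X.fst) (𝟙 X.snd) = 𝟙 X := rfl

@[simp]
lemma tmul_comp {X Y Z : LinProd K A B} (f : X.fst ⟶ Y.fst) (g : X.snd ⟶ Y.snd)
    (f' : Y.fst ⟶ Z.fst) (g' : Y.snd ⟶ Z.snd) :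
    tmul K f g ≫ tmul K f' g' = tmul K (f ≫ f') (g ≫ g') :=
  congrArg (fun φ => φ (TensorProduct.tmul K f' g'))
    (TensorProduct.map₂_apply_tmul (Linear.comp (S := K) X.fst Y.fst Z.fst)
      (Linear.comp (S := K) X.snd Y.snd Z.snd) f g)

lemma tmul_add_left {X Y : LinProd K A B} (f f' : X.fst ⟶ Y.fst) (g : X.snd ⟶ Y.snd) :
    tmul K (f + f') g = tmul K f g + tmul K f' g := TensorProduct.add_tmul f f' g

lemma tmul_add_right {X Y : LinProd K A B} (f : X.fst ⟶ Y.fst) (g g' : X.snd ⟶ Y.snd) :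
    tmul K f (g + g') = tmul K f g + tmul K f g' := TensorProduct.tmul_add f g g'

lemma tmul_smul_left {X Y : LinProd K A B} (r : K) (f : X.fst ⟶ Y.fst) (g : X.snd ⟶ Y.snd) :
    tmul K (r • f) g = r • tmul K f g := TensorProduct.smul_tmul' r f g

lemma tmul_smul_right {X Y : LinProd K A B} (r : K) (f : X.fst ⟶ Y.fst) (g : X.snd ⟶ Y.snd) :
    tmul K f (r • g) = r • tmul K f g := TensorProduct.tmul_smul r f g

/-- Induction on morphisms of `A ⊗_K B`. -/
lemma hom_induction {X Y : LinProd K A B} {p : (X ⟶ Y) → Prop} (f : X ⟶ Y) (zero : p 0)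
    (tmul : ∀ f g, p (tmul K f g)) (add : ∀ f g, p f → p g → p (f + g)) : p f :=
  TensorProduct.induction_on f zero tmul add

/-- Isomorphisms of `A` and `B` give an isomorphism of `A ⊗_K B`. -/
@[simps]
noncomputable def isoMk {X Y : LinProd K A B} (e : X.fst ≅ Y.fst) (e' : X.snd ≅ Y.snd) :
    X ≅ Y where
  hom := tmul K e.hom e'.hom
  inv := tmul K e.inv e'.inv
  hom_inv_id := by simp
  inv_hom_id := by simp

instance instEssentiallySmall [EssentiallySmall.{v} A] [EssentiallySmall.{v} B] :
    EssentiallySmall.{v} (LinProd K A B) := by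
  rw [essentiallySmall_iff]
  refine ⟨?_, inferInstance⟩
  have hA := ((essentiallySmall_iff.{v} A).1 inferInstance).1
  have hB := ((essentiallySmall_iff.{v} B).1 inferInstance).1
  let φ : Skeleton A × Skeleton B → Skeleton (LinProd K A B) := fun p =>
    toSkeleton ⟨(fromSkeleton A).obj p.1, (fromSkeleton B).obj p.2⟩
  refine small_of_surjective (f := φ) fun X => ?_
  let Y := (fromSkeleton _).obj X
  refine ⟨⟨toSkeleton Y.fst, toSkeleton Y.snd⟩, ?_⟩
  have : toSkeleton Y = X := toSkeleton_fromSkeleton_obj X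
  rw [← this]
  exact toSkeleton_eq_toSkeleton_iff.2
    ⟨isoMk (fromSkeletonToSkeletonIso Y.fst) (fromSkeletonToSkeletonIso Y.snd)⟩

variable [MonoidalCategory A] [MonoidalPreadditive A] [MonoidalLinear K A]
  [MonoidalCategory B] [MonoidalPreadditive B] [MonoidalLinear K B]

/-- Left whiskering in `A ⊗_K B`, determined by `X ◁ (f ⊗ g) = (X.fst ◁ f) ⊗ (X.snd ◁ g)`. -/
noncomputable def whiskerLeftMap (X Y Z : LinProd K A B) :
    ((Y.fst ⟶ Z.fst) ⊗[K] (Y.snd ⟶ Z.snd)) →ₗ[K]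
      ((X.fst ⊗ Y.fst ⟶ X.fst ⊗ Z.fst) ⊗[K] (X.snd ⊗ Y.snd ⟶ X.snd ⊗ Z.snd)) :=
  TensorProduct.map ((tensorLeft X.fst).mapLinearMap K) ((tensorLeft X.snd).mapLinearMap K)

/-- Right whiskering in `A ⊗_K B`, determined by `(f ⊗ g) ▷ X = (f ▷ X.fst) ⊗ (g ▷ X.snd)`. -/
noncomputable def whiskerRightMap (X Y Z : LinProd K A B) :
    ((Y.fst ⟶ Z.fst) ⊗[K] (Y.snd ⟶ Z.snd)) →ₗ[K]
      ((Y.fst ⊗ X.fst ⟶ Z.fst ⊗ X.fst) ⊗[K] (Y.snd ⊗ X.snd ⟶ Z.snd ⊗ X.snd)) :=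
  TensorProduct.map ((tensorRight X.fst).mapLinearMap K) ((tensorRight X.snd).mapLinearMap K)

noncomputable instance instMonoidalStruct : MonoidalCategoryStruct (LinProd K A B) where
  tensorObj X Y := ⟨X.fst ⊗ Y.fst, X.snd ⊗ Y.snd⟩
  whiskerLeft X Y Z f := whiskerLeftMap X Y Z f
  whiskerRight {Y Z} f X := whiskerRightMap X Y Z f
  tensorUnit := ⟨𝟙_ A, 𝟙_ B⟩
  associator X Y Z := isoMk (α_ X.fst Y.fst Z.fst) (α_ X.snd Y.snd Z.snd)
  leftUnitor X := isoMk (λ_ X.fst) (λ_ X.snd)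
  rightUnitor X := isoMk (ρ_ X.fst) (ρ_ X.snd)

@[simp]
lemma whiskerLeft_tmul (X : LinProd K A B) {Y Z : LinProd K A B} (f : Y.fst ⟶ Z.fst)
    (g : Y.snd ⟶ Z.snd) : X ◁ tmul K f g = tmul K (X.fst ◁ f) (X.snd ◁ g) := rfl

@[simp]
lemma tmul_whiskerRight {Y Z : LinProd K A B} (f : Y.fst ⟶ Z.fst) (g : Y.snd ⟶ Z.snd)
    (X : LinProd K A B) : tmul K f g ▷ X = tmul K (f ▷ X.fst) (g ▷ X.snd) := rfl

lemma whiskerLeft_zero' (X Y Z : LinProd K A B) : X ◁ (0 : Y ⟶ Z) = 0 :=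
  map_zero (whiskerLeftMap X Y Z)

lemma zero_whiskerRight' (X Y Z : LinProd K A B) : (0 : Y ⟶ Z) ▷ X = 0 :=
  map_zero (whiskerRightMap X Y Z)

lemma whiskerLeft_add' (X : LinProd K A B) {Y Z : LinProd K A B} (f g : Y ⟶ Z) :
    X ◁ (f + g) = X ◁ f + X ◁ g := map_add (whiskerLeftMap X Y Z) f g

lemma add_whiskerRight' {Y Z : LinProd K A B} (f g : Y ⟶ Z) (X : LinProd K A B) :
    (f + g) ▷ X = f ▷ X + g ▷ X := map_add (whiskerRightMap X Y Z) f g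

@[simp]
lemma tmul_tensorHom_tmul {X Y X' Y' : LinProd K A B} (f : X.fst ⟶ Y.fst) (g : X.snd ⟶ Y.snd)
    (f' : X'.fst ⟶ Y'.fst) (g' : X'.snd ⟶ Y'.snd) :
    tmul K f g ⊗ₘ tmul K f' g' = tmul K (f ⊗ₘ f') (g ⊗ₘ g') := by
  rw [tensorHom_def f f', tensorHom_def g g']
  exact tmul_comp (X := X ⊗ X') (Y := Y ⊗ X') (Z := Y ⊗ Y') _ _ _ _

lemma zero_tensorHom' {X Y X' Y' : LinProd K A B} (g : X' ⟶ Y') : (0 : X ⟶ Y) ⊗ₘ g = 0 := by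
  change (0 : X ⟶ Y) ▷ X' ≫ Y ◁ g = 0
  rw [zero_whiskerRight', zero_comp]

lemma tensorHom_zero' {X Y X' Y' : LinProd K A B} (f : X ⟶ Y) : f ⊗ₘ (0 : X' ⟶ Y') = 0 := by
  change f ▷ X' ≫ Y ◁ (0 : X' ⟶ Y') = 0
  rw [whiskerLeft_zero', comp_zero]

lemma add_tensorHom' {X Y X' Y' : LinProd K A B} (f f' : X ⟶ Y) (g : X' ⟶ Y') :
    (f + f') ⊗ₘ g = f ⊗ₘ g + f' ⊗ₘ g := by
  change (f + f') ▷ X' ≫ Y ◁ g = f ▷ X' ≫ Y ◁ g + f' ▷ X' ≫ Y ◁ g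
  rw [add_whiskerRight', Preadditive.add_comp]

lemma tensorHom_add' {X Y X' Y' : LinProd K A B} (f : X ⟶ Y) (g g' : X' ⟶ Y') :
    f ⊗ₘ (g + g') = f ⊗ₘ g + f ⊗ₘ g' := by
  change f ▷ X' ≫ Y ◁ (g + g') = f ▷ X' ≫ Y ◁ g + f ▷ X' ≫ Y ◁ g'
  rw [whiskerLeft_add', Preadditive.comp_add]

lemma tensorHom_comp' {X₁ Y₁ Z₁ X₂ Y₂ Z₂ : LinProd K A B} (f₁ : X₁ ⟶ Y₁) (f₂ : X₂ ⟶ Y₂)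
    (g₁ : Y₁ ⟶ Z₁) (g₂ : Y₂ ⟶ Z₂) : (f₁ ⊗ₘ f₂) ≫ (g₁ ⊗ₘ g₂) = (f₁ ≫ g₁) ⊗ₘ (f₂ ≫ g₂) := by
  induction f₁ using hom_induction with
  | zero => simp only [zero_comp, zero_tensorHom']
  | add f f' hf hf' => simp only [Preadditive.add_comp, add_tensorHom', hf, hf']
  | tmul a a' =>
    induction f₂ using hom_induction with
    | zero => simp only [zero_comp, tensorHom_zero']
    | add f f' hf hf' => simp only [Preadditive.add_comp, tensorHom_add', hf, hf']
    | tmul b b' =>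
      induction g₁ using hom_induction with
      | zero => simp only [comp_zero, zero_tensorHom']
      | add f f' hf hf' => simp only [Preadditive.comp_add, add_tensorHom', hf, hf']
      | tmul c c' =>
        induction g₂ using hom_induction with
        | zero => simp only [comp_zero, tensorHom_zero']
        | add f f' hf hf' => simp only [Preadditive.comp_add, tensorHom_add', hf, hf']
        | tmul d d' =>
          rw [tmul_tensorHom_tmul, tmul_tensorHom_tmul, tmul_comp a a' c c',
            tmul_comp b b' d d', tmul_tensorHom_tmul, ← tensorHom_comp_tensorHom a b c d,
            ← tensorHom_comp_tensorHom a' b' c' d']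
          exact tmul_comp (X := X₁ ⊗ X₂) (Y := Y₁ ⊗ Y₂) (Z := Z₁ ⊗ Z₂) _ _ _ _

/-- The monoidal structure on `A ⊗_K B`: `(a, b) ⊗ (a', b') = (a ⊗ a', b ⊗ b')` on objects,
`(f ⊗ g) ⊗ (f' ⊗ g') = (f ⊗ f') ⊗ (g ⊗ g')` on morphisms, and unit `(1, 1)`. -/
noncomputable instance instMonoidal : MonoidalCategory (LinProd K A B) where
  tensorHom_def _ _ := rfl
  id_tensorHom_id X Y := by
    rw [← tmul_id, ← tmul_id, tmul_tensorHom_tmul, id_tensorHom_id, id_tensorHom_id]; rfl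
  tensorHom_comp_tensorHom f₁ f₂ g₁ g₂ := tensorHom_comp' f₁ f₂ g₁ g₂
  whiskerLeft_id X Y := by
    rw [← tmul_id, whiskerLeft_tmul, whiskerLeft_id, whiskerLeft_id]; rfl
  id_whiskerRight X Y := by
    rw [← tmul_id, tmul_whiskerRight, id_whiskerRight, id_whiskerRight]; rfl
  associator_naturality {X₁ X₂ X₃ Y₁ Y₂ Y₃} f g h := by
    induction f using hom_induction with
    | zero => simp only [zero_comp, comp_zero, zero_tensorHom']
    | add f f' hf hf' => simp only [Preadditive.add_comp, Preadditive.comp_add, add_tensorHom',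
        hf, hf']
    | tmul a a' =>
      induction g using hom_induction with
      | zero => simp only [zero_comp, comp_zero, zero_tensorHom', tensorHom_zero']
      | add f f' hf hf' => simp only [Preadditive.add_comp, Preadditive.comp_add, add_tensorHom',
          tensorHom_add', hf, hf']
      | tmul b b' =>
        induction h using hom_induction with
        | zero => simp only [zero_comp, comp_zero, tensorHom_zero']
        | add f f' hf hf' => simp only [Preadditive.add_comp, Preadditive.comp_add,
            tensorHom_add', hf, hf']
        | tmul c c' =>
          have h₁ : (tmul K a a' ⊗ₘ tmul K b b') ⊗ₘ tmul K c c' = tmul K (X := (X₁ ⊗ X₂) ⊗ X₃)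
              (Y := (Y₁ ⊗ Y₂) ⊗ Y₃) ((a ⊗ₘ b) ⊗ₘ c) ((a' ⊗ₘ b') ⊗ₘ c') := by
            rw [tmul_tensorHom_tmul]
            exact tmul_tensorHom_tmul (X := X₁ ⊗ X₂) (Y := Y₁ ⊗ Y₂) _ _ _ _
          have h₂ : tmul K a a' ⊗ₘ tmul K b b' ⊗ₘ tmul K c c' = tmul K (X := X₁ ⊗ X₂ ⊗ X₃)
              (Y := Y₁ ⊗ Y₂ ⊗ Y₃) (a ⊗ₘ b ⊗ₘ c) (a' ⊗ₘ b' ⊗ₘ c') := by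
            rw [tmul_tensorHom_tmul (X := X₂)]
            exact tmul_tensorHom_tmul (X' := X₂ ⊗ X₃) (Y' := Y₂ ⊗ Y₃) _ _ _ _
          rw [h₁, h₂]
          exact (tmul_comp (X := (X₁ ⊗ X₂) ⊗ X₃) (Y := (Y₁ ⊗ Y₂) ⊗ Y₃) (Z := Y₁ ⊗ Y₂ ⊗ Y₃)
            _ _ _ _).trans ((congrArg₂ (tmul K) (associator_naturality a b c)
            (associator_naturality a' b' c')).trans (tmul_comp (X := (X₁ ⊗ X₂) ⊗ X₃)
            (Y := X₁ ⊗ X₂ ⊗ X₃) (Z := Y₁ ⊗ Y₂ ⊗ Y₃) _ _ _ _).symm)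
  leftUnitor_naturality {X Y} f := by
    induction f using hom_induction with
    | zero => rw [whiskerLeft_zero', zero_comp, comp_zero]
    | add f f' hf hf' => rw [whiskerLeft_add', Preadditive.add_comp, Preadditive.comp_add, hf, hf']
    | tmul a a' =>
      exact (tmul_comp (X := 𝟙_ _ ⊗ X) (Y := 𝟙_ _ ⊗ Y) (Z := Y) _ _ _ _).trans
        ((congrArg₂ (tmul K) (leftUnitor_naturality a) (leftUnitor_naturality a')).trans
        (tmul_comp (X := 𝟙_ _ ⊗ X) (Y := X) (Z := Y) _ _ _ _).symm)
  rightUnitor_naturality {X Y} f := by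
    induction f using hom_induction with
    | zero => rw [zero_whiskerRight', zero_comp, comp_zero]
    | add f f' hf hf' => rw [add_whiskerRight', Preadditive.add_comp, Preadditive.comp_add, hf, hf']
    | tmul a a' =>
      exact (tmul_comp (X := X ⊗ 𝟙_ _) (Y := Y ⊗ 𝟙_ _) (Z := Y) _ _ _ _).trans
        ((congrArg₂ (tmul K) (rightUnitor_naturality a) (rightUnitor_naturality a')).trans
        (tmul_comp (X := X ⊗ 𝟙_ _) (Y := X) (Z := Y) _ _ _ _).symm)
  pentagon W X Y Z := by
    have h := congrArg₂ (fun a b => tmul K (X := ((W ⊗ X) ⊗ Y) ⊗ Z) (Y := W ⊗ X ⊗ Y ⊗ Z) a b)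
      (pentagon W.fst X.fst Y.fst Z.fst) (pentagon W.snd X.snd Y.snd Z.snd)
    refine Eq.trans ?_ (h.trans ?_)
    · refine (congrArg _ (tmul_comp (X := (W ⊗ X ⊗ Y) ⊗ Z) (Y := W ⊗ (X ⊗ Y) ⊗ Z)
        (Z := W ⊗ X ⊗ Y ⊗ Z) _ _ _ _)).trans ?_
      exact tmul_comp (X := ((W ⊗ X) ⊗ Y) ⊗ Z) (Y := (W ⊗ X ⊗ Y) ⊗ Z) (Z := W ⊗ X ⊗ Y ⊗ Z) _ _ _ _
    · exact (tmul_comp (X := ((W ⊗ X) ⊗ Y) ⊗ Z) (Y := (W ⊗ X) ⊗ Y ⊗ Z)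
        (Z := W ⊗ X ⊗ Y ⊗ Z) _ _ _ _).symm
  triangle X Y := by
    refine (tmul_comp (X := (X ⊗ 𝟙_ _) ⊗ Y) (Y := X ⊗ 𝟙_ _ ⊗ Y) (Z := X ⊗ Y) _ _ _ _).trans ?_
    exact congrArg₂ (fun a b => tmul K (X := (X ⊗ 𝟙_ _) ⊗ Y) (Y := X ⊗ Y) a b)
      (triangle X.fst Y.fst) (triangle X.snd Y.snd)

instance instMonoidalPreadditive : MonoidalPreadditive (LinProd K A B) where
  whiskerLeft_zero := whiskerLeft_zero' _ _ _
  zero_whiskerRight := zero_whiskerRight' _ _ _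
  whiskerLeft_add := whiskerLeft_add' _
  add_whiskerRight f g := add_whiskerRight' f g _

instance instMonoidalLinear : MonoidalLinear K (LinProd K A B) where
  whiskerLeft_smul X Y Z r f := (whiskerLeftMap X Y Z).map_smul r f
  smul_whiskerRight r Y Z f X := (whiskerRightMap X Y Z).map_smul r f

end LinProd

variable (K : Type v) [CommRing K]
  {A : Type u₁} [Category.{v} A] [Preadditive A] [Linear K A]
  [MonoidalCategory A] [MonoidalPreadditive A] [MonoidalLinear K A] [SymmetricCategory A]
  {B : Type u₂} [Category.{v} B] [Preadditive B] [Linear K B]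
  [MonoidalCategory B] [MonoidalPreadditive B] [MonoidalLinear K B] [SymmetricCategory B]

namespace LinProd

variable {K}

/-- The componentwise symmetry on `A ⊗_K B`. -/
noncomputable instance instSymmetric : SymmetricCategory (LinProd K A B) where
  braiding X Y := isoMk (β_ X.fst Y.fst) (β_ X.snd Y.snd)
  braiding_naturality_right X Y Z f := by
    induction f using hom_induction with
    | zero => rw [whiskerLeft_zero', zero_whiskerRight', zero_comp, comp_zero]
    | add f f' hf hf' => rw [whiskerLeft_add', add_whiskerRight', Preadditive.add_comp,
        Preadditive.comp_add, hf, hf']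
    | tmul a a' =>
      exact (tmul_comp (X := X ⊗ Y) (Y := X ⊗ Z) (Z := Z ⊗ X) _ _ _ _).trans
        ((congrArg₂ (tmul K) (BraidedCategory.braiding_naturality_right X.fst a)
          (BraidedCategory.braiding_naturality_right X.snd a')).trans
        (tmul_comp (X := X ⊗ Y) (Y := Y ⊗ X) (Z := Z ⊗ X) _ _ _ _).symm)
  braiding_naturality_left {X Y} f Z := by
    induction f using hom_induction with
    | zero => rw [whiskerLeft_zero', zero_whiskerRight', zero_comp, comp_zero]
    | add f f' hf hf' => rw [whiskerLeft_add', add_whiskerRight', Preadditive.add_comp,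
        Preadditive.comp_add, hf, hf']
    | tmul a a' =>
      exact (tmul_comp (X := X ⊗ Z) (Y := Y ⊗ Z) (Z := Z ⊗ Y) _ _ _ _).trans
        ((congrArg₂ (tmul K) (BraidedCategory.braiding_naturality_left a Z.fst)
          (BraidedCategory.braiding_naturality_left a' Z.snd)).trans
        (tmul_comp (X := X ⊗ Z) (Y := Z ⊗ X) (Z := Z ⊗ Y) _ _ _ _).symm)
  hexagon_forward X Y Z := by
    have h := congrArg₂ (fun a b => tmul K (X := (X ⊗ Y) ⊗ Z) (Y := Y ⊗ Z ⊗ X) a b)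
      (BraidedCategory.hexagon_forward X.fst Y.fst Z.fst)
      (BraidedCategory.hexagon_forward X.snd Y.snd Z.snd)
    refine Eq.trans ?_ (h.trans (Eq.symm ?_))
    · refine (congrArg _ (tmul_comp (X := X ⊗ Y ⊗ Z) (Y := (Y ⊗ Z) ⊗ X) (Z := Y ⊗ Z ⊗ X)
        _ _ _ _)).trans ?_
      exact tmul_comp (X := (X ⊗ Y) ⊗ Z) (Y := X ⊗ Y ⊗ Z) (Z := Y ⊗ Z ⊗ X) _ _ _ _
    · refine (congrArg _ (tmul_comp (X := (Y ⊗ X) ⊗ Z) (Y := Y ⊗ X ⊗ Z) (Z := Y ⊗ Z ⊗ X)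
        _ _ _ _)).trans ?_
      exact tmul_comp (X := (X ⊗ Y) ⊗ Z) (Y := (Y ⊗ X) ⊗ Z) (Z := Y ⊗ Z ⊗ X) _ _ _ _
  hexagon_reverse X Y Z := by
    have h := congrArg₂ (fun a b => tmul K (X := X ⊗ Y ⊗ Z) (Y := (Z ⊗ X) ⊗ Y) a b)
      (BraidedCategory.hexagon_reverse X.fst Y.fst Z.fst)
      (BraidedCategory.hexagon_reverse X.snd Y.snd Z.snd)
    refine Eq.trans ?_ (h.trans (Eq.symm ?_))
    · refine (congrArg _ (tmul_comp (X := (X ⊗ Y) ⊗ Z) (Y := Z ⊗ X ⊗ Y) (Z := (Z ⊗ X) ⊗ Y)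
        _ _ _ _)).trans ?_
      exact tmul_comp (X := X ⊗ Y ⊗ Z) (Y := (X ⊗ Y) ⊗ Z) (Z := (Z ⊗ X) ⊗ Y) _ _ _ _
    · refine (congrArg _ (tmul_comp (X := X ⊗ Z ⊗ Y) (Y := (X ⊗ Z) ⊗ Y) (Z := (Z ⊗ X) ⊗ Y)
        _ _ _ _)).trans ?_
      exact tmul_comp (X := X ⊗ Y ⊗ Z) (Y := X ⊗ Z ⊗ Y) (Z := (Z ⊗ X) ⊗ Y) _ _ _ _
  symmetry X Y := by
    refine (tmul_comp (X := X ⊗ Y) (Y := Y ⊗ X) (Z := X ⊗ Y) _ _ _ _).trans ?_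
    exact congrArg₂ (fun a b => tmul K (X := X ⊗ Y) (Y := X ⊗ Y) a b)
      (SymmetricCategory.symmetry X.fst Y.fst) (SymmetricCategory.symmetry X.snd Y.snd)

end LinProd

variable (A B)

/-- The functor `A × B → A ⊗_K B`, `(a, b) ↦ (a, b)` and `(f, g) ↦ f ⊗ g`. -/
noncomputable def toLinProd : A × B ⥤ LinProd K A B where
  obj X := ⟨X.1, X.2⟩
  map f := LinProd.tmul K f.1 f.2
  map_id _ := rfl
  map_comp {X Y Z} f g :=
    (LinProd.tmul_comp (X := ⟨X.1, X.2⟩) (Y := ⟨Y.1, Y.2⟩) (Z := ⟨Z.1, Z.2⟩) f.1 f.2 g.1 g.2).symm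

/-- The functor `A × B → A ⊗_K B` is strict monoidal. -/
noncomputable instance toLinProdMonoidal : (toLinProd K A B).Monoidal :=
  Functor.CoreMonoidal.toMonoidal
    { εIso := Iso.refl _
      μIso := fun X Y => Iso.refl _
      μIso_hom_natural_left := fun {X Y} f Z => (Category.comp_id
        ((toLinProd K A B).map f ▷ (toLinProd K A B).obj Z)).trans (Category.id_comp _).symm
      μIso_hom_natural_right := fun {X Y} Z f => (Category.comp_id
        ((toLinProd K A B).obj Z ◁ (toLinProd K A B).map f)).trans (Category.id_comp _).symm
      associativity := fun X Y Z => by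
        let F := toLinProd K A B
        change 𝟙 (F.obj X ⊗ F.obj Y) ▷ F.obj Z ≫ 𝟙 ((F.obj X ⊗ F.obj Y) ⊗ F.obj Z) ≫
          (α_ (F.obj X) (F.obj Y) (F.obj Z)).hom = (α_ (F.obj X) (F.obj Y) (F.obj Z)).hom ≫
            F.obj X ◁ 𝟙 (F.obj Y ⊗ F.obj Z) ≫ 𝟙 (F.obj X ⊗ F.obj Y ⊗ F.obj Z)
        simp
      left_unitality := fun X => by
        let F := toLinProd K A B
        change (λ_ (F.obj X)).hom = 𝟙 (𝟙_ (LinProd K A B)) ▷ F.obj X ≫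
          𝟙 (𝟙_ (LinProd K A B) ⊗ F.obj X) ≫ (λ_ (F.obj X)).hom
        simp
      right_unitality := fun X => by
        let F := toLinProd K A B
        change (ρ_ (F.obj X)).hom = F.obj X ◁ 𝟙 (𝟙_ (LinProd K A B)) ≫
          𝟙 (F.obj X ⊗ 𝟙_ (LinProd K A B)) ≫ (ρ_ (F.obj X)).hom
        simp }

noncomputable instance toLinProdBraided : (toLinProd K A B).Braided where
  braided X Y := (Category.id_comp
    (β_ ((toLinProd K A B).obj X) ((toLinProd K A B).obj Y)).hom).trans (Category.comp_id _).symm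

end LinearTensor

/-- The `K`-linear tensor category `A ⊗_K B`. -/
noncomputable def LinTensorCat.tensor (K : Type v) [CommRing K] (A B : LinTensorCat.{v} K) :
    LinTensorCat.{v} K where
  carrier := LinProd K A.carrier B.carrier

/-- The tensor functor `A × B → A ⊗_K B`, `(a, b) ↦ (a, b)`. -/
noncomputable def LinTensorCat.toTensor (K : Type v) [CommRing K] (A B : LinTensorCat.{v} K) :
    TensorFunctor (A.toTensorCat.prod B.toTensorCat) (tensor K A B).toTensorCat :=
  TensorFunctor.mk (A := A.toTensorCat.prod B.toTensorCat) (B := (tensor K A B).toTensorCat)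
    (toLinProd K A.carrier B.carrier) (braided := toLinProdBraided K A.carrier B.carrier)

/-- The `K`-linear tensor functor `A → A ⊗_K B`, `a ↦ (a, 1)`, `f ↦ f ⊗ id`. -/
noncomputable def LinTensorCat.inl (K : Type v) [CommRing K] (A B : LinTensorCat.{v} K) :
    A ⟶ tensor K A B where
  hom := A.toTensorCat.inl B.toTensorCat ≫ toTensor K A B
  mem := ⟨⟨LinProd.tmul_add_left (K := K) _ _ _⟩,
    ⟨fun {X Y} f r => LinProd.tmul_smul_left (X := ⟨X, 𝟙_ B.carrier⟩) (Y := ⟨Y, 𝟙_ B.carrier⟩)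
      r f (𝟙 (𝟙_ B.carrier))⟩⟩

/-- The `K`-linear tensor functor `B → A ⊗_K B`, `b ↦ (1, b)`, `g ↦ id ⊗ g`. -/
noncomputable def LinTensorCat.inr (K : Type v) [CommRing K] (A B : LinTensorCat.{v} K) :
    B ⟶ tensor K A B where
  hom := A.toTensorCat.inr B.toTensorCat ≫ toTensor K A B
  mem := ⟨⟨LinProd.tmul_add_right (K := K) _ _ _⟩,
    ⟨fun {X Y} f r => LinProd.tmul_smul_right (X := ⟨𝟙_ A.carrier, X⟩) (Y := ⟨𝟙_ A.carrier, Y⟩)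
      r (𝟙 (𝟙_ A.carrier)) f⟩⟩

section CocontinuousTensor

variable {A B P : Type (v + 1)} [Category.{v} A] [Category.{v} B] [Category.{v} P]
  (C : Type (v + 1)) [Category.{v} C]

variable (A B) in
/-- The functors on `A × B` that are finitely cocontinuous in each variable. -/
def biCocontinuous : ObjectProperty (A × B ⥤ C) := fun F =>
  (∀ a : A, PreservesFiniteColimits (Prod.sectR a B ⋙ F)) ∧
    ∀ b : B, PreservesFiniteColimits (Prod.sectL A b ⋙ F)

/-- Restriction of finitely cocontinuous functors along a functor `t` on `A × B` which is finitely
cocontinuous in each variable. -/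
def restrictFc (t : A × B ⥤ P) (ht : biCocontinuous A B P t) :
    (P ⥤ᵣ C) ⥤ (biCocontinuous A B C).FullSubcategory :=
  ObjectProperty.lift _ (RightExactFunctor.forget P C ⋙ (Functor.whiskeringLeft _ _ C).obj t)
    fun G => by
      have : PreservesFiniteColimits G.obj := G.property
      refine ⟨fun a => ?_, fun b => ?_⟩
      · have := ht.1 a
        exact comp_preservesFiniteColimits (Prod.sectR a B ⋙ t) G.obj
      · have := ht.2 b
        exact comp_preservesFiniteColimits (Prod.sectL A b ⋙ t) G.obj

/-- The functor `t : A × B → P` exhibits `P` as the tensor product `A ⊠ B` of finitely cocomplete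
categories: `P` is essentially small and finitely cocomplete, `t` is finitely cocontinuous in each
variable, and for every essentially small finitely cocomplete category `C`, restriction along `t`
is an equivalence from the category of finitely cocontinuous functors `P → C` to the category of
functors `A × B → C` which are finitely cocontinuous in each variable. -/
structure IsFcTensorProduct (t : A × B ⥤ P) : Prop where
  essentiallySmall : EssentiallySmall.{v} P
  hasFiniteColimits : HasFiniteColimits P
  biCocontinuous : biCocontinuous A B P t
  universal : ∀ (C : Type (v + 1)) [Category.{v} C] [EssentiallySmall.{v} C] [HasFiniteColimits C],
    (restrictFc C t biCocontinuous).IsEquivalence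

variable (K : Type v) [CommRing K] [Preadditive A] [Linear K A] [Preadditive B] [Linear K B]
  [Preadditive P] [Linear K P] [Preadditive C] [Linear K C]

/-- The finitely cocontinuous `K`-linear functors. -/
def fcLinear : ObjectProperty (P ⥤ C) := fun F =>
  PreservesFiniteColimits F ∧ F.Additive ∧ F.Linear K

variable (A B) in
/-- The functors on `A × B` that are finitely cocontinuous and `K`-linear in each variable. -/
def biFcLinear : ObjectProperty (A × B ⥤ C) := fun F =>
  (∀ a : A, fcLinear C K (Prod.sectR a B ⋙ F)) ∧ ∀ b : B, fcLinear C K (Prod.sectL A b ⋙ F)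

variable {K} in
/-- Restriction of finitely cocontinuous `K`-linear functors along a functor `t` on `A × B` which
is finitely cocontinuous and `K`-linear in each variable. -/
def restrictFcLinear (t : A × B ⥤ P) (ht : biFcLinear A B P K t) :
    (fcLinear (P := P) C K).FullSubcategory ⥤ (biFcLinear A B C K).FullSubcategory :=
  ObjectProperty.lift _ ((fcLinear (P := P) C K).ι ⋙ (Functor.whiskeringLeft _ _ C).obj t)
    fun G => by
      obtain ⟨_, _, _⟩ := G.property
      refine ⟨fun a => ?_, fun b => ?_⟩
      · obtain ⟨_, _, _⟩ := ht.1 a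
        exact ⟨comp_preservesFiniteColimits (Prod.sectR a B ⋙ t) G.obj,
          inferInstanceAs ((Prod.sectR a B ⋙ t) ⋙ G.obj).Additive,
          inferInstanceAs (((Prod.sectR a B ⋙ t) ⋙ G.obj).Linear K)⟩
      · obtain ⟨_, _, _⟩ := ht.2 b
        exact ⟨comp_preservesFiniteColimits (Prod.sectL A b ⋙ t) G.obj,
          inferInstanceAs ((Prod.sectL A b ⋙ t) ⋙ G.obj).Additive,
          inferInstanceAs (((Prod.sectL A b ⋙ t) ⋙ G.obj).Linear K)⟩

/-- The functor `t : A × B → P` exhibits `P` as the tensor product `A ⊠_K B` of finitely cocomplete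
`K`-linear categories: it classifies the functors on `A × B` which are finitely cocontinuous and
`K`-linear in each variable. -/
structure IsFcLinTensorProduct (t : A × B ⥤ P) : Prop where
  essentiallySmall : EssentiallySmall.{v} P
  hasFiniteColimits : HasFiniteColimits P
  biFcLinear : biFcLinear A B P K t
  universal : ∀ (C : Type (v + 1)) [Category.{v} C] [EssentiallySmall.{v} C] [HasFiniteColimits C]
    [Preadditive C] [Linear K C], (restrictFcLinear C t biFcLinear).IsEquivalence

end CocontinuousTensor

/-- The tensor functor `t : A × B → P` exhibits the underlying category of `P` as `A ⊠ B`, so that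
`P` is `A ⊠ B` with its induced tensor structure: `1 ≅ 1 ⊠ 1` and
`(a ⊠ b) ⊗ (a' ⊠ b') ≅ (a ⊗ a') ⊠ (b ⊗ b')`. -/
def FcTensorCat.IsTensor {A B P : FcTensorCat.{v}}
    (t : A.toTensorCat.prod B.toTensorCat ⟶ P.toTensorCat) : Prop :=
  IsFcTensorProduct (A := A.carrier) (B := B.carrier) t.functor

/-- The finitely cocontinuous tensor functor `A → A ⊠ B`, `a ↦ a ⊠ 1`. -/
def FcTensorCat.inl {A B P : FcTensorCat.{v}}
    (t : A.toTensorCat.prod B.toTensorCat ⟶ P.toTensorCat) (ht : IsTensor t) : A ⟶ P where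
  hom := A.toTensorCat.inl B.toTensorCat ≫ t
  mem := ht.biCocontinuous.2 (𝟙_ B.carrier)

/-- The finitely cocontinuous tensor functor `B → A ⊠ B`, `b ↦ 1 ⊠ b`. -/
def FcTensorCat.inr {A B P : FcTensorCat.{v}}
    (t : A.toTensorCat.prod B.toTensorCat ⟶ P.toTensorCat) (ht : IsTensor t) : B ⟶ P where
  hom := A.toTensorCat.inr B.toTensorCat ≫ t
  mem := ht.biCocontinuous.1 (𝟙_ A.carrier)

/-- The tensor functor `t : A × B → P` exhibits the underlying category of `P` as `A ⊠_K B`, so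
that `P` is `A ⊠_K B` with its induced tensor structure. -/
def FcLinTensorCat.IsTensor {K : Type v} [CommRing K] {A B P : FcLinTensorCat.{v} K}
    (t : A.toTensorCat.prod B.toTensorCat ⟶ P.toTensorCat) : Prop :=
  IsFcLinTensorProduct (A := A.carrier) (B := B.carrier) K t.functor

/-- The finitely cocontinuous `K`-linear tensor functor `A → A ⊠_K B`, `a ↦ a ⊠ 1`. -/
def FcLinTensorCat.inl {K : Type v} [CommRing K] {A B P : FcLinTensorCat.{v} K}
    (t : A.toTensorCat.prod B.toTensorCat ⟶ P.toTensorCat) (ht : IsTensor t) : A ⟶ P where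
  hom := A.toTensorCat.inl B.toTensorCat ≫ t
  mem := ht.biFcLinear.2 (𝟙_ B.carrier)

/-- The finitely cocontinuous `K`-linear tensor functor `B → A ⊠_K B`, `b ↦ 1 ⊠ b`. -/
def FcLinTensorCat.inr {K : Type v} [CommRing K] {A B P : FcLinTensorCat.{v} K}
    (t : A.toTensorCat.prod B.toTensorCat ⟶ P.toTensorCat) (ht : IsTensor t) : B ⟶ P where
  hom := A.toTensorCat.inr B.toTensorCat ≫ t
  mem := ht.biFcLinear.1 (𝟙_ A.carrier)

end TensorCats

/-!
The coproduct of tensor categories `A` and `B` is `A × B`: the object `(a, b)` is isomorphic to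
`(a, 1) ⊗ (1, b)`, so a tensor functor `F` on `A × B` is naturally isomorphic to
`(a, b) ↦ F (a, 1) ⊗ F (1, b)` (`decompose`), and the symmetry of the target makes this isomorphism
monoidal. Hence `(G, H) ↦ ((a, b) ↦ G a ⊗ H b)` (`TensorCat.prodLift`) is inverse to restriction.

The three other cases are reduced to this one along a tensor functor `t : A × B ⥤ P`. Let `P` be
such that the natural transformations between admissible functors on `P` restrict bijectively
along `t`. As precomposing and postcomposing an admissible functor with `- ⊗ x` gives an admissible
functor, this bijectivity can be applied one variable at a time. So natural transformations in
several variables, and equalities between them, extend from the image of `t`; this is the notion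
`Detects`. It follows that a monoidal transformation along `t` extends to a monoidal transformation
(`Detects.bijective_whiskerLeft_tensorTrans`), and that a functor whose restriction along `t` is a
tensor functor is itself one (`Detects.exists_tensorFunctor`). Finally a tensor functor `F` on
`A × B` is cocontinuous or linear in each variable as soon as `F (-, 1)` and `F (1, -)` are, again
by `F (a, b) ≅ F (a, 1) ⊗ F (1, b)`. These facts are put together in
`LocallyFull.isBicategoricalCoproduct`.

What remains is the existence of `A ⊠ B` and `A ⊠_K B` with their tensor structure. Given a small
category `E` with a small family of finite cocones, the presheaves on `E` sending the cocones to
limits form a reflective subcategory of all presheaves. In it, the closure `P` under finite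
colimits of the reflections of the representables is the universal finitely cocomplete category
under `E` in which the cocones become colimits (`CoconeFamily.Completion`). Two properties of `t : E ⥤ P` carry everything
else: every finitely cocontinuous functor on `P` is a pointwise left Kan extension of its
restriction along `t` (`DenseFor`), and every object of `P` is reached from the image of `t` by
finite colimits (`Generates`). Taking `E = A × B` or `E = A ⊗_K B`, with the cocones coming from
finite colimits in one variable, gives the underlying category of `A ⊠ B` or `A ⊠_K B`.

The tensor product of `E` extends to a functor `P ⥤ P ⥤ P` cocontinuous in each variable, by
extending it in one variable after the other (`exists_bifunctor`). The associator, the unitors, the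
symmetry and their coherence laws live between functors which are dense in each variable, so they
are determined on the image of `t`, where they are those of `E` (`TensorData`, `Tensored`).

In the `K`-linear case no enriched completion is needed. In `A ⊗_K B` the pair `(a ⊞ a, b)` is a
biproduct of `(a, b)` with itself, and `t` preserves the underlying coproduct. The sum of two maps
`f, g : t x ⟶ q` is therefore forced to be the composite of `t (inl + inr)` with `[f, g]`, and
by density this defines a preadditive and `K`-linear structure on the completion
(`DiagonalData`).
-/

namespace TensorCats

universe u₁ u₂ u₃ u₄ u₅ w

/-! ### Completing a category under finite colimits relative to given cocones -/

section

open Opposite Cardinal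

section Dense

variable {E : Type u₁} [Category.{v} E] {P : Type u₂} [Category.{v} P]
  {C : Type u₃} [Category.{v} C]

/-- The functor `G` is the pointwise left Kan extension along `t` of its restriction `t ⋙ G`: the
morphisms `G p ⟶ c` are the families of morphisms `G (t e) ⟶ c`, indexed by the `x : t e ⟶ p` and
natural in `(e, x)`. For `G` the identity functor this says that `t` is dense. -/
def DenseFor (t : E ⥤ P) (G : P ⥤ C) : Prop :=
  ∀ (p : P) (c : C) (φ : ∀ e : E, (t.obj e ⟶ p) → (G.obj (t.obj e) ⟶ c)),
    (∀ (e e' : E) (u : e ⟶ e') (x : t.obj e' ⟶ p),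
      φ e (t.map u ≫ x) = G.map (t.map u) ≫ φ e' x) →
    ∃! f : G.obj p ⟶ c, ∀ (e : E) (x : t.obj e ⟶ p), G.map x ≫ f = φ e x

/-- Every object of `P` is obtained from the image of `t` by iterated finite colimits, expressed as
an induction principle: a property which is invariant under isomorphisms, stable under finite
colimits and true on the image of `t` holds everywhere. -/
def Generates (t : E ⥤ P) : Prop :=
  ∀ Q : ObjectProperty P, Q.IsClosedUnderIsomorphisms →
    (∀ (J : Type v) [SmallCategory J] [FinCategory J], Q.IsClosedUnderColimitsOfShape J) →
    (∀ e, Q (t.obj e)) → ∀ p, Q p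

end Dense

/-- A small family of finite diagrams in `E`, each with a cocone. -/
structure CoconeFamily (E : Type u₁) [Category.{v} E] where
  index : Type v
  shape : index → Type v
  [category : ∀ i, SmallCategory (shape i)]
  [finCategory : ∀ i, FinCategory (shape i)]
  diagram : ∀ i, shape i ⥤ E
  cocone : ∀ i, Cocone (diagram i)

attribute [instance] CoconeFamily.category CoconeFamily.finCategory

namespace CoconeFamily

/-- The functor `F` sends every cocone of the family to a colimit cocone. -/
def Sends {E : Type u₁} [Category.{v} E] {C : Type u₃} [Category.{v} C] (Φ : CoconeFamily E)
    (F : E ⥤ C) : Prop :=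
  ∀ i, Nonempty (IsColimit (F.mapCocone (Φ.cocone i)))

variable {E : Type v} [SmallCategory E] (Φ : CoconeFamily.{v} E)

/-- The comparison map from the colimit, in presheaves, of the `i`-th diagram to the presheaf
represented by the point of its cocone. -/
noncomputable def comparison (i : Φ.index) :
    colimit (Φ.diagram i ⋙ yoneda) ⟶ yoneda.obj (Φ.cocone i).pt :=
  colimit.desc _ (yoneda.mapCocone (Φ.cocone i))

/-- The presheaves that send every cocone of the family to a limit cone, encoded as the presheaves
that are local with respect to the comparison maps. -/
abbrev Models : ObjectProperty (Eᵒᵖ ⥤ Type v) :=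
  (MorphismProperty.ofHoms Φ.comparison).isLocal

lemma isCardinalPresentable_yoneda (e : E) :
    have := fact_isRegular_aleph0.{v}
    IsCardinalPresentable (yoneda.obj e) ℵ₀ := by
  have := fact_isRegular_aleph0.{v}
  refine ⟨fun J _ _ => ?_⟩
  let i : coyoneda.obj (op (yoneda.obj e)) ≅ (evaluation _ (Type v)).obj (op e) :=
    NatIso.ofComponents (fun P ↦ Equiv.toIso yonedaEquiv)
  exact preservesColimitsOfShape_of_natIso i.symm

/-- The models form a reflective subcategory, since the comparison maps are maps between finitely
presentable presheaves. -/
instance : Φ.Models.ι.IsRightAdjoint := by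
  have := fact_isRegular_aleph0.{v}
  have := isCardinalPresentable_yoneda (E := E)
  refine MorphismProperty.isRightAdjoint_ι_isLocal _ ℵ₀ ?_
  rintro X Y f ⟨i⟩
  have : ∀ k, IsCardinalPresentable ((Φ.diagram i ⋙ yoneda).obj k) ℵ₀ := fun k =>
    isCardinalPresentable_yoneda _
  exact ⟨isCardinalPresentable_of_isColimit _ (colimit.isColimit _) ℵ₀
    (by rw [hasCardinalLT_aleph0_iff]; infer_instance), inferInstance⟩

noncomputable instance : Reflective Φ.Models.ι where
  L := Φ.Models.ι.leftAdjoint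
  adj := Adjunction.ofIsRightAdjoint _

instance : HasColimits Φ.Models.FullSubcategory := hasColimits_of_reflective Φ.Models.ι

/-- The functor sending `e` to the reflection of the presheaf it represents. -/
noncomputable def toModels : E ⥤ Φ.Models.FullSubcategory := yoneda ⋙ reflector Φ.Models.ι

/-- The Yoneda lemma for models: morphisms from the model of `e` to `S` are elements of `S e`. -/
noncomputable def homEquiv (e : E) {S : Φ.Models.FullSubcategory} :
    (Φ.toModels.obj e ⟶ S) ≃ S.obj.obj (op e) :=
  ((reflectorAdjunction Φ.Models.ι).homEquiv _ _).trans yonedaEquiv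

lemma homEquiv_naturality_left {e e' : E} (u : e ⟶ e') {S : Φ.Models.FullSubcategory}
    (x : Φ.toModels.obj e' ⟶ S) :
    Φ.homEquiv e (Φ.toModels.map u ≫ x) = S.obj.map u.op (Φ.homEquiv e' x) :=
  (congrArg yonedaEquiv ((reflectorAdjunction Φ.Models.ι).homEquiv_naturality_left
    (yoneda.map u) x)).trans (yonedaEquiv_naturality _ u).symm

lemma homEquiv_naturality_right (e : E) {S S' : Φ.Models.FullSubcategory}
    (x : Φ.toModels.obj e ⟶ S) (f : S ⟶ S') :
    Φ.homEquiv e (x ≫ f) = f.hom.app (op e) (Φ.homEquiv e x) :=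
  (congrArg yonedaEquiv ((reflectorAdjunction Φ.Models.ι).homEquiv_naturality_right
    (X := yoneda.obj e) x f)).trans (yonedaEquiv_comp _ _)

attribute [irreducible] homEquiv

lemma sends_toModels : Φ.Sends Φ.toModels := by
  intro i
  let L : _ ⥤ Φ.Models.FullSubcategory := reflector Φ.Models.ι
  have : IsIso (L.map (Φ.comparison i)) := by
    rw [← ObjectProperty.isLocal_iff_isIso_map (reflectorAdjunction Φ.Models.ι)]
    rintro _ ⟨S, rfl⟩
    exact S.property _ ⟨i⟩
  refine ⟨(isColimitOfPreserves L (colimit.isColimit (Φ.diagram i ⋙ yoneda))).ofIsoColimit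
    (Cocone.ext (@asIso _ _ _ _ _ this) fun j => ?_)⟩
  exact (L.map_comp _ _).symm.trans (congrArg L.map (colimit.ι_desc _ _))

/-- The models that are obtained from the models of the objects of `E` by finite colimits. -/
abbrev Generated : ObjectProperty Φ.Models.FullSubcategory :=
  (ObjectProperty.ofObj Φ.toModels.obj).colimitsCardinalClosure (ℵ₀ : Cardinal.{v})

instance (J : Type v) [SmallCategory J] [FinCategory J] :
    Φ.Generated.IsClosedUnderColimitsOfShape J :=
  ObjectProperty.isClosedUnderColimitsOfShape_colimitsCardinalClosure _ _ J
    (by rw [hasCardinalLT_aleph0_iff]; infer_instance)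

/-- The completion of `E` under finite colimits in which the cocones of the family become
colimits. -/
abbrev Completion : Type (v + 1) := Φ.Generated.FullSubcategory

instance : HasFiniteColimits Φ.Completion :=
  hasFiniteColimits_of_hasFiniteColimits_of_size.{v} _ fun _ _ _ => inferInstance

instance : PreservesFiniteColimits Φ.Generated.ι :=
  preservesFiniteColimits_of_preservesFiniteColimitsOfSize.{v} _ fun _ _ _ => inferInstance

instance : EssentiallySmall.{v} Φ.Completion := inferInstance

/-- The canonical functor from `E` to its completion. -/
noncomputable def toCompletion : E ⥤ Φ.Completion :=
  Φ.Generated.lift Φ.toModels fun e =>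
    ObjectProperty.le_colimitsCardinalClosure _ _ _ (ObjectProperty.ofObj_apply _ e)

lemma sends_toCompletion : Φ.Sends Φ.toCompletion := fun i => by
  obtain ⟨h⟩ := Φ.sends_toModels i
  exact ⟨isColimitOfReflects Φ.Generated.ι h⟩

/-- Induction over the generated models, for properties of a model together with the proof that it
is generated. -/
lemma completion_induction (Q : ∀ p, Φ.Generated p → Prop)
    (h₁ : ∀ e h, Q (Φ.toModels.obj e) h)
    (h₂ : ∀ {p q} (_ : p ≅ q) (hp : Φ.Generated p) (hq : Φ.Generated q), Q p hp → Q q hq)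
    (h₃ : ∀ {J : Type v} [SmallCategory J] [FinCategory J] {K : J ⥤ Φ.Completion}
      {c : Cocone K} (_ : IsColimit c), (∀ j, Q (K.obj j).obj (K.obj j).property) →
        Q c.pt.obj c.pt.property) : ∀ p hp, Q p hp := by
  let R : ObjectProperty Φ.Models.FullSubcategory := fun p => ∃ hp, Q p hp
  have : R.IsClosedUnderIsomorphisms :=
    ⟨fun e ⟨hp, h⟩ => ⟨Φ.Generated.prop_of_iso e hp, h₂ e _ _ h⟩⟩
  have hR : Φ.Generated ≤ R := by
    refine ObjectProperty.colimitsCardinalClosure_le _ _ (fun J _ hJ => ⟨?_⟩) ?_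
    · rintro p ⟨h⟩
      obtain ⟨_⟩ := Arrow.finite_iff J |>.1 ((hasCardinalLT_aleph0_iff _).1 hJ)
      choose h' h'' using h.prop_diag_obj
      have hp := Φ.Generated.prop_of_isColimit h.isColimit h'
      refine ⟨hp, h₃ (K := Φ.Generated.lift h.diag h')
        (c := ⟨⟨p, hp⟩, ⟨fun j => ⟨h.ι.app j⟩, fun _ _ f => ?_⟩⟩) ?_ h''⟩
      · ext : 1
        exact h.ι.naturality f
      · exact isColimitOfReflects Φ.Generated.ι h.isColimit
    · rintro _ ⟨e⟩
      have := ObjectProperty.le_colimitsCardinalClosure _ ℵ₀ _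
        (ObjectProperty.ofObj_apply Φ.toModels.obj e)
      exact ⟨this, h₁ e this⟩
  intro p hp
  exact (hR p hp).2

lemma generates_toCompletion : Generates Φ.toCompletion := by
  intro Q _ hQ h p
  refine Φ.completion_induction (fun p hp => Q ⟨p, hp⟩) (fun e _ => h e) ?_ ?_ p.obj p.property
  · intro p q e hp hq h
    exact Q.prop_of_iso (Φ.Generated.isoMk e) h
  · intro J _ _ K c hc h
    have := hQ J
    exact Q.prop_of_isColimit hc h

variable {C : Type u₃} [Category.{v} C]

/-- For a functor `F` sending the cocones to colimits, the functor `c ↦ Hom(F -, c)` with values in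
models. -/
def nerve (F : E ⥤ C) (hF : Φ.Sends F) : C ⥤ Φ.Models.FullSubcategory :=
  Φ.Models.lift (yoneda ⋙ (Functor.whiskeringLeft _ _ _).obj F.op) fun c => by
    rintro _ _ _ ⟨i⟩
    obtain ⟨h⟩ := hF i
    have key : ∀ (j : Φ.shape i) (g : yoneda.obj (Φ.cocone i).pt ⟶ F.op ⋙ yoneda.obj c),
        yonedaEquiv (colimit.ι (Φ.diagram i ⋙ yoneda) j ≫ Φ.comparison i ≫ g) =
          F.map ((Φ.cocone i).ι.app j) ≫ yonedaEquiv g := fun j g => by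
      rw [comparison, colimit.ι_desc_assoc]
      exact (yonedaEquiv_naturality g ((Φ.cocone i).ι.app j)).symm
    refine ⟨fun g g' hg => ?_, fun g => ?_⟩
    · refine yonedaEquiv.injective (h.hom_ext fun j => ?_)
      exact (key j g).symm.trans ((congrArg (fun k => yonedaEquiv
        (colimit.ι (Φ.diagram i ⋙ yoneda) j ≫ k)) hg).trans (key j g'))
    · refine ⟨yonedaEquiv.symm (h.desc ⟨c, ⟨fun j => yonedaEquiv
        (X := (Φ.diagram i).obj j) (F := F.op ⋙ yoneda.obj c)
        (colimit.ι (Φ.diagram i ⋙ yoneda) j ≫ g), fun j j' f => ?_⟩⟩), ?_⟩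
      · have := yonedaEquiv_naturality (F := F.op ⋙ yoneda.obj c)
          (colimit.ι (Φ.diagram i ⋙ yoneda) j' ≫ g) ((Φ.diagram i).map f)
        refine this.trans ?_
        have h2 := colimit.w (Φ.diagram i ⋙ yoneda) f
        dsimp at h2 ⊢
        rw [reassoc_of% h2, Category.comp_id]
      · refine colimit.hom_ext fun j => yonedaEquiv.injective ?_
        refine (key j _).trans ?_
        rw [Equiv.apply_symm_apply]
        exact h.fac _ j

/-- By the Yoneda lemma, a natural family of morphisms `F e ⟶ c`, indexed by the `x` from the model
of `e` to `S`, comes from a morphism from `S` to the nerve of `c`. -/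
lemma exists_hom_nerve (F : E ⥤ C) (hF : Φ.Sends F) (S : Φ.Models.FullSubcategory) (c : C)
    (φ : ∀ e : E, (Φ.toModels.obj e ⟶ S) → (F.obj e ⟶ c))
    (hφ : ∀ (e e' : E) (u : e ⟶ e') (x : Φ.toModels.obj e' ⟶ S),
      φ e (Φ.toModels.map u ≫ x) = F.map u ≫ φ e' x) :
    ∃ g : S ⟶ (Φ.nerve F hF).obj c, ∀ e (x : Φ.toModels.obj e ⟶ S),
      Φ.homEquiv e (x ≫ g) = φ e x := by
  let g : S.obj ⟶ F.op ⋙ yoneda.obj c :=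
    { app := fun e => ↾fun s => φ e.unop ((Φ.homEquiv e.unop).symm s)
      naturality := fun e e' u => by
        ext s
        obtain ⟨x, rfl⟩ := (Φ.homEquiv e.unop).surjective s
        refine Eq.trans ?_ ((congrArg (φ _) ((Φ.homEquiv _).symm_apply_eq.2
          (Φ.homEquiv_naturality_left u.unop x).symm)).trans ((hφ _ _ u.unop x).trans ?_))
        · rfl
        · exact congrArg (fun y => F.map u.unop ≫ φ _ y) ((Φ.homEquiv _).symm_apply_apply x).symm }
  refine ⟨⟨g⟩, fun e x => ?_⟩
  rw [homEquiv_naturality_right]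
  exact congrArg (φ e) ((Φ.homEquiv e).symm_apply_apply x)

/-- Natural families indexed by the maps into a colimit of models agree if they agree on the maps
that factor through the diagram. Such maps need not exhaust all maps into the colimit; the reason is
that the families correspond to morphisms out of the colimit. -/
lemma family_ext {J : Type v} [SmallCategory J] {K : J ⥤ Φ.Models.FullSubcategory} {c : Cocone K}
    (hc : IsColimit c) (F : E ⥤ C) (hF : Φ.Sends F) (d : C)
    (φ ψ : ∀ e : E, (Φ.toModels.obj e ⟶ c.pt) → (F.obj e ⟶ d))
    (hφ : ∀ (e e' : E) (u : e ⟶ e') (x : Φ.toModels.obj e' ⟶ c.pt),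
      φ e (Φ.toModels.map u ≫ x) = F.map u ≫ φ e' x)
    (hψ : ∀ (e e' : E) (u : e ⟶ e') (x : Φ.toModels.obj e' ⟶ c.pt),
      ψ e (Φ.toModels.map u ≫ x) = F.map u ≫ ψ e' x)
    (h : ∀ j e (x : Φ.toModels.obj e ⟶ K.obj j), φ e (x ≫ c.ι.app j) = ψ e (x ≫ c.ι.app j)) :
    φ = ψ := by
  obtain ⟨f, hf⟩ := Φ.exists_hom_nerve F hF c.pt d φ hφ
  obtain ⟨g, hg⟩ := Φ.exists_hom_nerve F hF c.pt d ψ hψ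
  have hom_ext : ∀ {S S' : Φ.Models.FullSubcategory} (f g : S ⟶ S'),
      (∀ e (x : Φ.toModels.obj e ⟶ S), x ≫ f = x ≫ g) → f = g := by
    intro S S' f g hfg
    ext e s
    obtain ⟨x, rfl⟩ := (Φ.homEquiv e.unop).surjective s
    have := congrArg (Φ.homEquiv e.unop) (hfg e.unop x)
    rwa [homEquiv_naturality_right, homEquiv_naturality_right] at this
  have : f = g := hc.hom_ext fun j => hom_ext _ _ fun e x => (Φ.homEquiv e).injective (by
    rw [← Category.assoc, hf, ← Category.assoc, hg, h])
  funext e x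
  rw [← hf, ← hg, this]

/-- Proved by induction over the generated models: the Yoneda lemma for objects of `E`, and gluing
for finite colimits. -/
lemma denseFor_toCompletion (G : Φ.Completion ⥤ C) [PreservesFiniteColimits G] :
    DenseFor Φ.toCompletion G := by
  have hF : Φ.Sends (Φ.toCompletion ⋙ G) := fun i => by
    obtain ⟨h⟩ := Φ.sends_toCompletion i
    exact ⟨isColimitOfPreserves G h⟩
  intro p
  refine Φ.completion_induction (fun p hp => ∀ (c : C)
    (φ : ∀ e : E, (Φ.toCompletion.obj e ⟶ ⟨p, hp⟩) → (G.obj (Φ.toCompletion.obj e) ⟶ c)),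
    (∀ (e e' : E) (u : e ⟶ e') (x : Φ.toCompletion.obj e' ⟶ ⟨p, hp⟩),
      φ e (Φ.toCompletion.map u ≫ x) = G.map (Φ.toCompletion.map u) ≫ φ e' x) →
    ∃! f : G.obj ⟨p, hp⟩ ⟶ c, ∀ (e : E) (x : Φ.toCompletion.obj e ⟶ ⟨p, hp⟩),
      G.map x ≫ f = φ e x) ?_ ?_ ?_ p.obj p.property
  · -- an object of `E`: by the Yoneda lemma, a natural family is determined by its
    -- value at the identity
    intro e₀ h c φ hφ
    refine ⟨φ e₀ (𝟙 (Φ.toCompletion.obj e₀)), fun e x => ?_, fun f hf => ?_⟩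
    · obtain ⟨f, hf⟩ := Φ.exists_hom_nerve _ hF (Φ.toModels.obj e₀) c (fun e x => φ e ⟨x⟩)
        fun e e' u x => hφ e e' u (ObjectProperty.homMk (X := Φ.toCompletion.obj e')
          (Y := Φ.toCompletion.obj e₀) x)
      obtain ⟨g, hg⟩ := Φ.exists_hom_nerve _ hF (Φ.toModels.obj e₀) c
        (fun e x => G.map (X := Φ.toCompletion.obj e) (Y := Φ.toCompletion.obj e₀) ⟨x⟩ ≫
          φ e₀ (𝟙 (Φ.toCompletion.obj e₀))) fun e e' u x =>
        (congrArg (· ≫ φ e₀ (𝟙 (Φ.toCompletion.obj e₀))) (G.map_comp (Φ.toCompletion.map u)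
          (Y := Φ.toCompletion.obj e') (Z := Φ.toCompletion.obj e₀) ⟨x⟩)).trans
            (Category.assoc _ _ _)
      have hfg : f = g := (Φ.homEquiv e₀).injective (by
        have h₁ := (hf e₀ (𝟙 _)).trans (((congrArg (· ≫ φ e₀ (𝟙 (Φ.toCompletion.obj e₀)))
          (G.map_id _)).trans (Category.id_comp _)).symm.trans (hg e₀ (𝟙 _)).symm)
        rwa [Category.id_comp, Category.id_comp] at h₁)
      exact (hg e x.hom).symm.trans ((congrArg (fun k => Φ.homEquiv e (x.hom ≫ k)) hfg.symm).trans
        (hf e x.hom))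
    · refine Eq.trans ?_ (hf e₀ (𝟙 (Φ.toCompletion.obj e₀)))
      exact ((congrArg (· ≫ f) (G.map_id _)).trans (Category.id_comp f)).symm
  · intro p q i hp hq H c φ hφ
    let i' : (⟨p, hp⟩ : Φ.Completion) ≅ ⟨q, hq⟩ := Φ.Generated.isoMk i
    obtain ⟨f, hf, hf'⟩ := H c (fun e x => φ e (x ≫ i'.hom)) fun e e' u x => by
      rw [Category.assoc, hφ]
    refine ⟨G.map i'.inv ≫ f, fun e x => ?_, fun g hg => ?_⟩
    · rw [← G.map_comp_assoc, hf, Category.assoc, i'.inv_hom_id, Category.comp_id]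
    · rw [← hf' (G.map i'.hom ≫ g) fun e x => by rw [← G.map_comp_assoc, hg], ← G.map_comp_assoc,
        i'.inv_hom_id, G.map_id, Category.id_comp]
  · -- a colimit: the morphisms out of the objects of the diagram are unique, hence compatible
    intro J _ _ K k hk H c φ hφ
    choose f hf hf' using fun j => H j c (fun e x => φ e (x ≫ k.ι.app j)) fun e e' u x => by
      rw [Category.assoc, hφ]
    have hGk := isColimitOfPreserves G hk
    have nat : ∀ {i j : J} (a : i ⟶ j), G.map (K.map a) ≫ f j = f i := fun {i j} a =>
      hf' i _ fun e x => by rw [← G.map_comp_assoc, hf, Category.assoc, k.w]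
    let g : G.obj k.pt ⟶ c := hGk.desc ⟨c,
      ⟨f, fun i j a => (nat a).trans (Category.comp_id _).symm⟩⟩
    have hg : ∀ j, G.map (k.ι.app j) ≫ g = f j := fun j => hGk.fac _ j
    refine ⟨g, ?_, fun g' hg' => hGk.hom_ext fun j => ?_⟩
    · have := Φ.family_ext (isColimitOfPreserves Φ.Generated.ι hk) (Φ.toCompletion ⋙ G) hF c
        (fun e x => G.map (Y := k.pt) (X := Φ.toCompletion.obj e) ⟨x⟩ ≫ g)
        (fun e x => φ e ⟨x⟩) ?_ ?_ ?_
      · exact fun e x => congrFun (congrFun this e) x.hom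
      · intro e e' u x
        exact (congrArg (· ≫ g) (G.map_comp (Φ.toCompletion.map u) ⟨x⟩)).trans
          (Category.assoc _ _ _)
      · exact fun e e' u x => hφ e e' u ⟨x⟩
      · intro j e x
        have h₁ := G.map_comp_assoc (X := Φ.toCompletion.obj e) (Y := K.obj j) ⟨x⟩ (k.ι.app j) g
        refine h₁.trans ?_
        rw [hg, hf]
        rfl
    · refine Eq.trans ?_ (hg j).symm
      exact hf' j _ fun e x => by
        refine (G.map_comp_assoc x (k.ι.app j) g').symm.trans (hg' _ _)

/-- The functor `c ↦ Hom(model of e, nerve of c)` is corepresented by `F e`. -/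
noncomputable def corepresentableBy (F : E ⥤ C) (hF : Φ.Sends F) (e : E) :
    (Φ.nerve F hF ⋙ coyoneda.obj (op (Φ.toModels.obj e))).CorepresentableBy (F.obj e) where
  homEquiv {c} := (Φ.homEquiv e (S := (Φ.nerve F hF).obj c)).symm
  homEquiv_comp {c d} g f := by
    apply (Φ.homEquiv e).injective
    erw [homEquiv_naturality_right, Equiv.apply_symm_apply, Equiv.apply_symm_apply]
    rfl

/-- The nerve has a left adjoint on the generated models: the models where it is defined contain
those of the objects of `E` and are stable under finite colimits. -/
lemma generated_le (F : E ⥤ C) (hF : Φ.Sends F) [HasFiniteColimits C] :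
    Φ.Generated ≤ (Φ.nerve F hF).leftAdjointObjIsDefined := by
  intro p hp
  refine Φ.completion_induction (fun p _ => (Φ.nerve F hF).leftAdjointObjIsDefined p)
    (fun e _ => ?_) (fun {p q} e hp hq h => ?_) (fun {J} _ _ K k hk h => ?_) p hp
  · exact (Φ.corepresentableBy F hF e).isCorepresentable
  · obtain ⟨X, ⟨r⟩⟩ := h
    exact ⟨X, ⟨r.ofIso (Functor.isoWhiskerLeft _ (coyoneda.mapIso e.symm.op))⟩⟩
  · exact Functor.leftAdjointObjIsDefined_of_isColimit (isColimitOfPreserves Φ.Generated.ι hk) h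

section Extend

variable (F : E ⥤ C) (hF : Φ.Sends F) [HasFiniteColimits C]

/-- The extension of `F` to the completion, as the partial left adjoint of the nerve. -/
noncomputable def extend : Φ.Completion ⥤ C :=
  ObjectProperty.ιOfLE (Φ.generated_le F hF) ⋙ (Φ.nerve F hF).partialLeftAdjoint

/-- The adjunction between the extension of `F` and the nerve of `F`. -/
noncomputable def extendHomEquiv {p : Φ.Completion} {c : C} :
    ((Φ.extend F hF).obj p ⟶ c) ≃ (p.obj ⟶ (Φ.nerve F hF).obj c) :=
  (Φ.nerve F hF).partialLeftAdjointHomEquiv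
    (X := (ObjectProperty.ιOfLE (Φ.generated_le F hF)).obj p)

lemma extendHomEquiv_comp {p : Φ.Completion} {c d : C} (f : (Φ.extend F hF).obj p ⟶ c)
    (g : c ⟶ d) : Φ.extendHomEquiv F hF (f ≫ g) =
      Φ.extendHomEquiv F hF f ≫ (Φ.nerve F hF).map g :=
  (Φ.nerve F hF).partialLeftAdjointHomEquiv_comp f g

lemma extendHomEquiv_map_comp {p q : Φ.Completion} {c : C} (u : p ⟶ q)
    (f : (Φ.extend F hF).obj q ⟶ c) : Φ.extendHomEquiv F hF ((Φ.extend F hF).map u ≫ f) =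
      u.hom ≫ Φ.extendHomEquiv F hF f :=
  (Φ.nerve F hF).partialLeftAdjointHomEquiv_map_comp
    ((ObjectProperty.ιOfLE (Φ.generated_le F hF)).map u) f

lemma preservesFiniteColimits_extend : PreservesFiniteColimits (Φ.extend F hF) := by
  refine preservesFiniteColimits_of_preservesFiniteColimitsOfSize.{v} _ fun J _ _ => ⟨fun {K} =>
    ⟨fun {k} hk => ⟨?_⟩⟩⟩
  have h := isColimitOfPreserves Φ.Generated.ι hk
  let e := fun {p c} => Φ.extendHomEquiv F hF (p := p) (c := c)
  refine
    { desc := fun s => e.symm (h.desc ⟨(Φ.nerve F hF).obj s.pt, ⟨fun j => e (s.ι.app j), ?_⟩⟩)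
      fac := fun s j => ?_
      uniq := fun s m hm => ?_ }
  · intro i j f
    refine (Φ.extendHomEquiv_map_comp F hF (K.map f) (s.ι.app j)).symm.trans ?_
    exact (congrArg e (s.w f)).trans (Category.comp_id _).symm
  · refine e.injective ((Φ.extendHomEquiv_map_comp F hF (k.ι.app j) _).trans ?_)
    refine (congrArg _ (Equiv.apply_symm_apply _ _)).trans ?_
    exact h.fac _ j
  · refine e.eq_symm_apply.2 (h.uniq ⟨(Φ.nerve F hF).obj s.pt, _⟩ _ fun j => ?_)
    exact (Φ.extendHomEquiv_map_comp F hF (k.ι.app j) m).symm.trans (congrArg e (hm j))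

/-- The comparison from `F` to the restriction of its extension, which corresponds to the identity
under the adjunction and the Yoneda lemma. -/
noncomputable def extendUnit : F ⟶ Φ.toCompletion ⋙ Φ.extend F hF where
  app e := Φ.homEquiv e (Φ.extendHomEquiv F hF (p := Φ.toCompletion.obj e) (𝟙 _))
  naturality e e' u := by
    have h₁ := (Φ.homEquiv_naturality_left u (Φ.extendHomEquiv F hF
      (p := Φ.toCompletion.obj e') (𝟙 _)))
    have h₂ := Φ.extendHomEquiv_map_comp F hF (Φ.toCompletion.map u) (𝟙 _)
    have h₃ := Φ.extendHomEquiv_comp F hF (p := Φ.toCompletion.obj e) (𝟙 _)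
      ((Φ.extend F hF).map (Φ.toCompletion.map u))
    have h₄ := Φ.homEquiv_naturality_right e (Φ.extendHomEquiv F hF
      (p := Φ.toCompletion.obj e) (𝟙 _))
      ((Φ.nerve F hF).map ((Φ.extend F hF).map (Φ.toCompletion.map u)))
    refine h₁.symm.trans (Eq.trans (congrArg (Φ.homEquiv e) ?_) h₄)
    refine h₂.symm.trans (Eq.trans (congrArg _ ?_) h₃)
    rw [Category.comp_id, Category.id_comp]

lemma isIso_extendUnit : IsIso (Φ.extendUnit F hF) := by
  have (e : E) : IsIso ((Φ.extendUnit F hF).app e) := by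
    refine isIso_of_coyoneda_map_bijective _ fun c => ?_
    refine (congrArg Function.Bijective (funext fun f => ?_)).mp
      ((Φ.extendHomEquiv F hF (p := Φ.toCompletion.obj e) (c := c)).trans (Φ.homEquiv e)).bijective
    have h₃ := Φ.extendHomEquiv_comp F hF (p := Φ.toCompletion.obj e) (𝟙 _) f
    rw [Category.id_comp] at h₃
    have h₄ := Φ.homEquiv_naturality_right e (Φ.extendHomEquiv F hF
      (p := Φ.toCompletion.obj e) (𝟙 _)) ((Φ.nerve F hF).map f)
    exact (congrArg (Φ.homEquiv e) h₃).trans h₄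
  exact NatIso.isIso_of_isIso_app _

/-- The extension of `F` restricts to `F`. -/
noncomputable def toCompletionCompExtend : Φ.toCompletion ⋙ Φ.extend F hF ≅ F :=
  have := Φ.isIso_extendUnit F hF
  (asIso (Φ.extendUnit F hF)).symm

end Extend

end CoconeFamily

end

/-! ### Density -/

section Dense

variable {E : Type u₁} [Category.{v} E] {P : Type u₂} [Category.{v} P]
  {C : Type u₃} [Category.{v} C]

lemma DenseFor.hom_ext {t : E ⥤ P} {G : P ⥤ C} (h : DenseFor t G) {p : P} {c : C}
    {f g : G.obj p ⟶ c} (hfg : ∀ (e : E) (x : t.obj e ⟶ p), G.map x ≫ f = G.map x ≫ g) : f = g :=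
  (h p c (fun _ x => G.map x ≫ f) fun _ _ _ _ => by rw [G.map_comp, Category.assoc]).unique
    (fun _ _ => rfl) fun e x => (hfg e x).symm

lemma DenseFor.of_iso {t : E ⥤ P} {G H : P ⥤ C} (h : DenseFor t G) (i : G ≅ H) :
    DenseFor t H := by
  intro p c φ hφ
  obtain ⟨f, hf, -⟩ := h p c (fun e x => i.hom.app _ ≫ φ e x) fun e e' u x => by
    rw [hφ, ← i.hom.naturality_assoc]
  refine ⟨i.inv.app p ≫ f, fun e x => ?_, fun g hg => ?_⟩
  · rw [i.inv.naturality_assoc, hf, Iso.inv_hom_id_app_assoc]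
  · rw [← cancel_epi (i.hom.app p), Iso.hom_inv_id_app_assoc]
    refine h.hom_ext fun e x => ?_
    rw [hf, i.hom.naturality_assoc, hg]

lemma DenseFor.precomp_equivalence {E' : Type u₄} [Category.{v} E'] (s : E' ⥤ E) [s.IsEquivalence]
    {t : E ⥤ P} {G : P ⥤ C} (h : DenseFor t G) : DenseFor (s ⋙ t) G := by
  intro p c φ hφ
  have hu : ∀ f : G.obj p ⟶ c, (∀ e (x : t.obj (s.obj e) ⟶ p), G.map x ≫ f = φ e x) →
      ∀ e (x : t.obj e ⟶ p), G.map x ≫ f = G.map (t.map (s.objObjPreimageIso e).inv) ≫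
        φ (s.objPreimage e) (t.map (s.objObjPreimageIso e).hom ≫ x) := fun f hf e x => by
    rw [← hf, ← G.map_comp_assoc, ← t.map_comp_assoc, Iso.inv_hom_id, t.map_id, Category.id_comp]
  obtain ⟨f, hf, hf'⟩ := h p c (fun e x => G.map (t.map (s.objObjPreimageIso e).inv) ≫
    φ (s.objPreimage e) (t.map (s.objObjPreimageIso e).hom ≫ x)) fun e e' u x => by
      have := hφ _ _ (s.preimage ((s.objObjPreimageIso e).hom ≫ u ≫ (s.objObjPreimageIso e').inv))
        (t.map (s.objObjPreimageIso e').hom ≫ x)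
      simp only [Functor.comp_map, Functor.map_preimage, ← t.map_comp_assoc, Category.assoc,
        Iso.inv_hom_id, Category.comp_id] at this
      rw [← t.map_comp_assoc, this]
      simp only [← G.map_comp_assoc, ← t.map_comp, Iso.inv_hom_id_assoc]
  refine ⟨f, fun e x => ?_, fun g hg => hf' g (hu g hg)⟩
  have := hφ _ _ (s.preimage (s.objObjPreimageIso (s.obj e)).hom) x
  simp only [Functor.comp_map, Functor.map_preimage] at this
  dsimp at x
  rw [hf, this]
  simp only [← G.map_comp_assoc, ← t.map_comp, Iso.inv_hom_id, t.map_id, G.map_id]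
  exact Category.id_comp _

lemma Generates.precomp_essSurj {E' : Type u₄} [Category.{v} E'] (s : E' ⥤ E) [s.EssSurj]
    {t : E ⥤ P} (h : Generates t) : Generates (s ⋙ t) := fun Q hQ hJ hE =>
  h Q hQ hJ fun e => Q.prop_of_iso (t.mapIso (s.objObjPreimageIso e)) (hE _)

/-- Natural transformations out of a dense functor are determined by, and extend from, their
components on the image of `t`. -/
lemma DenseFor.existsUnique_natTrans {t : E ⥤ P} {G H : P ⥤ C} (h : DenseFor t G)
    (α : t ⋙ G ⟶ t ⋙ H) : ∃! β : G ⟶ H, Functor.whiskerLeft t β = α := by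
  choose β hβ hβ' using fun p => h p (H.obj p) (fun e x => α.app e ≫ H.map x) fun e e' u x => by
    rw [H.map_comp]
    exact (α.naturality_assoc u (H.map x)).symm
  refine ⟨⟨β, fun p q f => h.hom_ext fun e x => ?_⟩, ?_, fun γ hγ => ?_⟩
  · rw [← G.map_comp_assoc, hβ, ← Category.assoc, hβ, Category.assoc, H.map_comp]
  · ext e
    have := hβ (t.obj e) e (𝟙 _)
    rw [G.map_id, Category.id_comp, H.map_id] at this
    exact this.trans (Category.comp_id _)
  · ext p
    refine hβ' p _ fun e x => ?_
    rw [γ.naturality, ← hγ]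
    rfl

/-- The natural transformation that extends `α` along `t`. -/
noncomputable def DenseFor.descTrans {t : E ⥤ P} {G H : P ⥤ C} (h : DenseFor t G)
    (α : t ⋙ G ⟶ t ⋙ H) : G ⟶ H := (h.existsUnique_natTrans α).choose

lemma DenseFor.descTrans_app {t : E ⥤ P} {G H : P ⥤ C} (h : DenseFor t G)
    (α : t ⋙ G ⟶ t ⋙ H) (e : E) : (h.descTrans α).app (t.obj e) = α.app e :=
  congrArg (fun γ => γ.app e) (h.existsUnique_natTrans α).choose_spec.1

lemma DenseFor.natTrans_ext {t : E ⥤ P} {G H : P ⥤ C} (h : DenseFor t G) {α β : G ⟶ H}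
    (hαβ : ∀ e, α.app (t.obj e) = β.app (t.obj e)) : α = β :=
  (h.existsUnique_natTrans (Functor.whiskerLeft t β)).unique (by ext e; exact hαβ e) rfl

/-- The natural isomorphism that extends `α` along `t`. -/
noncomputable def DenseFor.descIso {t : E ⥤ P} {G H : P ⥤ C} (hG : DenseFor t G)
    (hH : DenseFor t H) (α : t ⋙ G ≅ t ⋙ H) : G ≅ H where
  hom := hG.descTrans α.hom
  inv := hH.descTrans α.inv
  hom_inv_id := hG.natTrans_ext fun e => by simp [descTrans_app]
  inv_hom_id := hH.natTrans_ext fun e => by simp [descTrans_app]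

end Dense

/-! ### The completion for functors cocontinuous in each variable -/

section

open Cardinal

section

variable {A B C : Type (v + 1)} [Category.{v} A] [Category.{v} B] [Category.{v} C]

lemma biCocontinuous.of_iso {F G : A × B ⥤ C} (i : F ≅ G) (h : biCocontinuous A B C F) :
    biCocontinuous A B C G :=
  ⟨fun a => have := h.1 a; preservesFiniteColimits_of_natIso (Functor.isoWhiskerLeft _ i),
    fun b => have := h.2 b; preservesFiniteColimits_of_natIso (Functor.isoWhiskerLeft _ i)⟩

/-- The functors `a ↦ (a, b)` and `a ↦ (a, b')` are isomorphic for isomorphic `b` and `b'`. -/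
def sectLIso {b b' : B} (i : b ≅ b') : Prod.sectL A b ≅ Prod.sectL A b' :=
  NatIso.ofComponents (fun a => Iso.prod (Iso.refl a) i) fun f => Prod.ext
    ((Category.comp_id f).trans (Category.id_comp f).symm)
    ((Category.id_comp i.hom).trans (Category.comp_id i.hom).symm)

/-- The functors `b ↦ (a, b)` and `b ↦ (a', b)` are isomorphic for isomorphic `a` and `a'`. -/
def sectRIso {a a' : A} (i : a ≅ a') : Prod.sectR a B ≅ Prod.sectR a' B :=
  NatIso.ofComponents (fun b => Iso.prod i (Iso.refl b)) fun f => Prod.ext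
    ((Category.id_comp i.hom).trans (Category.comp_id i.hom).symm)
    ((Category.comp_id f).trans (Category.id_comp f).symm)

end

section Completion

variable {A B : Type (v + 1)} [Category.{v} A] [EssentiallySmall.{v} A] [HasFiniteColimits A]
  [Category.{v} B] [EssentiallySmall.{v} B] [HasFiniteColimits B]
  {E : Type u₁} [Category.{v} E] [EssentiallySmall.{v} E] (j : A × B ⥤ E)

noncomputable instance (S : SmallCategoryCardinalLT (ℵ₀ : Cardinal.{v})) :
    FinCategory (SmallCategoryCardinalLT.categoryFamily ℵ₀ S) :=
  ((Arrow.finite_iff _).1 ((hasCardinalLT_aleph0_iff _).1 S.hasCardinalLT)).some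

/-- The images under `j : A × B ⥤ E` of the finite colimit cocones of `A` and of `B`, the other
variable being fixed. To have a small family, the categories are replaced by small models, and
the finite diagram shapes by representatives. -/
noncomputable def biCocones : CoconeFamily.{v} (SmallModel.{v} E) where
  index := Σ S : SmallCategoryCardinalLT (ℵ₀ : Cardinal.{v}),
    ((SmallCategoryCardinalLT.categoryFamily ℵ₀ S ⥤ SmallModel.{v} A) × SmallModel.{v} B) ⊕
      ((SmallCategoryCardinalLT.categoryFamily ℵ₀ S ⥤ SmallModel.{v} B) × SmallModel.{v} A)
  shape i := SmallCategoryCardinalLT.categoryFamily ℵ₀ i.1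
  diagram i := match i.2 with
    | .inl K => (K.1 ⋙ (equivSmallModel A).inverse) ⋙
        Prod.sectL A ((equivSmallModel B).inverse.obj K.2) ⋙ j ⋙ (equivSmallModel E).functor
    | .inr K => (K.1 ⋙ (equivSmallModel B).inverse) ⋙
        Prod.sectR ((equivSmallModel A).inverse.obj K.2) B ⋙ j ⋙ (equivSmallModel E).functor
  cocone i := match i with
    | ⟨_, .inl _⟩ => (Prod.sectL A _ ⋙ j ⋙ _).mapCocone (colimit.cocone _)
    | ⟨_, .inr _⟩ => (Prod.sectR _ B ⋙ j ⋙ _).mapCocone (colimit.cocone _)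

/-- A functor on an essentially small category preserves finite colimits if it preserves those of
the representative shapes and of diagrams in the small model. -/
lemma preservesFiniteColimits_of_smallModel {C : Type u₂} [Category.{v} C] (F : A ⥤ C)
    (h : ∀ (S : SmallCategoryCardinalLT (ℵ₀ : Cardinal.{v}))
      (K : SmallCategoryCardinalLT.categoryFamily ℵ₀ S ⥤ SmallModel.{v} A),
      Nonempty (IsColimit (F.mapCocone (colimit.cocone (K ⋙ (equivSmallModel A).inverse))))) :
    PreservesFiniteColimits F := by
  refine preservesFiniteColimits_of_preservesFiniteColimitsOfSize.{v} _ fun J _ _ => ?_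
  obtain ⟨S, ⟨e⟩⟩ := SmallCategoryCardinalLT.exists_equivalence (ℵ₀ : Cardinal.{v}) J
    (by rw [hasCardinalLT_aleph0_iff]; infer_instance)
  have : PreservesColimitsOfShape (SmallCategoryCardinalLT.categoryFamily ℵ₀ S) F := ⟨fun {K} => by
    obtain ⟨hK⟩ := h S (K ⋙ (equivSmallModel A).functor)
    have : PreservesColimit ((K ⋙ (equivSmallModel A).functor) ⋙ (equivSmallModel A).inverse) F :=
      preservesColimit_of_preserves_colimit_cocone (colimit.isColimit _) hK
    exact preservesColimit_of_iso_diagram F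
      (K₁ := (K ⋙ (equivSmallModel A).functor) ⋙ (equivSmallModel A).inverse)
      (Functor.isoWhiskerLeft K (equivSmallModel A).unitIso.symm)⟩
  exact preservesColimitsOfShape_of_equiv e F

variable {C : Type (v + 1)} [Category.{v} C]

/-- Sending the family of cocones to colimits amounts to being cocontinuous in each variable. -/
lemma biCocones_sends_iff (F : SmallModel.{v} E ⥤ C) :
    (biCocones j).Sends F ↔
      biCocontinuous A B C (j ⋙ (equivSmallModel E).functor ⋙ F) := by
  refine ⟨fun h => ⟨fun a => ?_, fun b => ?_⟩, fun h => ?_⟩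
  · have : PreservesFiniteColimits (Prod.sectR
        (((equivSmallModel A).functor ⋙ (equivSmallModel A).inverse).obj a) B ⋙ j ⋙
          (equivSmallModel E).functor ⋙ F) :=
      preservesFiniteColimits_of_smallModel _ fun S K =>
        h ⟨S, .inr (K, (equivSmallModel A).functor.obj a)⟩
    exact preservesFiniteColimits_of_natIso (Functor.isoWhiskerRight
      (sectRIso (B := B) ((equivSmallModel A).unitIso.symm.app a))
      (j ⋙ (equivSmallModel E).functor ⋙ F))
  · have : PreservesFiniteColimits (Prod.sectL A
        (((equivSmallModel B).functor ⋙ (equivSmallModel B).inverse).obj b) ⋙ j ⋙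
          (equivSmallModel E).functor ⋙ F) :=
      preservesFiniteColimits_of_smallModel _ fun S K =>
        h ⟨S, .inl (K, (equivSmallModel B).functor.obj b)⟩
    exact preservesFiniteColimits_of_natIso (Functor.isoWhiskerRight
      (sectLIso (A := A) ((equivSmallModel B).unitIso.symm.app b))
      (j ⋙ (equivSmallModel E).functor ⋙ F))
  · rintro ⟨S, K | K⟩
    · have := h.2 ((equivSmallModel B).inverse.obj K.2)
      have h' := isColimitOfPreserves (Prod.sectL A ((equivSmallModel B).inverse.obj K.2) ⋙ j ⋙
        (equivSmallModel E).functor ⋙ F) (colimit.isColimit (K.1 ⋙ (equivSmallModel A).inverse))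
      exact ⟨h'⟩
    · have := h.1 ((equivSmallModel A).inverse.obj K.2)
      have h' := isColimitOfPreserves (Prod.sectR ((equivSmallModel A).inverse.obj K.2) B ⋙ j ⋙
        (equivSmallModel E).functor ⋙ F) (colimit.isColimit (K.1 ⋙ (equivSmallModel B).inverse))
      exact ⟨h'⟩

/-- The universal finitely cocomplete category `P` under `E` such that the composite
`A × B ⥤ E ⥤ P` is finitely cocontinuous in each variable. -/
abbrev BiCompletion : Type (v + 1) := (biCocones j).Completion

/-- The canonical functor from `E` to its completion. -/
noncomputable def toBiCompletion : E ⥤ BiCompletion j :=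
  (equivSmallModel E).functor ⋙ (biCocones j).toCompletion

lemma biCocontinuous_toBiCompletion :
    biCocontinuous A B (BiCompletion j) (j ⋙ toBiCompletion j) :=
  (biCocones_sends_iff j _).1 (biCocones j).sends_toCompletion

lemma denseFor_toBiCompletion (G : BiCompletion j ⥤ C) [PreservesFiniteColimits G] :
    DenseFor (toBiCompletion j) G :=
  ((biCocones j).denseFor_toCompletion G).precomp_equivalence _

lemma generates_toBiCompletion : Generates (toBiCompletion j) :=
  (biCocones j).generates_toCompletion.precomp_essSurj _

lemma exists_extension_biCompletion [HasFiniteColimits C] (F : E ⥤ C)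
    (hF : biCocontinuous A B C (j ⋙ F)) : ∃ G : BiCompletion j ⥤ C,
      PreservesFiniteColimits G ∧ Nonempty (toBiCompletion j ⋙ G ≅ F) := by
  let F' := (equivSmallModel E).inverse ⋙ F
  let i : (equivSmallModel E).functor ⋙ F' ≅ F :=
    (equivSmallModel E).funInvIdAssoc F
  have hF' : (biCocones j).Sends F' := (biCocones_sends_iff j F').2
    (hF.of_iso (Functor.isoWhiskerLeft j i.symm))
  exact ⟨(biCocones j).extend F' hF', (biCocones j).preservesFiniteColimits_extend F' hF',
    ⟨Functor.isoWhiskerLeft (equivSmallModel E).functor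
      ((biCocones j).toCompletionCompExtend F' hF') ≪≫ i⟩⟩

end Completion

end

/-! ### Extending bifunctors along a dense generating functor -/

/-- A colimit of finitely cocontinuous functors is finitely cocontinuous, because colimits commute
with colimits. -/
lemma isClosedUnderColimitsOfShape_preservesFiniteColimits {A : Type u₁} [Category.{v} A]
    {C : Type u₂} [Category.{v} C] (J : Type v) [SmallCategory J] [HasColimitsOfShape J C] :
    (ObjectProperty.preservesFiniteColimits : ObjectProperty (A ⥤ C)).IsClosedUnderColimitsOfShape
      J where
  colimitsOfShape_le := by
    rintro G ⟨h⟩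
    have := h.prop_diag_obj
    have : PreservesFiniteColimits h.diag.flip :=
      preservesFiniteColimits_of_evaluation _ fun j => h.prop_diag_obj j
    exact preservesFiniteColimits_of_natIso (F := h.diag.flip ⋙ colim) (NatIso.ofComponents
      (fun a => (colimit.isColimit (h.diag.flip.obj a)).coconePointUniqueUpToIso
          (isColimitOfPreserves ((evaluation _ _).obj a) h.isColimit))
      fun f => colimit.hom_ext fun j => by simp)

section

variable {E : Type u₁} [Category.{v} E] {P : Type u₂} [Category.{v} P] {t : E ⥤ P}

/-- Restriction along `t` of finitely cocontinuous functors, with values in the functors having the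
property `Q`. -/
def restriction (Q : ObjectProperty (E ⥤ P))
    (hQt : ∀ G : P ⥤ P, PreservesFiniteColimits G → Q (t ⋙ G)) :
    (ObjectProperty.preservesFiniteColimits (J := P) (C := P)).FullSubcategory ⥤
    Q.FullSubcategory :=
  Q.lift (ObjectProperty.ι _ ⋙ (Functor.whiskeringLeft _ _ P).obj t) fun G => hQt G.obj G.property

lemma isEquivalence_restriction (hd : ∀ G : P ⥤ P, PreservesFiniteColimits G → DenseFor t G)
    (Q : ObjectProperty (E ⥤ P))
    (hext : ∀ F, Q F → ∃ G : P ⥤ P, PreservesFiniteColimits G ∧ Nonempty (t ⋙ G ≅ F))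
    (hQt : ∀ G : P ⥤ P, PreservesFiniteColimits G → Q (t ⋙ G)) :
    (restriction Q hQt).IsEquivalence where
  faithful := ⟨fun {F G} α β h => by
    ext : 1
    refine (hd F.obj F.property).natTrans_ext fun e => ?_
    exact congrArg (fun γ => γ.hom.app e) h⟩
  full := ⟨fun {F G} α => by
    obtain ⟨β, hβ, -⟩ := (hd F.obj F.property).existsUnique_natTrans α.hom
    exact ⟨⟨β⟩, by ext : 1; exact hβ⟩⟩
  essSurj := ⟨fun F => by
    obtain ⟨G, hG, ⟨i⟩⟩ := hext F.obj F.property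
    exact ⟨⟨G, hG⟩, ⟨Q.isoMk i⟩⟩⟩

/-- A property of functors that is stable under finite colimits holds for all values of a finitely
cocontinuous functor `T` if it holds for the values on the image of `t`. -/
lemma Generates.prop_obj (hg : Generates t) {C : Type u₃} [Category.{v} C]
    {X : Type u₄} [Category.{v} X] (T : P ⥤ X ⥤ C) (hT : PreservesFiniteColimits T)
    (R : ObjectProperty (X ⥤ C)) [R.IsClosedUnderIsomorphisms]
    (hR : ∀ (J : Type v) [SmallCategory J] [FinCategory J], R.IsClosedUnderColimitsOfShape J)
    (h : ∀ e, R (T.obj (t.obj e))) (p : P) : R (T.obj p) := by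
  refine hg (R.inverseImage T) inferInstance (fun J _ _ => ⟨?_⟩) h p
  rintro p ⟨hp⟩
  have := hR J
  exact R.prop_of_isColimit (isColimitOfPreserves T hp.isColimit) hp.prop_diag_obj

/-- If finitely cocontinuous functors on `P` correspond to functors on `E` with the property `Q`,
then a bifunctor on `E` that has the property `Q` in each variable extends to a bifunctor on `P`
that is finitely cocontinuous in each variable. -/
theorem exists_bifunctor [HasFiniteColimits P]
    (hd : ∀ G : P ⥤ P, PreservesFiniteColimits G → DenseFor t G) (hg : Generates t)
    (Q : ObjectProperty (E ⥤ P)) [Q.IsClosedUnderIsomorphisms]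
    (hQ : ∀ (J : Type v) [SmallCategory J] [FinCategory J], Q.IsClosedUnderColimitsOfShape J)
    (hext : ∀ F, Q F → ∃ G : P ⥤ P, PreservesFiniteColimits G ∧ Nonempty (t ⋙ G ≅ F))
    (hQt : ∀ G : P ⥤ P, PreservesFiniteColimits G → Q (t ⋙ G))
    (N : E ⥤ E ⥤ P) (hl : ∀ x, Q (N.obj x)) (hr : ∀ y, Q (N.flip.obj y)) :
    ∃ T : P ⥤ P ⥤ P, (∀ p, PreservesFiniteColimits (T.obj p)) ∧
      (∀ q, PreservesFiniteColimits (T.flip.obj q)) ∧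
      Nonempty (t ⋙ T ⋙ (Functor.whiskeringLeft _ _ _).obj t ≅ N) := by
  let QP := ObjectProperty.preservesFiniteColimits (J := P) (C := P)
  have := isEquivalence_restriction hd Q hext hQt
  let R := (restriction Q hQt).asEquivalence
  -- extend in the second variable
  let m₁ : E ⥤ P ⥤ P := Q.lift N hl ⋙ R.inverse ⋙ QP.ι
  have hm₁ : ∀ x, PreservesFiniteColimits (m₁.obj x) := fun x =>
    (R.inverse.obj ((Q.lift N hl).obj x)).property
  let i₁ : m₁ ⋙ (Functor.whiskeringLeft _ _ _).obj t ≅ N :=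
    Functor.isoWhiskerLeft (Q.lift N hl) (Functor.isoWhiskerRight R.counitIso Q.ι)
  -- the extension still has the property `Q` in the first variable, since this holds on the image
  -- of `t` and `P` is generated by it
  have hn : ∀ p, Q (m₁.flip.obj p) := by
    refine hg.prop_obj m₁.flip
      (preservesFiniteColimits_of_evaluation _ fun x => hm₁ x) Q hQ fun y => ?_
    exact Q.prop_of_iso ((flipFunctor _ _ _).mapIso i₁.symm |>.app y) (hr y)
  -- extend in the first variable
  let m₂ : P ⥤ P ⥤ P := Q.lift m₁.flip hn ⋙ R.inverse ⋙ QP.ι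
  have hm₂ : ∀ p, PreservesFiniteColimits (m₂.obj p) := fun p =>
    (R.inverse.obj ((Q.lift m₁.flip hn).obj p)).property
  let i₂ : m₂ ⋙ (Functor.whiskeringLeft _ _ _).obj t ≅ m₁.flip :=
    Functor.isoWhiskerLeft (Q.lift m₁.flip hn) (Functor.isoWhiskerRight R.counitIso Q.ι)
  refine ⟨m₂.flip, ?_, fun q => hm₂ q, ⟨?_⟩⟩
  · refine hg.prop_obj m₂.flip
      (preservesFiniteColimits_of_evaluation _ fun x => hm₂ x)
      (ObjectProperty.preservesFiniteColimits (J := P) (C := P))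
      (fun J _ _ => isClosedUnderColimitsOfShape_preservesFiniteColimits J) fun x => ?_
    have : PreservesFiniteColimits (m₁.flip.flip.obj x) := hm₁ x
    exact preservesFiniteColimits_of_natIso (F := m₁.flip.flip.obj x)
      ((flipFunctor _ _ _).mapIso i₂.symm |>.app x)
  · exact Functor.isoWhiskerRight ((flipFunctor _ _ _).mapIso i₂)
      ((Functor.whiskeringLeft _ _ _).obj t) ≪≫ i₁

end

/-! ### Tensor products extended along a dense functor -/

section

variable {E₁ : Type u₁} [Category.{v} E₁] {P₁ : Type u₂} [Category.{v} P₁]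
  {E₂ : Type u₃} [Category.{v} E₂] {P₂ : Type u₄} [Category.{v} P₂]
  {C : Type u₅} [Category.{v} C]

/-- A functor of two variables that is dense in each variable is dense for the product functor. -/
lemma DenseFor.prod {t₁ : E₁ ⥤ P₁} {t₂ : E₂ ⥤ P₂} {G : P₁ × P₂ ⥤ C}
    (h₁ : ∀ q, DenseFor t₁ (Prod.sectL P₁ q ⋙ G)) (h₂ : ∀ p, DenseFor t₂ (Prod.sectR p P₂ ⋙ G)) :
    DenseFor (t₁.prod t₂) G := by
  rintro ⟨p, q⟩ c φ hφ
  have comp₁ : ∀ {x y : E₁} (u : x ⟶ y) (e : E₂) (a : t₁.obj y ⟶ p) (b : t₂.obj e ⟶ q),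
      φ (x, e) (t₁.map u ≫ a, b) =
        G.map (Prod.mkHom (t₁.map u) (𝟙 (t₂.obj e))) ≫ φ (y, e) (a, b) := fun {x y} u e a b => by
    have h := hφ (x, e) (y, e) (u, 𝟙 e) (a, b)
    rw [show (t₁.prod t₂).map (X := (x, e)) (Y := (y, e)) (u, 𝟙 e) =
      Prod.mkHom (t₁.map u) (𝟙 (t₂.obj e)) from Prod.ext rfl (t₂.map_id e)] at h
    rw [← h]
    exact congrArg (φ _) (Prod.ext rfl (Category.id_comp b).symm)
  have comp₂ : ∀ {x y : E₂} (u : x ⟶ y) (e : E₁) (a : t₁.obj e ⟶ p) (b : t₂.obj y ⟶ q),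
      φ (e, x) (a, t₂.map u ≫ b) =
        G.map (Prod.mkHom (𝟙 (t₁.obj e)) (t₂.map u)) ≫ φ (e, y) (a, b) := fun {x y} u e a b => by
    have h := hφ (e, x) (e, y) (𝟙 e, u) (a, b)
    rw [show (t₁.prod t₂).map (X := (e, x)) (Y := (e, y)) (𝟙 e, u) =
      Prod.mkHom (𝟙 (t₁.obj e)) (t₂.map u) from Prod.ext (t₁.map_id e) rfl] at h
    rw [← h]
    exact congrArg (φ _) (Prod.ext (Category.id_comp a).symm rfl)
  have split : ∀ {x : E₁} {y : E₂} (a : t₁.obj x ⟶ p) (b : t₂.obj y ⟶ q),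
      G.map (X := (t₁.obj x, t₂.obj y)) (Y := (p, q)) (a, b) =
        G.map (X := (t₁.obj x, t₂.obj y)) (Y := (t₁.obj x, q)) (𝟙 _, b) ≫
          G.map (X := (t₁.obj x, q)) (Y := (p, q)) (a, 𝟙 q) := fun a b => by
    rw [← G.map_comp]
    exact congrArg G.map (Prod.ext (Category.id_comp a).symm (Category.comp_id b).symm)
  have swap : ∀ {x y : E₁} (u : x ⟶ y) {e : E₂} (b : t₂.obj e ⟶ q),
      G.map (X := (t₁.obj x, t₂.obj e)) (Y := (t₁.obj x, q)) (𝟙 _, b) ≫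
        G.map (X := (t₁.obj x, q)) (Y := (t₁.obj y, q)) (t₁.map u, 𝟙 q) =
      G.map (X := (t₁.obj x, t₂.obj e)) (Y := (t₁.obj y, t₂.obj e)) (t₁.map u, 𝟙 _) ≫
        G.map (X := (t₁.obj y, t₂.obj e)) (Y := (t₁.obj y, q)) (𝟙 _, b) := fun u e b => by
    rw [← G.map_comp, ← G.map_comp]
    exact congrArg G.map (Prod.ext ((Category.id_comp _).trans (Category.comp_id _).symm)
      ((Category.comp_id _).trans (Category.id_comp _).symm))
  have h : ∀ (x : E₁) (a : t₁.obj x ⟶ p), ∃ f : G.obj (t₁.obj x, q) ⟶ c,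
      (∀ (y : E₂) (b : t₂.obj y ⟶ q), G.map (X := (t₁.obj x, t₂.obj y)) (Y := (t₁.obj x, q))
        (𝟙 _, b) ≫ f = φ (x, y) (a, b)) ∧ ∀ g : G.obj (t₁.obj x, q) ⟶ c,
      (∀ (y : E₂) (b : t₂.obj y ⟶ q), G.map (X := (t₁.obj x, t₂.obj y)) (Y := (t₁.obj x, q))
        (𝟙 _, b) ≫ g = φ (x, y) (a, b)) → g = f := fun x a =>
    h₂ (t₁.obj x) q c (fun y b => φ (x, y) (a, b)) fun y y' u b => comp₂ u x a b
  choose ψ hψ hψ' using h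
  have h : ∃ f : G.obj (p, q) ⟶ c, (∀ (x : E₁) (a : t₁.obj x ⟶ p),
      G.map (X := (t₁.obj x, q)) (Y := (p, q)) (a, 𝟙 q) ≫ f = ψ x a) ∧
      ∀ g : G.obj (p, q) ⟶ c, (∀ (x : E₁) (a : t₁.obj x ⟶ p),
        G.map (X := (t₁.obj x, q)) (Y := (p, q)) (a, 𝟙 q) ≫ g = ψ x a) → g = f :=
    h₁ q p c ψ fun x y u a => by
      symm
      refine hψ' x _ _ fun e b => ?_
      rw [comp₁, ← hψ y a e b]
      exact (Category.assoc _ _ _).symm.trans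
        ((congrArg (· ≫ ψ y a) (swap u b)).trans (Category.assoc _ _ _))
  obtain ⟨f, hf, hf'⟩ := h
  refine ⟨f, ?_, fun g hg => hf' g fun x a => hψ' x a _ fun y b => ?_⟩
  · rintro ⟨x, y⟩ ⟨a, b⟩
    rw [← hψ x a y b, ← hf x a, ← Category.assoc]
    exact congrArg (· ≫ f) (split a b)
  · rw [← hg (x, y) (a, b), ← Category.assoc]
    exact congrArg (· ≫ g) (split a b).symm

end

/-- An extension along `t : E ⥤ P` of the tensor product of `E` to a bifunctor that is finitely
cocontinuous in each variable, where every finitely cocontinuous functor `P ⥤ P` is dense for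
`t`. -/
structure TensorData {E : Type u₁} [Category.{v} E] [MonoidalCategory E] {P : Type u₂}
    [Category.{v} P] (t : E ⥤ P) where
  tensor : P ⥤ P ⥤ P
  left : ∀ p, PreservesFiniteColimits (tensor.obj p)
  right : ∀ q, PreservesFiniteColimits (tensor.flip.obj q)
  iso : t ⋙ tensor ⋙ (Functor.whiskeringLeft _ _ _).obj t ≅
    curriedTensor E ⋙ (Functor.whiskeringRight _ _ _).obj t
  dense : ∀ G : P ⥤ P, PreservesFiniteColimits G → DenseFor t G

namespace TensorData

variable {E : Type u₁} [Category.{v} E] [MonoidalCategory E] {P : Type u₂} [Category.{v} P]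
  {t : E ⥤ P} (D : TensorData t)

/-- The isomorphism between the product of `t x` and `t y` and `t (x ⊗ y)`, on `P` as such. -/
def mu (x y : E) : (D.tensor.obj (t.obj x)).obj (t.obj y) ≅ t.obj (x ⊗ y) :=
  (D.iso.app x).app y

lemma mu_natural_right (x : E) {y y' : E} (g : y ⟶ y') :
    (D.tensor.obj (t.obj x)).map (t.map g) ≫ (D.mu x y').hom = (D.mu x y).hom ≫ t.map (x ◁ g) :=
  (D.iso.app x).hom.naturality g

lemma mu_natural_left {x x' : E} (f : x ⟶ x') (y : E) :
    (D.tensor.map (t.map f)).app (t.obj y) ≫ (D.mu x' y).hom = (D.mu x y).hom ≫ t.map (f ▷ y) :=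
  congrArg (fun α => α.app y) (D.iso.hom.naturality f)

/-- The tensor product of two objects. -/
abbrev ob (p q : P) : P := (D.tensor.obj p).obj q

/-- The tensor product of two morphisms. -/
def map₂ {p p' q q' : P} (f : p ⟶ p') (g : q ⟶ q') : D.ob p q ⟶ D.ob p' q' :=
  (D.tensor.map f).app q ≫ (D.tensor.obj p').map g

@[simp]
lemma map₂_id (p q : P) : D.map₂ (𝟙 p) (𝟙 q) = 𝟙 (D.ob p q) := by simp [map₂]

lemma map₂_id_left (p : P) {q q' : P} (g : q ⟶ q') :
    D.map₂ (𝟙 p) g = (D.tensor.obj p).map g := by simp [map₂]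

lemma map₂_id_right {p p' : P} (f : p ⟶ p') (q : P) :
    D.map₂ f (𝟙 q) = (D.tensor.map f).app q := by simp [map₂]

lemma map₂_comp {p p' p'' q q' q'' : P} (f : p ⟶ p') (f' : p' ⟶ p'') (g : q ⟶ q')
    (g' : q' ⟶ q'') : D.map₂ (f ≫ f') (g ≫ g') = D.map₂ f g ≫ D.map₂ f' g' := by simp [map₂]

/-- The tensor product of two isomorphisms. -/
def iso₂ {p p' q q' : P} (f : p ≅ p') (g : q ≅ q') : D.ob p q ≅ D.ob p' q' where
  hom := D.map₂ f.hom g.hom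
  inv := D.map₂ f.inv g.inv
  hom_inv_id := by simp [← map₂_comp]
  inv_hom_id := by simp [← map₂_comp]

lemma map₂_mu {x x' y y' : E} (f : x ⟶ x') (g : y ⟶ y') :
    D.map₂ (t.map f) (t.map g) ≫ (D.mu x' y').hom = (D.mu x y).hom ≫ t.map (f ⊗ₘ g) := by
  rw [map₂, Category.assoc, mu_natural_right, reassoc_of% @mu_natural_left, ← t.map_comp,
    MonoidalCategory.tensorHom_def]

/-- The functor `(p, q) ↦ p ⊗ q`. -/
def tensor₂ : P × P ⥤ P where
  obj X := D.ob X.1 X.2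
  map f := D.map₂ f.1 f.2
  map_id _ := D.map₂_id _ _
  map_comp _ _ := D.map₂_comp _ _ _ _

/-- The functor `(p, q, r) ↦ (p ⊗ q) ⊗ r`. -/
def tensorLeft₃ : P × P × P ⥤ P where
  obj X := D.ob (D.ob X.1 X.2.1) X.2.2
  map f := D.map₂ (D.map₂ f.1 f.2.1) f.2.2
  map_id _ := (congrArg₂ D.map₂ (D.map₂_id _ _) rfl).trans (D.map₂_id _ _)
  map_comp _ _ := (congrArg₂ D.map₂ (D.map₂_comp _ _ _ _) rfl).trans (D.map₂_comp _ _ _ _)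

/-- The functor `(p, q, r) ↦ p ⊗ (q ⊗ r)`. -/
def tensorRight₃ : P × P × P ⥤ P where
  obj X := D.ob X.1 (D.ob X.2.1 X.2.2)
  map f := D.map₂ f.1 (D.map₂ f.2.1 f.2.2)
  map_id _ := (congrArg₂ D.map₂ rfl (D.map₂_id _ _)).trans (D.map₂_id _ _)
  map_comp _ _ := (congrArg₂ D.map₂ rfl (D.map₂_comp _ _ _ _)).trans (D.map₂_comp _ _ _ _)

/-- The functor `(p, q, r, s) ↦ ((p ⊗ q) ⊗ r) ⊗ s`. -/
def tensorLeft₄ : P × P × P × P ⥤ P where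
  obj X := D.ob (D.ob (D.ob X.1 X.2.1) X.2.2.1) X.2.2.2
  map f := D.map₂ (D.map₂ (D.map₂ f.1 f.2.1) f.2.2.1) f.2.2.2
  map_id X := (congrArg₂ D.map₂ (D.tensorLeft₃.map_id (X.1, X.2.1, X.2.2.1)) rfl).trans
    (D.map₂_id _ _)
  map_comp {X Y Z} f g := (congrArg₂ D.map₂ (D.tensorLeft₃.map_comp (X := (X.1, X.2.1, X.2.2.1))
    (Y := (Y.1, Y.2.1, Y.2.2.1)) (Z := (Z.1, Z.2.1, Z.2.2.1)) (f.1, f.2.1, f.2.2.1)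
    (g.1, g.2.1, g.2.2.1)) rfl).trans (D.map₂_comp _ _ _ _)

lemma denseFor_tensor₂ : DenseFor (t.prod t) D.tensor₂ := by
  refine DenseFor.prod (fun q => ?_) (fun p => ?_)
  · exact (D.dense _ (D.right q)).of_iso (NatIso.ofComponents (fun _ => Iso.refl _) fun f => by
      change _ ≫ 𝟙 _ = 𝟙 _ ≫ D.map₂ f (𝟙 _)
      simp [map₂_id_right])
  · exact (D.dense _ (D.left p)).of_iso (NatIso.ofComponents (fun _ => Iso.refl _) fun f => by
      change _ ≫ 𝟙 _ = 𝟙 _ ≫ D.map₂ (𝟙 _) f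
      simp [map₂_id_left])

lemma denseFor_tensorLeft₃ : DenseFor (t.prod (t.prod t)) D.tensorLeft₃ := by
  have := D.left
  have := D.right
  refine DenseFor.prod (fun q => ?_) (fun p => DenseFor.prod (fun r => ?_) fun q => ?_)
  · exact (D.dense (D.tensor.flip.obj q.1 ⋙ D.tensor.flip.obj q.2)
      (comp_preservesFiniteColimits _ _)).of_iso
      (NatIso.ofComponents (fun _ => Iso.refl _) fun f => by
      change _ ≫ 𝟙 _ = 𝟙 _ ≫ D.map₂ (D.map₂ f (𝟙 _)) (𝟙 _)
      simp [map₂_id_right])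
  · exact (D.dense (D.tensor.obj p ⋙ D.tensor.flip.obj r)
      (comp_preservesFiniteColimits _ _)).of_iso
      (NatIso.ofComponents (fun _ => Iso.refl _) fun f => by
      change _ ≫ 𝟙 _ = 𝟙 _ ≫ D.map₂ (D.map₂ (𝟙 _) f) (𝟙 _)
      simp [map₂_id_right, map₂_id_left])
  · exact (D.dense (D.tensor.obj ((D.tensor.obj p).obj q))
      inferInstance).of_iso (NatIso.ofComponents (fun _ => Iso.refl _) fun f => by
      change _ ≫ 𝟙 _ = 𝟙 _ ≫ D.map₂ (D.map₂ (𝟙 _) (𝟙 _)) f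
      simp [map₂_id_left])

lemma denseFor_tensorRight₃ : DenseFor (t.prod (t.prod t)) D.tensorRight₃ := by
  have := D.left
  have := D.right
  refine DenseFor.prod (fun q => ?_) (fun p => DenseFor.prod (fun r => ?_) fun q => ?_)
  · exact (D.dense (D.tensor.flip.obj ((D.tensor.obj q.1).obj q.2))
      inferInstance).of_iso (NatIso.ofComponents (fun _ => Iso.refl _) fun f => by
      change _ ≫ 𝟙 _ = 𝟙 _ ≫ D.map₂ f (D.map₂ (𝟙 _) (𝟙 _))
      simp [map₂_id_right])
  · exact (D.dense (D.tensor.flip.obj r ⋙ D.tensor.obj p)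
      (comp_preservesFiniteColimits _ _)).of_iso
      (NatIso.ofComponents (fun _ => Iso.refl _) fun f => by
      change _ ≫ 𝟙 _ = 𝟙 _ ≫ D.map₂ (𝟙 _) (D.map₂ f (𝟙 _))
      simp [map₂_id_left, map₂_id_right])
  · exact (D.dense (D.tensor.obj q ⋙ D.tensor.obj p)
      (comp_preservesFiniteColimits _ _)).of_iso
      (NatIso.ofComponents (fun _ => Iso.refl _) fun f => by
      change _ ≫ 𝟙 _ = 𝟙 _ ≫ D.map₂ (𝟙 _) (D.map₂ (𝟙 _) f)
      simp [map₂_id_left])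

lemma denseFor_tensorLeft₄ : DenseFor (t.prod (t.prod (t.prod t))) D.tensorLeft₄ := by
  have := D.left
  have := D.right
  refine DenseFor.prod (fun q => ?_) (fun p => DenseFor.prod (fun r => ?_) fun q =>
    DenseFor.prod (fun r => ?_) fun s => ?_)
  · exact (D.dense ((D.tensor.flip.obj q.1 ⋙ D.tensor.flip.obj q.2.1) ⋙ D.tensor.flip.obj q.2.2)
      (@comp_preservesFiniteColimits _ _ _ _ _ _ _ _ (comp_preservesFiniteColimits _ _) _)).of_iso
      (NatIso.ofComponents (fun _ => Iso.refl _) fun f => by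
      change _ ≫ 𝟙 _ = 𝟙 _ ≫ D.map₂ (D.map₂ (D.map₂ f (𝟙 _)) (𝟙 _)) (𝟙 _)
      simp [map₂_id_right])
  · exact (D.dense ((D.tensor.obj p ⋙ D.tensor.flip.obj r.1) ⋙ D.tensor.flip.obj r.2)
      (@comp_preservesFiniteColimits _ _ _ _ _ _ _ _ (comp_preservesFiniteColimits _ _) _)).of_iso
      (NatIso.ofComponents (fun _ => Iso.refl _) fun f => by
      change _ ≫ 𝟙 _ = 𝟙 _ ≫ D.map₂ (D.map₂ (D.map₂ (𝟙 _) f) (𝟙 _)) (𝟙 _)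
      simp [map₂_id_right, map₂_id_left])
  · exact (D.dense (D.tensor.obj (D.ob p q) ⋙ D.tensor.flip.obj r)
      (comp_preservesFiniteColimits _ _)).of_iso
      (NatIso.ofComponents (fun _ => Iso.refl _) fun f => by
      change _ ≫ 𝟙 _ = 𝟙 _ ≫ D.map₂ (D.map₂ (D.map₂ (𝟙 _) (𝟙 _)) f) (𝟙 _)
      simp [map₂_id_right, map₂_id_left])
  · exact (D.dense (D.tensor.obj (D.ob (D.ob p q) s))
      inferInstance).of_iso (NatIso.ofComponents (fun _ => Iso.refl _) fun f => by
      change _ ≫ 𝟙 _ = 𝟙 _ ≫ D.map₂ (D.map₂ (D.map₂ (𝟙 _) (𝟙 _)) (𝟙 _)) f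
      simp [map₂_id_left])

end TensorData

/-! ### The monoidal structure on the extension -/

namespace TensorData

variable {E : Type u₁} [Category.{v} E] [MonoidalCategory E] {P : Type u₂} [Category.{v} P]
  {t : E ⥤ P} (D : TensorData t)

lemma map₂_mu_left {x x' y y' z z' : E} (f : x ⟶ x') (g : y ⟶ y') (h : z ⟶ z') :
    D.map₂ (D.map₂ (t.map f) (t.map g)) (t.map h) ≫ D.map₂ (D.mu x' y').hom (𝟙 _) ≫
      (D.mu (x' ⊗ y') z').hom =
    (D.map₂ (D.mu x y).hom (𝟙 _) ≫ (D.mu (x ⊗ y) z).hom) ≫ t.map ((f ⊗ₘ g) ⊗ₘ h) := by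
  rw [← reassoc_of% @map₂_comp, map₂_mu, Category.comp_id, Category.assoc, ← map₂_mu D (f ⊗ₘ g) h,
    ← reassoc_of% @map₂_comp, Category.id_comp]

lemma map₂_mu_right {x x' y y' z z' : E} (f : x ⟶ x') (g : y ⟶ y') (h : z ⟶ z') :
    D.map₂ (t.map f) (D.map₂ (t.map g) (t.map h)) ≫ D.map₂ (𝟙 _) (D.mu y' z').hom ≫
      (D.mu x' (y' ⊗ z')).hom =
    (D.map₂ (𝟙 _) (D.mu y z).hom ≫ (D.mu x (y ⊗ z)).hom) ≫ t.map (f ⊗ₘ (g ⊗ₘ h)) := by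
  rw [← reassoc_of% @map₂_comp, map₂_mu, Category.comp_id, Category.assoc, ← map₂_mu D f (g ⊗ₘ h),
    ← reassoc_of% @map₂_comp, Category.id_comp]

/-- On the image of `t`, the triple product bracketed to the left is that of `E`. -/
def muLeft₃ : t.prod (t.prod t) ⋙ D.tensorLeft₃ ≅ leftAssocTensor E ⋙ t :=
  NatIso.ofComponents (fun X => D.iso₂ (D.mu X.1 X.2.1) (Iso.refl (t.obj X.2.2)) ≪≫ D.mu _ X.2.2)
    fun f => D.map₂_mu_left f.1 f.2.1 f.2.2

/-- On the image of `t`, the triple product bracketed to the right is that of `E`. -/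
def muRight₃ : t.prod (t.prod t) ⋙ D.tensorRight₃ ≅ rightAssocTensor E ⋙ t :=
  NatIso.ofComponents (fun X => D.iso₂ (Iso.refl (t.obj X.1)) (D.mu X.2.1 X.2.2) ≪≫ D.mu X.1 _)
    fun f => D.map₂_mu_right f.1 f.2.1 f.2.2

/-- The associator as a natural isomorphism, extended from the associator of `E` by density. -/
noncomputable def associatorNatIso : D.tensorLeft₃ ≅ D.tensorRight₃ :=
  D.denseFor_tensorLeft₃.descIso D.denseFor_tensorRight₃
    (D.muLeft₃ ≪≫ Functor.isoWhiskerRight (MonoidalCategory.associatorNatIso E) t ≪≫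
      D.muRight₃.symm)

/-- The associator, at objects of `P`. -/
noncomputable def assoc (p q r : P) : D.ob (D.ob p q) r ≅ D.ob p (D.ob q r) :=
  D.associatorNatIso.app (p, q, r)

lemma assoc_naturality {p p' q q' r r' : P} (f : p ⟶ p') (g : q ⟶ q') (h : r ⟶ r') :
    D.map₂ (D.map₂ f g) h ≫ (D.assoc p' q' r').hom =
      (D.assoc p q r).hom ≫ D.map₂ f (D.map₂ g h) :=
  D.associatorNatIso.hom.naturality (X := (p, q, r)) (Y := (p', q', r')) (f, g, h)

/-- On the image of `t`, the associator is that of `E`. -/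
lemma assoc_mu (x y z : E) : (D.assoc (t.obj x) (t.obj y) (t.obj z)).hom ≫
    D.map₂ (𝟙 _) (D.mu y z).hom ≫ (D.mu x (y ⊗ z)).hom =
      D.map₂ (D.mu x y).hom (𝟙 _) ≫ (D.mu (x ⊗ y) z).hom ≫ t.map (α_ x y z).hom := by
  have h : (D.assoc (t.obj x) (t.obj y) (t.obj z)).hom =
      (D.map₂ (D.mu x y).hom (𝟙 _) ≫ (D.mu (x ⊗ y) z).hom) ≫ t.map (α_ x y z).hom ≫
        (D.mu x (y ⊗ z)).inv ≫ D.map₂ (𝟙 _) (D.mu y z).inv :=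
    D.denseFor_tensorLeft₃.descTrans_app _ (x, y, z)
  rw [h]
  simp [← reassoc_of% @map₂_comp]

/-- The left unitor, extended from the left unitor of `E` by density. -/
noncomputable def leftUnitorNatIso : D.tensor.obj (t.obj (𝟙_ E)) ≅ 𝟭 P :=
  (D.dense _ (D.left _)).descIso (D.dense _ inferInstance)
    (NatIso.ofComponents (fun x => D.mu _ x ≪≫ t.mapIso (λ_ x)) fun f => by
      dsimp
      rw [reassoc_of% @mu_natural_right, Category.assoc, ← t.map_comp, ← t.map_comp,
        leftUnitor_naturality])

/-- The right unitor, extended from the right unitor of `E` by density. -/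
noncomputable def rightUnitorNatIso : D.tensor.flip.obj (t.obj (𝟙_ E)) ≅ 𝟭 P :=
  (D.dense _ (D.right _)).descIso (D.dense _ inferInstance)
    (NatIso.ofComponents (fun x => D.mu x _ ≪≫ t.mapIso (ρ_ x)) fun f => by
      dsimp
      rw [reassoc_of% @mu_natural_left, Category.assoc, ← t.map_comp, ← t.map_comp,
        rightUnitor_naturality])

end TensorData

/-- The category `P`, as the carrier of the tensor structure defined by `D`. -/
def Tensored {E : Type u₁} [Category.{v} E] [MonoidalCategory E] {P : Type u₂} [Category.{v} P]
  {t : E ⥤ P} (_ : TensorData t) : Type u₂ := P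

namespace Tensored

variable {E : Type u₁} [Category.{v} E] [MonoidalCategory E] {P : Type u₂} [Category.{v} P]
  {t : E ⥤ P} (D : TensorData t)

instance : Category.{v} (Tensored D) := inferInstanceAs (Category.{v} P)

noncomputable instance : MonoidalCategoryStruct (Tensored D) where
  tensorObj p q := D.ob p q
  whiskerLeft p _ _ g := D.map₂ (CategoryStruct.id (obj := P) p) g
  whiskerRight f q := D.map₂ f (CategoryStruct.id (obj := P) q)
  tensorHom f g := D.map₂ f g
  tensorUnit := t.obj (𝟙_ E)
  associator p q r := D.assoc p q r
  leftUnitor p := D.leftUnitorNatIso.app p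
  rightUnitor p := D.rightUnitorNatIso.app p

/-- The functor `t`, with the tensored category as its target. -/
def of : E ⥤ Tensored D := t

/-- The isomorphism between the tensor product of the images of `x` and `y` and the image of
`x ⊗ y`. -/
def mu (x y : E) : (of D).obj x ⊗ (of D).obj y ≅ (of D).obj (x ⊗ y) := D.mu x y

@[simp]
lemma id_tensorHom_id (p q : Tensored D) : 𝟙 p ⊗ₘ 𝟙 q = 𝟙 (p ⊗ q) := D.map₂_id p q

lemma comp_tensorHom_comp {p p' p'' q q' q'' : Tensored D} (f : p ⟶ p') (f' : p' ⟶ p'')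
    (g : q ⟶ q') (g' : q' ⟶ q'') : (f ≫ f') ⊗ₘ (g ≫ g') = (f ⊗ₘ g) ≫ (f' ⊗ₘ g') :=
  D.map₂_comp f f' g g'

lemma tensorHom_mu {x x' y y' : E} (f : x ⟶ x') (g : y ⟶ y') :
    ((of D).map f ⊗ₘ (of D).map g) ≫ (mu D x' y').hom = (mu D x y).hom ≫ (of D).map (f ⊗ₘ g) :=
  D.map₂_mu f g

lemma associator_nat {p p' q q' r r' : Tensored D} (f : p ⟶ p') (g : q ⟶ q') (h : r ⟶ r') :
    ((f ⊗ₘ g) ⊗ₘ h) ≫ (α_ p' q' r').hom = (α_ p q r).hom ≫ (f ⊗ₘ g ⊗ₘ h) :=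
  D.assoc_naturality f g h

lemma associator_mu (x y z : E) : (α_ ((of D).obj x) ((of D).obj y) ((of D).obj z)).hom ≫
    (𝟙 _ ⊗ₘ (mu D y z).hom) ≫ (mu D x (y ⊗ z)).hom =
      ((mu D x y).hom ⊗ₘ 𝟙 _) ≫ (mu D (x ⊗ y) z).hom ≫ (of D).map (α_ x y z).hom :=
  D.assoc_mu x y z

lemma leftUnitor_nat {p q : Tensored D} (f : p ⟶ q) :
    (𝟙 (𝟙_ _) ⊗ₘ f) ≫ (λ_ q).hom = (λ_ p).hom ≫ f := by
  refine Eq.trans ?_ (D.leftUnitorNatIso.hom.naturality f)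
  exact congrArg (· ≫ D.leftUnitorNatIso.hom.app q) (D.map₂_id_left _ f)

lemma rightUnitor_nat {p q : Tensored D} (f : p ⟶ q) :
    (f ⊗ₘ 𝟙 (𝟙_ _)) ≫ (ρ_ q).hom = (ρ_ p).hom ≫ f := by
  refine Eq.trans ?_ (D.rightUnitorNatIso.hom.naturality f)
  exact congrArg (· ≫ D.rightUnitorNatIso.hom.app q) (D.map₂_id_right f _)

lemma leftUnitor_of (x : E) :
    (λ_ ((of D).obj x)).hom = (mu D _ x).hom ≫ (of D).map (λ_ x).hom :=
  (D.dense _ (D.left _)).descTrans_app _ x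

lemma rightUnitor_of (x : E) :
    (ρ_ ((of D).obj x)).hom = (mu D x _).hom ≫ (of D).map (ρ_ x).hom :=
  (D.dense _ (D.right _)).descTrans_app _ x

/-- Morphisms out of `p ⊗ q` agree if they agree after composition with all `a ⊗ b`, for `a` and
`b` morphisms from the image of `E`. -/
lemma tensor_hom_ext {p q r : Tensored D} {f g : p ⊗ q ⟶ r}
    (h : ∀ (x y : E) (a : (of D).obj x ⟶ p) (b : (of D).obj y ⟶ q),
      (a ⊗ₘ b) ≫ f = (a ⊗ₘ b) ≫ g) : f = g :=
  D.denseFor_tensor₂.hom_ext (p := (p, q)) fun e x => h e.1 e.2 x.1 x.2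

lemma tensor_hom_ext₃ {p q r s : Tensored D} {f g : (p ⊗ q) ⊗ r ⟶ s}
    (h : ∀ (x y z : E) (a : (of D).obj x ⟶ p) (b : (of D).obj y ⟶ q) (c : (of D).obj z ⟶ r),
      ((a ⊗ₘ b) ⊗ₘ c) ≫ f = ((a ⊗ₘ b) ⊗ₘ c) ≫ g) : f = g :=
  D.denseFor_tensorLeft₃.hom_ext (p := (p, q, r)) fun e x => h e.1 e.2.1 e.2.2 x.1 x.2.1 x.2.2

lemma tensor_hom_ext₄ {p q r s u : Tensored D} {f g : ((p ⊗ q) ⊗ r) ⊗ s ⟶ u}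
    (h : ∀ (x y z w : E) (a : (of D).obj x ⟶ p) (b : (of D).obj y ⟶ q) (c : (of D).obj z ⟶ r)
      (d : (of D).obj w ⟶ s), (((a ⊗ₘ b) ⊗ₘ c) ⊗ₘ d) ≫ f = (((a ⊗ₘ b) ⊗ₘ c) ⊗ₘ d) ≫ g) : f = g :=
  D.denseFor_tensorLeft₄.hom_ext (p := (p, q, r, s)) fun e x =>
    h e.1 e.2.1 e.2.2.1 e.2.2.2 x.1 x.2.1 x.2.2.1 x.2.2.2

/-- The pentagon on the image of `E` is the image of the pentagon in `E`: after composition with the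
isomorphism from `F x ⊗ (F y ⊗ (F z ⊗ F w))` to `F (x ⊗ (y ⊗ (z ⊗ w)))`, where `F` is the canonical
functor, all structure maps can be moved into `E`. -/
lemma pentagon_of (x y z w : E) :
    let F := of D
    ((α_ (F.obj x) (F.obj y) (F.obj z)).hom ⊗ₘ 𝟙 (F.obj w)) ≫ (α_ _ _ _).hom ≫
      (𝟙 (F.obj x) ⊗ₘ (α_ (F.obj y) (F.obj z) (F.obj w)).hom) =
    (α_ _ _ _).hom ≫ (α_ (F.obj x) (F.obj y) (F.obj z ⊗ F.obj w)).hom := by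
  intro F
  have hm : Mono ((𝟙 (F.obj x) ⊗ₘ (𝟙 (F.obj y) ⊗ₘ (mu D z w).hom)) ≫
      (𝟙 _ ⊗ₘ (mu D y _).hom) ≫ (mu D x _).hom) := by
    have := (D.iso₂ (Iso.refl (t.obj x)) (D.iso₂ (Iso.refl (t.obj y)) (D.mu z w)) ≪≫
      D.iso₂ (Iso.refl (t.obj x)) (D.mu y _) ≪≫ D.mu x _).isIso_hom
    exact @IsIso.mono_of_iso _ _ _ _ _ this
  rw [← cancel_mono ((𝟙 (F.obj x) ⊗ₘ (𝟙 (F.obj y) ⊗ₘ (mu D z w).hom)) ≫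
      (𝟙 _ ⊗ₘ (mu D y _).hom) ≫ (mu D x _).hom)]
  have e₁ : (𝟙 (F.obj x) ⊗ₘ (α_ (F.obj y) (F.obj z) (F.obj w)).hom) ≫
      (𝟙 (F.obj x) ⊗ₘ (𝟙 (F.obj y) ⊗ₘ (mu D z w).hom)) ≫ (𝟙 _ ⊗ₘ (mu D y _).hom) =
      (𝟙 (F.obj x) ⊗ₘ ((mu D y z).hom ⊗ₘ 𝟙 _)) ≫ (𝟙 _ ⊗ₘ (mu D (y ⊗ z) w).hom) ≫
        (F.map (𝟙 x) ⊗ₘ F.map (α_ y z w).hom) := by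
    rw [F.map_id]
    simp only [← comp_tensorHom_comp, Category.id_comp]
    rw [associator_mu]
  have e₂ : ((α_ (F.obj x) (F.obj y) (F.obj z)).hom ⊗ₘ 𝟙 (F.obj w)) ≫
      ((𝟙 (F.obj x) ⊗ₘ (mu D y z).hom) ⊗ₘ 𝟙 _) ≫ ((mu D x (y ⊗ z)).hom ⊗ₘ 𝟙 _) =
      (((mu D x y).hom ⊗ₘ 𝟙 _) ⊗ₘ 𝟙 _) ≫ ((mu D (x ⊗ y) z).hom ⊗ₘ 𝟙 _) ≫
        (F.map (α_ x y z).hom ⊗ₘ F.map (𝟙 w)) := by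
    rw [F.map_id]
    simp only [← comp_tensorHom_comp, Category.id_comp]
    rw [associator_mu]
  have e₃ : (α_ (F.obj x ⊗ F.obj y) (F.obj z) (F.obj w)).hom ≫
      (𝟙 _ ⊗ₘ (mu D z w).hom) ≫ ((mu D x y).hom ⊗ₘ 𝟙 _) =
      (((mu D x y).hom ⊗ₘ 𝟙 _) ⊗ₘ 𝟙 _) ≫ (α_ _ _ _).hom ≫ (𝟙 _ ⊗ₘ (mu D z w).hom) := by
    rw [reassoc_of% @associator_nat, ← comp_tensorHom_comp, ← comp_tensorHom_comp]
    simp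
    rfl
  calc _ = ((α_ (F.obj x) (F.obj y) (F.obj z)).hom ⊗ₘ 𝟙 (F.obj w)) ≫ (α_ _ _ _).hom ≫
        ((𝟙 (F.obj x) ⊗ₘ (α_ (F.obj y) (F.obj z) (F.obj w)).hom) ≫
        (𝟙 (F.obj x) ⊗ₘ (𝟙 (F.obj y) ⊗ₘ (mu D z w).hom)) ≫ (𝟙 _ ⊗ₘ (mu D y _).hom)) ≫
        (mu D x _).hom := by simp only [Category.assoc]
    _ = (((α_ (F.obj x) (F.obj y) (F.obj z)).hom ⊗ₘ 𝟙 (F.obj w)) ≫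
        ((𝟙 (F.obj x) ⊗ₘ (mu D y z).hom) ⊗ₘ 𝟙 _) ≫ ((mu D x (y ⊗ z)).hom ⊗ₘ 𝟙 _)) ≫
        (mu D (x ⊗ (y ⊗ z)) w).hom ≫ F.map (α_ x (y ⊗ z) w).hom ≫
        F.map (𝟙 x ⊗ₘ (α_ y z w).hom) := by
      rw [e₁]
      simp only [Category.assoc]
      rw [tensorHom_mu, ← reassoc_of% @associator_nat, reassoc_of% @associator_mu]
    _ = (((mu D x y).hom ⊗ₘ 𝟙 _) ⊗ₘ 𝟙 _) ≫ ((mu D (x ⊗ y) z).hom ⊗ₘ 𝟙 _) ≫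
        (mu D ((x ⊗ y) ⊗ z) w).hom ≫ F.map ((α_ x y z).hom ⊗ₘ 𝟙 w) ≫
        F.map (α_ x (y ⊗ z) w).hom ≫ F.map (𝟙 x ⊗ₘ (α_ y z w).hom) := by
      rw [e₂]
      simp only [Category.assoc]
      rw [reassoc_of% @tensorHom_mu]
    _ = (((mu D x y).hom ⊗ₘ 𝟙 _) ⊗ₘ 𝟙 _) ≫ ((mu D (x ⊗ y) z).hom ⊗ₘ 𝟙 _) ≫
        (mu D ((x ⊗ y) ⊗ z) w).hom ≫ F.map (α_ (x ⊗ y) z w).hom ≫ F.map (α_ x y (z ⊗ w)).hom := by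
      simp only [← F.map_comp]
      rw [MonoidalCategory.tensorHom_id, MonoidalCategory.id_tensorHom, MonoidalCategory.pentagon]
    _ = _ := by
      have e₄ := reassoc_of% (associator_mu D (x ⊗ y) z w)
      rw [← e₄ (F.map (α_ x y (z ⊗ w)).hom), ← reassoc_of% e₃, ← associator_mu]
      simp only [Category.assoc]
      rw [← reassoc_of% @associator_nat]
      simp
      rfl

/-- The triangle on the image of `E` is the image of the triangle in `E`. -/
lemma triangle_of (x y : E) :
    letI F := of D
    (α_ (F.obj x) (𝟙_ (Tensored D)) (F.obj y)).hom ≫ (𝟙 (F.obj x) ⊗ₘ (λ_ (F.obj y)).hom) =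
      (ρ_ (F.obj x)).hom ⊗ₘ 𝟙 (F.obj y) := by
  let F := of D
  rw [← cancel_mono (mu D x y).hom, rightUnitor_of, leftUnitor_of]
  have e₁ := tensorHom_mu D (𝟙 x) (λ_ y).hom
  have e₂ := tensorHom_mu D (ρ_ x).hom (𝟙 y)
  rw [CategoryTheory.Functor.map_id] at e₁ e₂
  calc
    _ = (α_ (F.obj x) (F.obj (𝟙_ E)) (F.obj y)).hom ≫ (𝟙 _ ⊗ₘ (mu D (𝟙_ E) y).hom) ≫
        (mu D x (𝟙_ E ⊗ y)).hom ≫ F.map (𝟙 x ⊗ₘ (λ_ y).hom) := by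
      rw [← e₁, ← reassoc_of% @comp_tensorHom_comp, Category.id_comp, Category.assoc]; rfl
    _ = ((mu D x (𝟙_ E)).hom ⊗ₘ 𝟙 _) ≫ (mu D _ y).hom ≫ F.map ((ρ_ x).hom ⊗ₘ 𝟙 y) := by
      have := reassoc_of% (associator_mu D x (𝟙_ E) y)
      rw [this, ← F.map_comp, MonoidalCategory.id_tensorHom, MonoidalCategory.triangle,
        MonoidalCategory.tensorHom_id]
    _ = _ := by
      rw [← e₂, ← reassoc_of% @comp_tensorHom_comp, Category.id_comp]; rfl

noncomputable instance : MonoidalCategory (Tensored D) :=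
  MonoidalCategory.ofTensorHom
    (id_tensorHom_id := id_tensorHom_id D)
    (id_tensorHom := fun _ _ _ _ => rfl)
    (tensorHom_id := fun _ _ => rfl)
    (tensorHom_comp_tensorHom := fun _ _ _ _ => (comp_tensorHom_comp D _ _ _ _).symm)
    (associator_naturality := associator_nat D)
    (leftUnitor_naturality := leftUnitor_nat D)
    (rightUnitor_naturality := rightUnitor_nat D)
    (pentagon := fun p q r s => by
      refine tensor_hom_ext₄ D fun x y z w a b c d => ?_
      have h₁ : (((a ⊗ₘ b) ⊗ₘ c) ⊗ₘ d) ≫ ((α_ p q r).hom ⊗ₘ 𝟙 s) =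
          ((α_ _ _ _).hom ⊗ₘ 𝟙 _) ≫ ((a ⊗ₘ (b ⊗ₘ c)) ⊗ₘ d) := by
        rw [← comp_tensorHom_comp, ← comp_tensorHom_comp, associator_nat, Category.comp_id,
          Category.id_comp]
      have h₂ : (a ⊗ₘ ((b ⊗ₘ c) ⊗ₘ d)) ≫ (𝟙 p ⊗ₘ (α_ q r s).hom) =
          (𝟙 _ ⊗ₘ (α_ _ _ _).hom) ≫ (a ⊗ₘ (b ⊗ₘ (c ⊗ₘ d))) := by
        rw [← comp_tensorHom_comp, ← comp_tensorHom_comp, associator_nat, Category.comp_id,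
          Category.id_comp]
      rw [reassoc_of% h₁, reassoc_of% @associator_nat, h₂, reassoc_of% @associator_nat,
        associator_nat]
      simpa only [Category.assoc] using
        congrArg (· ≫ (a ⊗ₘ (b ⊗ₘ (c ⊗ₘ d)))) (pentagon_of D x y z w))
    (triangle := fun p q => by
      refine tensor_hom_ext₃ D fun x z y a c b => ?_
      have h₁ : (a ⊗ₘ c) ⊗ₘ b = ((𝟙 _ ⊗ₘ c) ⊗ₘ 𝟙 _) ≫ ((a ⊗ₘ 𝟙 _) ⊗ₘ b) := by
        rw [← comp_tensorHom_comp, ← comp_tensorHom_comp]; simp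
      have h₂ : (a ⊗ₘ (𝟙 (𝟙_ _) ⊗ₘ b)) ≫ (𝟙 p ⊗ₘ (λ_ q).hom) =
          (𝟙 _ ⊗ₘ (λ_ _).hom) ≫ (a ⊗ₘ b) := by
        rw [← comp_tensorHom_comp, ← comp_tensorHom_comp, leftUnitor_nat, Category.comp_id,
          Category.id_comp]
      have h₃ : ((a ⊗ₘ 𝟙 (𝟙_ _)) ⊗ₘ b) ≫ ((ρ_ p).hom ⊗ₘ 𝟙 q) =
          ((ρ_ _).hom ⊗ₘ 𝟙 _) ≫ (a ⊗ₘ b) := by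
        rw [← comp_tensorHom_comp, ← comp_tensorHom_comp, rightUnitor_nat, Category.comp_id,
          Category.id_comp]
      rw [h₁, Category.assoc, Category.assoc, h₃, reassoc_of% @associator_nat, h₂]
      refine congrArg (_ ≫ ·) ?_
      simpa only [Category.assoc] using congrArg (· ≫ (a ⊗ₘ b)) (triangle_of D x y))

/-- The canonical functor is strong monoidal, with the identity as unit isomorphism. -/
noncomputable instance : (of D).Monoidal :=
  Functor.CoreMonoidal.toMonoidal
    { εIso := Iso.refl _
      μIso := mu D
      μIso_hom_natural_left := fun f y => by
        have := tensorHom_mu D f (𝟙 y)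
        rwa [CategoryTheory.Functor.map_id, MonoidalCategory.tensorHom_id,
          MonoidalCategory.tensorHom_id] at this
      μIso_hom_natural_right := fun x f => by
        have := tensorHom_mu D (𝟙 x) f
        rwa [CategoryTheory.Functor.map_id, MonoidalCategory.id_tensorHom,
          MonoidalCategory.id_tensorHom] at this
      associativity := fun x y z => by
        have := associator_mu D x y z
        rw [MonoidalCategory.tensorHom_id, MonoidalCategory.id_tensorHom] at this
        exact this.symm
      left_unitality := fun x => by
        refine (leftUnitor_of D x).trans ?_
        change _ = (𝟙 (𝟙_ (Tensored D)) ▷ (of D).obj x) ≫ _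
        rw [id_whiskerRight]
        exact (Category.id_comp _).symm
      right_unitality := fun x => by
        refine (rightUnitor_of D x).trans ?_
        change _ = ((of D).obj x ◁ 𝟙 (𝟙_ (Tensored D))) ≫ _
        rw [MonoidalCategory.whiskerLeft_id]
        exact (Category.id_comp _).symm }

instance (p : Tensored D) : PreservesFiniteColimits (tensorLeft p) := by
  have := D.left p
  exact preservesFiniteColimits_of_natIso (F := D.tensor.obj p) (NatIso.ofComponents
    (fun _ => Iso.refl _) fun f => by
      change _ ≫ 𝟙 _ = 𝟙 _ ≫ D.map₂ (𝟙 _) f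
      rw [Category.comp_id, Category.id_comp]
      exact (D.map₂_id_left p f).symm)

instance (p : Tensored D) : PreservesFiniteColimits (tensorRight p) := by
  have := D.right p
  exact preservesFiniteColimits_of_natIso (F := D.tensor.flip.obj p) (NatIso.ofComponents
    (fun _ => Iso.refl _) fun f => by
      change _ ≫ 𝟙 _ = 𝟙 _ ≫ D.map₂ f (𝟙 _)
      rw [Category.comp_id, Category.id_comp]
      exact (D.map₂_id_right f p).symm)

end Tensored

/-! ### The symmetry on the extension -/

namespace TensorData

variable {E : Type u₁} [Category.{v} E] [MonoidalCategory E] {P : Type u₂} [Category.{v} P]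
  {t : E ⥤ P} (D : TensorData t)

lemma denseFor_swap_tensor₂ : DenseFor (t.prod t) (CategoryTheory.Prod.swap P P ⋙ D.tensor₂) := by
  refine DenseFor.prod (fun q => ?_) (fun p => ?_)
  · exact (D.dense _ (D.left q)).of_iso (NatIso.ofComponents (fun _ => Iso.refl _) fun f => by
      change _ ≫ 𝟙 _ = 𝟙 _ ≫ D.map₂ (𝟙 _) f
      simp [map₂_id_left])
  · exact (D.dense _ (D.right p)).of_iso (NatIso.ofComponents (fun _ => Iso.refl _) fun f => by
      change _ ≫ 𝟙 _ = 𝟙 _ ≫ D.map₂ f (𝟙 _)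
      simp [map₂_id_right])

variable [SymmetricCategory E]

/-- The symmetry as a natural isomorphism, extended from the symmetry of `E` by density. -/
noncomputable def braidingNatIso : D.tensor₂ ≅ CategoryTheory.Prod.swap P P ⋙ D.tensor₂ :=
  D.denseFor_tensor₂.descIso D.denseFor_swap_tensor₂ <| NatIso.ofComponents
    (fun X => D.mu X.1 X.2 ≪≫ t.mapIso (β_ X.1 X.2) ≪≫ (D.mu X.2 X.1).symm) fun {X Y} f => by
      change D.map₂ (t.map f.1) (t.map f.2) ≫ (D.mu Y.1 Y.2).hom ≫ t.map _ ≫ (D.mu _ _).inv =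
        ((D.mu X.1 X.2).hom ≫ t.map _ ≫ (D.mu _ _).inv) ≫ D.map₂ (t.map f.2) (t.map f.1)
      rw [reassoc_of% @map₂_mu, ← t.map_comp_assoc, BraidedCategory.braiding_naturality, t.map_comp,
        Category.assoc, Category.assoc, Category.assoc, ← cancel_mono (D.mu Y.2 Y.1).hom]
      simp [map₂_mu]

end TensorData

namespace Tensored

variable {E : Type u₁} [Category.{v} E] [MonoidalCategory E] [SymmetricCategory E]
  {P : Type u₂} [Category.{v} P] {t : E ⥤ P} (D : TensorData t)

/-- The symmetry, at objects of the tensored category. -/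
noncomputable def braiding (p q : Tensored D) : p ⊗ q ≅ q ⊗ p := D.braidingNatIso.app (p, q)

lemma braiding_nat {p p' q q' : Tensored D} (f : p ⟶ p') (g : q ⟶ q') :
    (f ⊗ₘ g) ≫ (braiding D p' q').hom = (braiding D p q).hom ≫ (g ⊗ₘ f) :=
  D.braidingNatIso.hom.naturality (X := (p, q)) (Y := (p', q')) (f, g)

open Functor.LaxMonoidal Functor.OplaxMonoidal

/-- On the image of `E`, the symmetry is that of `E`. -/
lemma map_braiding_of (x y : E) : (of D).map (β_ x y).hom =
    δ (of D) x y ≫ (braiding D ((of D).obj x) ((of D).obj y)).hom ≫ μ (of D) y x := by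
  have : (braiding D ((of D).obj x) ((of D).obj y)).hom =
      (mu D x y).hom ≫ (of D).map (β_ x y).hom ≫ (mu D y x).inv :=
    D.denseFor_tensor₂.descTrans_app _ (x, y)
  rw [this]
  change _ = (mu D x y).inv ≫ _ ≫ (mu D y x).hom
  simp

lemma braiding_right {p q q' : Tensored D} (g : q ⟶ q') :
    p ◁ g ≫ (braiding D p q').hom = (braiding D p q).hom ≫ g ▷ p := by
  simpa using braiding_nat D (𝟙 p) g

lemma braiding_left {p p' q : Tensored D} (f : p ⟶ p') :
    f ▷ q ≫ (braiding D p' q).hom = (braiding D p q).hom ≫ q ◁ f := by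
  simpa using braiding_nat D f (𝟙 q)

lemma symmetry_aux (p q : Tensored D) : (braiding D p q).hom ≫ (braiding D q p).hom = 𝟙 _ := by
  refine tensor_hom_ext D fun x y a b => ?_
  rw [reassoc_of% (braiding_nat D a b), braiding_nat]
  have := congrArg (of D).map (SymmetricCategory.symmetry x y)
  rw [Functor.map_comp, map_braiding_of, map_braiding_of, CategoryTheory.Functor.map_id,
    ← cancel_epi (μ (of D) x y), ← cancel_mono (δ (of D) x y)] at this
  simp at this
  rw [reassoc_of% this]
  simp

lemma hexagon_of (x y z : E) : letI F := of D
    (α_ (F.obj x) (F.obj y) (F.obj z)).hom ≫ (braiding D (F.obj x) (F.obj y ⊗ F.obj z)).hom ≫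
        (α_ (F.obj y) (F.obj z) (F.obj x)).hom =
      (braiding D (F.obj x) (F.obj y)).hom ▷ (F.obj z) ≫
        (α_ (F.obj y) (F.obj x) (F.obj z)).hom ≫
        (F.obj y) ◁ (braiding D (F.obj x) (F.obj z)).hom := by
  have := congrArg (of D).map (BraidedCategory.hexagon_forward x y z)
  simp only [Functor.map_comp, Functor.Monoidal.map_associator, Functor.Monoidal.map_whiskerRight,
    Functor.Monoidal.map_whiskerLeft, map_braiding_of, Category.assoc,
    Functor.Monoidal.μ_δ_assoc, reassoc_of% @braiding_right, comp_whiskerRight,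
    MonoidalCategory.whiskerLeft_comp, Functor.Monoidal.whiskerRight_μ_δ_assoc,
    Functor.Monoidal.whiskerLeft_μ_δ_assoc, cancel_epi] at this
  simpa only [← Category.assoc, cancel_mono] using this

lemma braiding_inv (p q : Tensored D) : (braiding D p q).inv = (braiding D q p).hom := by
  rw [← cancel_epi (braiding D p q).hom, Iso.hom_inv_id, symmetry_aux]

lemma hexagon_aux (p q r : Tensored D) :
    (α_ p q r).hom ≫ (braiding D p (q ⊗ r)).hom ≫ (α_ q r p).hom =
      (braiding D p q).hom ▷ r ≫ (α_ q p r).hom ≫ q ◁ (braiding D p r).hom := by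
  refine tensor_hom_ext₃ D fun x y z a b c => ?_
  have h₁ : ((a ⊗ₘ b) ⊗ₘ c) ≫ (braiding D p q).hom ▷ r =
      (braiding D _ _).hom ▷ _ ≫ ((b ⊗ₘ a) ⊗ₘ c) := by
    rw [← MonoidalCategory.tensorHom_id, ← MonoidalCategory.tensorHom_id,
      ← comp_tensorHom_comp, ← comp_tensorHom_comp, braiding_nat, Category.comp_id,
        Category.id_comp]
  have h₂ : (b ⊗ₘ (a ⊗ₘ c)) ≫ q ◁ (braiding D p r).hom =
      _ ◁ (braiding D _ _).hom ≫ (b ⊗ₘ (c ⊗ₘ a)) := by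
    rw [← MonoidalCategory.id_tensorHom, ← MonoidalCategory.id_tensorHom,
      ← comp_tensorHom_comp, ← comp_tensorHom_comp, braiding_nat, Category.comp_id,
        Category.id_comp]
  rw [reassoc_of% @associator_nat, reassoc_of% (braiding_nat D a (b ⊗ₘ c)), associator_nat,
    reassoc_of% h₁, reassoc_of% @associator_nat, h₂]
  simpa only [Category.assoc] using congrArg (· ≫ (b ⊗ₘ (c ⊗ₘ a))) (hexagon_of D x y z)

noncomputable instance : SymmetricCategory (Tensored D) where
  braiding := braiding D
  braiding_naturality_right p q r f := braiding_right D f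
  braiding_naturality_left f r := braiding_left D f
  hexagon_forward := hexagon_aux D
  hexagon_reverse p q r := by
    have := congrArg Iso.inv (Iso.ext (hexagon_aux D r p q) : α_ r p q ≪≫ braiding D r (p ⊗ q) ≪≫
      α_ p q r = whiskerRightIso (braiding D r p) q ≪≫ α_ p r q ≪≫
        whiskerLeftIso p (braiding D r q))
    simpa [braiding_inv] using this
  symmetry := symmetry_aux D

noncomputable instance ofBraided : (of D).Braided where
  braided x y := by
    change _ = (braiding D _ _).hom ≫ _
    rw [map_braiding_of]
    simp

end Tensored

/-! ### The additive structure of a completion -/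

/-- Data on a dense functor `t` out of a preadditive category that force an additive structure on
its target: every `x` has a biproduct with itself that `t` sends to a coproduct, and `t` sends some
object to an initial object. The latter is indexed by `x`, so that `E` may be empty. -/
structure DiagonalData {E : Type u₁} [Category.{v} E] [Preadditive E] {P : Type u₂} [Category.{v} P]
    (t : E ⥤ P) where
  bicone : ∀ x : E, BinaryBicone x x
  isColimit : ∀ x, IsColimit (BinaryCofan.mk (t.map (bicone x).inl) (t.map (bicone x).inr))
  zero : E → E
  isInitial : ∀ x, IsInitial (t.obj (zero x))
  dense : DenseFor t (𝟭 P)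

namespace DiagonalData

variable {E : Type u₁} [Category.{v} E] [Preadditive E] {P : Type u₂} [Category.{v} P]
  {t : E ⥤ P} (D : DiagonalData t)

/-- The morphism induced from `x ⊞ x`. -/
def desc {x : E} {q : P} (f g : t.obj x ⟶ q) : t.obj (D.bicone x).pt ⟶ q :=
  (D.isColimit x).desc (BinaryCofan.mk f g)

@[simp]
lemma inl_desc {x : E} {q : P} (f g : t.obj x ⟶ q) :
    t.map (D.bicone x).inl ≫ D.desc f g = f :=
  (D.isColimit x).fac (BinaryCofan.mk f g) ⟨WalkingPair.left⟩

@[simp]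
lemma inr_desc {x : E} {q : P} (f g : t.obj x ⟶ q) :
    t.map (D.bicone x).inr ≫ D.desc f g = g :=
  (D.isColimit x).fac (BinaryCofan.mk f g) ⟨WalkingPair.right⟩

@[simp]
lemma inl_desc_comp {x : E} {q q' : P} (f g : t.obj x ⟶ q) (h : q ⟶ q') :
    t.map (D.bicone x).inl ≫ D.desc f g ≫ h = f ≫ h := by rw [← Category.assoc, inl_desc]

@[simp]
lemma inr_desc_comp {x : E} {q q' : P} (f g : t.obj x ⟶ q) (h : q ⟶ q') :
    t.map (D.bicone x).inr ≫ D.desc f g ≫ h = g ≫ h := by rw [← Category.assoc, inr_desc]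

lemma desc_ext {x : E} {q : P} {f g : t.obj (D.bicone x).pt ⟶ q}
    (h₁ : t.map (D.bicone x).inl ≫ f = t.map (D.bicone x).inl ≫ g)
    (h₂ : t.map (D.bicone x).inr ≫ f = t.map (D.bicone x).inr ≫ g) : f = g :=
  BinaryCofan.IsColimit.hom_ext (D.isColimit x) h₁ h₂

/-- The sum of two morphisms out of `t x`, as the composite of the diagonal `t x ⟶ t (x ⊞ x)` with
the morphism `[f, g]`. -/
def addAux {x : E} {q : P} (f g : t.obj x ⟶ q) : t.obj x ⟶ q :=
  t.map ((D.bicone x).inl + (D.bicone x).inr) ≫ D.desc f g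

lemma addAux_comp {x : E} {q q' : P} (f g : t.obj x ⟶ q) (h : q ⟶ q') :
    D.addAux f g ≫ h = D.addAux (f ≫ h) (g ≫ h) := by
  rw [addAux, addAux, Category.assoc]
  congr 1
  exact D.desc_ext (by simp) (by simp)

lemma map_comp_addAux {x y : E} {q : P} (w : x ⟶ y) (f g : t.obj y ⟶ q) :
    t.map w ≫ D.addAux f g = D.addAux (t.map w ≫ f) (t.map w ≫ g) := by
  -- the morphism `w ⊞ w` commutes with the diagonals
  let w' : (D.bicone x).pt ⟶ (D.bicone y).pt :=
    (D.bicone x).fst ≫ w ≫ (D.bicone y).inl + (D.bicone x).snd ≫ w ≫ (D.bicone y).inr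
  have h : t.map w' ≫ D.desc f g = D.desc (t.map w ≫ f) (t.map w ≫ g) := by
    refine D.desc_ext ?_ ?_
    · simp [w', ← t.map_comp_assoc]
    · simp [w', ← t.map_comp_assoc]
  rw [addAux, addAux, ← h, ← t.map_comp_assoc, ← t.map_comp_assoc]
  congr 2
  simp [w']

/-- The sum of `E` is compatible with the sum of morphisms out of objects `t x`. -/
lemma map_add_comp {x y : E} {q : P} (u w : x ⟶ y) (f : t.obj y ⟶ q) :
    t.map (u + w) ≫ f = D.addAux (t.map u ≫ f) (t.map w ≫ f) := by
  have : D.desc (t.map u ≫ f) (t.map w ≫ f) =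
      t.map ((D.bicone x).fst ≫ u + (D.bicone x).snd ≫ w) ≫ f :=
    D.desc_ext (by simp [← t.map_comp_assoc]) (by simp [← t.map_comp_assoc])
  rw [addAux, this, ← t.map_comp_assoc]
  simp

/-- The zero morphism out of `t x`, which factors through an initial object. -/
def zeroAux (x : E) (q : P) : t.obj x ⟶ q := t.map 0 ≫ (D.isInitial x).to q

lemma map_zero_comp {x y : E} {q : P} (f : t.obj y ⟶ q) :
    t.map (0 : x ⟶ y) ≫ f = D.zeroAux x q := by
  rw [zeroAux, ← zero_comp (X := x) (f := (0 : D.zero x ⟶ y)), t.map_comp, Category.assoc]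
  congr 1
  exact (D.isInitial x).hom_ext _ _

lemma addAux_zeroAux {x : E} {q : P} (f : t.obj x ⟶ q) : D.addAux f (D.zeroAux x q) = f := by
  have := D.map_add_comp (𝟙 x) 0 f
  rwa [add_zero, D.map_zero_comp, t.map_id, Category.id_comp, eq_comm] at this

lemma zeroAux_addAux {x : E} {q : P} (f : t.obj x ⟶ q) : D.addAux (D.zeroAux x q) f = f := by
  have := D.map_add_comp 0 (𝟙 x) f
  rwa [zero_add, D.map_zero_comp, t.map_id, Category.id_comp, eq_comm] at this

/-- The interchange law, from which commutativity and associativity follow. -/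
lemma addAux_addAux {x : E} {q : P} (f g h k : t.obj x ⟶ q) :
    D.addAux (D.addAux f g) (D.addAux h k) = D.addAux (D.addAux f h) (D.addAux g k) := by
  have : D.desc (D.addAux f g) (D.addAux h k) = D.addAux (D.desc f h) (D.desc g k) :=
    D.desc_ext (by simp [map_comp_addAux]) (by simp [map_comp_addAux])
  rw [addAux, this, map_comp_addAux]
  rfl

lemma addAux_comm {x : E} {q : P} (f g : t.obj x ⟶ q) : D.addAux f g = D.addAux g f := by
  have := D.addAux_addAux (D.zeroAux x q) f g (D.zeroAux x q)
  simpa only [zeroAux_addAux, addAux_zeroAux] using this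

lemma addAux_assoc {x : E} {q : P} (f g h : t.obj x ⟶ q) :
    D.addAux (D.addAux f g) h = D.addAux f (D.addAux g h) := by
  have := D.addAux_addAux f g (D.zeroAux x q) h
  simpa only [zeroAux_addAux, addAux_zeroAux] using this

/-- By density the sum is defined for morphisms out of an arbitrary object. -/
lemma existsUnique_add {p q : P} (f g : p ⟶ q) : ∃! h : p ⟶ q,
    ∀ (x : E) (u : t.obj x ⟶ p), u ≫ h = D.addAux (u ≫ f) (u ≫ g) :=
  D.dense p q (fun e x => D.addAux (x ≫ f) (x ≫ g)) fun e e' u x => by simp [map_comp_addAux]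

lemma existsUnique_zero (p q : P) : ∃! h : p ⟶ q,
    ∀ (x : E) (u : t.obj x ⟶ p), u ≫ h = D.zeroAux x q :=
  D.dense p q (fun e x => D.zeroAux e q) fun e e' u x => by
    simp only [zeroAux, Functor.id_map, ← t.map_comp_assoc, comp_zero]
    exact (D.map_zero_comp ((D.isInitial e').to q)).symm

lemma existsUnique_smul (D : DiagonalData t) {K : Type w} [CommRing K] [Linear K E] {p q : P}
    (r : K) (f : p ⟶ q) :
    ∃! h : p ⟶ q, ∀ (x : E) (u : t.obj x ⟶ p), u ≫ h = t.map (r • 𝟙 x) ≫ u ≫ f :=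
  D.dense p q (fun e x => t.map (r • 𝟙 e) ≫ x ≫ f) fun e e' u x => by
    simp [← t.map_comp_assoc]

/-- The sum of two morphisms. -/
noncomputable def add {p q : P} (f g : p ⟶ q) : p ⟶ q := (D.existsUnique_add f g).choose

lemma comp_add {x : E} {p q : P} (f g : p ⟶ q) (u : t.obj x ⟶ p) :
    u ≫ D.add f g = D.addAux (u ≫ f) (u ≫ g) :=
  (D.existsUnique_add f g).choose_spec.1 x u

/-- The zero morphism. -/
noncomputable def zeroHom (p q : P) : p ⟶ q := (D.existsUnique_zero p q).choose

lemma comp_zeroHom {x : E} {p : P} (q : P) (u : t.obj x ⟶ p) :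
    u ≫ D.zeroHom p q = D.zeroAux x q :=
  (D.existsUnique_zero p q).choose_spec.1 x u

/-- The product of a scalar and a morphism: scalars act on `t x` through `r • 𝟙 x`. For `K = ℤ` and
`r = -1` this gives the negative. -/
noncomputable def smul (D : DiagonalData t) {K : Type w} [CommRing K] [Linear K E] {p q : P}
    (r : K) (f : p ⟶ q) : p ⟶ q := (D.existsUnique_smul r f).choose

lemma comp_smul {K : Type w} [CommRing K] [Linear K E] {x : E} {p q : P} (r : K) (f : p ⟶ q)
    (u : t.obj x ⟶ p) : u ≫ D.smul r f = t.map (r • 𝟙 x) ≫ u ≫ f :=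
  (D.existsUnique_smul r f).choose_spec.1 x u

lemma hom_ext (D : DiagonalData t) {p q : P} {f g : p ⟶ q}
    (h : ∀ (x : E) (u : t.obj x ⟶ p), u ≫ f = u ≫ g) : f = g :=
  DenseFor.hom_ext D.dense h

/-- The preadditive structure on `P`. -/
noncomputable abbrev preadditive : Preadditive P where
  homGroup p q :=
    { add := D.add
      zero := D.zeroHom p q
      neg f := D.smul (-1 : ℤ) f
      add_assoc _ _ _ := D.hom_ext fun x u => by
        change u ≫ D.add (D.add _ _) _ = u ≫ D.add _ (D.add _ _)
        simp only [comp_add, addAux_assoc]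
      zero_add f := D.hom_ext fun x u => by
        change u ≫ D.add (D.zeroHom p q) _ = _
        simp only [comp_add, comp_zeroHom, zeroAux_addAux]
      add_zero f := D.hom_ext fun x u => by
        change u ≫ D.add _ (D.zeroHom p q) = _
        simp only [comp_add, comp_zeroHom, addAux_zeroAux]
      add_comm f g := D.hom_ext fun x u => by
        change u ≫ D.add _ _ = u ≫ D.add _ _
        rw [comp_add, addAux_comm, comp_add]
      neg_add_cancel f := D.hom_ext fun x u => by
        change u ≫ D.add (D.smul (-1 : ℤ) f) f = u ≫ D.zeroHom p q
        rw [comp_add, comp_smul, comp_zeroHom]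
        have := D.map_add_comp ((-1 : ℤ) • 𝟙 x) (𝟙 x) (u ≫ f)
        rw [t.map_id, Category.id_comp] at this
        rw [← this]
        simp [D.map_zero_comp]
      nsmul := @nsmulRec _ ⟨D.zeroHom p q⟩ ⟨D.add⟩
      zsmul := @zsmulRec _ ⟨D.zeroHom p q⟩ ⟨D.add⟩ ⟨fun f => D.smul (-1 : ℤ) f⟩
        (@nsmulRec _ ⟨D.zeroHom p q⟩ ⟨D.add⟩) }
  add_comp p q r f f' g := D.hom_ext fun x u => by
    change u ≫ D.add f f' ≫ g = u ≫ D.add _ _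
    rw [← Category.assoc, comp_add, addAux_comp, comp_add, Category.assoc, Category.assoc]
  comp_add p q r f g g' := D.hom_ext fun x u => by
    change u ≫ f ≫ D.add g g' = u ≫ D.add _ _
    rw [← Category.assoc, comp_add, comp_add, Category.assoc, Category.assoc]

variable (K : Type w) [CommRing K] [Linear K E]

/-- The `K`-linear structure on `P`. -/
noncomputable abbrev linear : letI := D.preadditive; Linear K P :=
  letI := D.preadditive
  { homModule p q :=
      { smul := D.smul
        one_smul f := D.hom_ext fun x u => by
          change u ≫ D.smul 1 f = _
          simp [comp_smul]
        mul_smul r s f := D.hom_ext fun x u => by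
          change u ≫ D.smul (r * s) f = u ≫ D.smul r (D.smul s f)
          simp only [comp_smul, ← t.map_comp_assoc]
          simp [mul_smul, smul_comm r s]
        smul_zero r := D.hom_ext fun x u => by
          change u ≫ D.smul r (D.zeroHom p q) = u ≫ D.zeroHom p q
          rw [comp_smul, ← Category.assoc, comp_zeroHom, comp_zeroHom]
        smul_add r f g := D.hom_ext fun x u => by
          change u ≫ D.smul r (D.add f g) = u ≫ D.add (D.smul r f) (D.smul r g)
          rw [comp_smul, comp_add, comp_add, comp_smul, comp_smul, map_comp_addAux]
        add_smul r s f := D.hom_ext fun x u => by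
          change u ≫ D.smul (r + s) f = u ≫ D.add (D.smul r f) (D.smul s f)
          rw [comp_smul, comp_add, comp_smul, comp_smul, add_smul, map_add_comp]
        zero_smul f := D.hom_ext fun x u => by
          change u ≫ D.smul (0 : K) f = u ≫ D.zeroHom p q
          rw [comp_smul, zero_smul, map_zero_comp, comp_zeroHom] }
    smul_comp p q r s f g := D.hom_ext fun x u => by
      change u ≫ D.smul s f ≫ g = u ≫ D.smul s (f ≫ g)
      rw [← Category.assoc, comp_smul, comp_smul, Category.assoc, Category.assoc]
    comp_smul p q r f s g := D.hom_ext fun x u => by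
      change u ≫ f ≫ D.smul s g = u ≫ D.smul s (f ≫ g)
      rw [← Category.assoc, comp_smul, comp_smul, Category.assoc] }

lemma add_eq {x : E} {q : P} (f g : t.obj x ⟶ q) : letI := D.preadditive
    f + g = t.map ((D.bicone x).inl + (D.bicone x).inr) ≫ D.desc f g := by
  change D.add f g = D.addAux f g
  have := D.comp_add f g (𝟙 _)
  simpa using this

lemma smul_eq {x : E} {q : P} (r : K) (f : t.obj x ⟶ q) : letI := D.preadditive
    letI := D.linear K
    r • f = t.map (r • 𝟙 x) ≫ f := by
  change D.smul r f = _
  have := D.comp_smul r f (𝟙 _)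
  simpa using this

lemma additive : letI := D.preadditive; t.Additive :=
  letI := D.preadditive
  { map_add {x y f g} := by
      have := D.map_add_comp f g (𝟙 _)
      simp only [Category.comp_id] at this
      rw [this, add_eq]
      rfl }

lemma functor_linear : letI := D.preadditive; letI := D.linear K; t.Linear K :=
  letI := D.preadditive
  letI := D.linear K
  { map_smul f r := by
      rw [smul_eq, ← t.map_comp]
      simp }

variable {C : Type u₃} [Category.{v} C] [Preadditive C]

/-- A functor that is dense for `t` is additive if its restriction along `t` is, because the sum of
morphisms out of `t x` is expressed by the coproduct `t (x ⊞ x)` and the map `t (inl + inr)`. -/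
lemma additive_of_comp {G : P ⥤ C} (hG : DenseFor t G) [(t ⋙ G).Additive] :
    letI := D.preadditive; G.Additive :=
  letI := D.preadditive
  { map_add {p q f g} := hG.hom_ext fun x u => by
      have h : ∀ f g : t.obj x ⟶ q, G.map (f + g) = G.map f + G.map g := fun f g => by
        have := (t ⋙ G).map_add (f := (D.bicone x).inl) (g := (D.bicone x).inr)
        simp only [Functor.comp_map] at this
        rw [add_eq, G.map_comp, this, Preadditive.add_comp, ← G.map_comp, ← G.map_comp, inl_desc,
          inr_desc]
      rw [← G.map_comp, Preadditive.comp_add, h, Preadditive.comp_add, G.map_comp, G.map_comp] }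

lemma linear_of_comp [Linear K C] {G : P ⥤ C} (hG : DenseFor t G) [(t ⋙ G).Additive]
    [(t ⋙ G).Linear K] : letI := D.preadditive; letI := D.linear K; G.Linear K :=
  letI := D.preadditive
  letI := D.linear K
  { map_smul {p q} f r := hG.hom_ext fun x u => by
      have := (t ⋙ G).map_smul r (𝟙 x)
      simp only [Functor.comp_map] at this
      rw [← G.map_comp, Linear.comp_smul, smul_eq, G.map_comp, this]
      simp }

end DiagonalData

/-! ### Existence of the extended tensor product -/

section

variable {E : Type u₁} [Category.{v} E] (C : Type u₂) [Category.{v} C]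

lemma isClosedUnderColimitsOfShape_comp {X : Type u₃} [Category.{v} X] (s : X ⥤ E) (J : Type v)
    [SmallCategory J] [HasColimitsOfShape J C] :
    ((ObjectProperty.preservesFiniteColimits (J := X) (C := C)).inverseImage
      ((Functor.whiskeringLeft X E C).obj s)).IsClosedUnderColimitsOfShape J where
  colimitsOfShape_le := by
    rintro F ⟨h⟩
    have := isClosedUnderColimitsOfShape_preservesFiniteColimits (A := X) (C := C) J
    exact ObjectProperty.prop_of_isColimit _
      (isColimitOfPreserves ((Functor.whiskeringLeft X E C).obj s) h.isColimit) h.prop_diag_obj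

end

section

variable {A : Type u₁} [Category.{v} A] [MonoidalCategory A]
  {B : Type u₂} [Category.{v} B] [MonoidalCategory B]

/-- Tensoring with `y` on the left after `b ↦ (a, b)` is tensoring with `y.2` before
`b ↦ (y.1 ⊗ a, b)`. -/
def sectRTensorLeft (a : A) (y : A × B) :
    tensorLeft y.2 ⋙ Prod.sectR (y.1 ⊗ a) B ≅ Prod.sectR a B ⋙ tensorLeft y :=
  NatIso.ofComponents (fun b => Iso.refl (y.1 ⊗ a, y.2 ⊗ b)) fun {b b'} f => by
    refine (Category.comp_id _).trans (Eq.trans ?_ (Category.id_comp _).symm)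
    exact Prod.ext (MonoidalCategory.whiskerLeft_id y.1 a).symm rfl

/-- Tensoring with `y` on the left after `a ↦ (a, b)` is tensoring with `y.1` before
`a ↦ (a, y.2 ⊗ b)`. -/
def sectLTensorLeft (b : B) (y : A × B) :
    tensorLeft y.1 ⋙ Prod.sectL A (y.2 ⊗ b) ≅ Prod.sectL A b ⋙ tensorLeft y :=
  NatIso.ofComponents (fun a => Iso.refl (y.1 ⊗ a, y.2 ⊗ b)) fun {a a'} f => by
    refine (Category.comp_id _).trans (Eq.trans ?_ (Category.id_comp _).symm)
    exact Prod.ext rfl (MonoidalCategory.whiskerLeft_id y.2 b).symm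

/-- Tensoring with `y` on the right after `b ↦ (a, b)` is tensoring with `y.2` before
`b ↦ (a ⊗ y.1, b)`. -/
def sectRTensorRight (a : A) (y : A × B) :
    tensorRight y.2 ⋙ Prod.sectR (a ⊗ y.1) B ≅ Prod.sectR a B ⋙ tensorRight y :=
  NatIso.ofComponents (fun b => Iso.refl (a ⊗ y.1, b ⊗ y.2)) fun {b b'} f => by
    refine (Category.comp_id _).trans (Eq.trans ?_ (Category.id_comp _).symm)
    exact Prod.ext (id_whiskerRight a y.1).symm rfl

/-- Tensoring with `y` on the right after `a ↦ (a, b)` is tensoring with `y.1` before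
`a ↦ (a, b ⊗ y.2)`. -/
def sectLTensorRight (b : B) (y : A × B) :
    tensorRight y.1 ⋙ Prod.sectL A (b ⊗ y.2) ≅ Prod.sectL A b ⋙ tensorRight y :=
  NatIso.ofComponents (fun a => Iso.refl (a ⊗ y.1, b ⊗ y.2)) fun {a a'} f => by
    refine (Category.comp_id _).trans (Eq.trans ?_ (Category.id_comp _).symm)
    exact Prod.ext rfl (id_whiskerRight b y.2).symm

end

section

open Functor.OplaxMonoidal

variable {A B : Type (v + 1)} [Category.{v} A] [EssentiallySmall.{v} A] [HasFiniteColimits A]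
  [MonoidalCategory A] [∀ a : A, PreservesFiniteColimits (tensorLeft a)]
  [∀ a : A, PreservesFiniteColimits (tensorRight a)]
  [Category.{v} B] [EssentiallySmall.{v} B] [HasFiniteColimits B]
  [MonoidalCategory B] [∀ b : B, PreservesFiniteColimits (tensorLeft b)]
  [∀ b : B, PreservesFiniteColimits (tensorRight b)]
  {E : Type u₁} [Category.{v} E] [EssentiallySmall.{v} E] [MonoidalCategory E]
  (j : A × B ⥤ E) [j.Monoidal] [j.EssSurj]

/-- Precomposition with `x ⊗ -` preserves cocontinuity in each variable: `x` is the image of some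
pair `y`, and `j` is monoidal, so the claim is about tensoring with `y` in `A × B`. -/
lemma biCocontinuous_tensorLeft_comp {C : Type (v + 1)} [Category.{v} C] (F : E ⥤ C)
    (hF : biCocontinuous A B C (j ⋙ F)) (x : E) :
    biCocontinuous A B C (j ⋙ tensorLeft x ⋙ F) := by
  let y := j.objPreimage x
  have e : tensorLeft y ⋙ j ⋙ F ≅ j ⋙ tensorLeft x ⋙ F := NatIso.ofComponents
    (fun z => F.mapIso ((Functor.Monoidal.μIso j y z).symm ≪≫
      whiskerRightIso (j.objObjPreimageIso x) _)) fun f => by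
        change F.map (j.map (y ◁ f)) ≫ F.map (δ j y _ ≫ (j.objObjPreimageIso x).hom ▷ _) =
          F.map (δ j y _ ≫ (j.objObjPreimageIso x).hom ▷ _) ≫ F.map (x ◁ j.map f)
        rw [← F.map_comp, ← F.map_comp, Category.assoc, ← whisker_exchange,
          δ_natural_right_assoc]
  refine biCocontinuous.of_iso e ⟨fun a => ?_, fun b => ?_⟩
  · have := hF.1 (y.1 ⊗ a)
    have : PreservesFiniteColimits ((tensorLeft y.2 ⋙ Prod.sectR (y.1 ⊗ a) B) ⋙ j ⋙ F) :=
      comp_preservesFiniteColimits (tensorLeft y.2) (Prod.sectR (y.1 ⊗ a) B ⋙ j ⋙ F)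
    exact preservesFiniteColimits_of_natIso (Functor.isoWhiskerRight (sectRTensorLeft a y) (j ⋙ F))
  · have := hF.2 (y.2 ⊗ b)
    have : PreservesFiniteColimits ((tensorLeft y.1 ⋙ Prod.sectL A (y.2 ⊗ b)) ⋙ j ⋙ F) :=
      comp_preservesFiniteColimits (tensorLeft y.1) (Prod.sectL A (y.2 ⊗ b) ⋙ j ⋙ F)
    exact preservesFiniteColimits_of_natIso (Functor.isoWhiskerRight (sectLTensorLeft b y) (j ⋙ F))

lemma biCocontinuous_tensorRight_comp {C : Type (v + 1)} [Category.{v} C] (F : E ⥤ C)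
    (hF : biCocontinuous A B C (j ⋙ F)) (x : E) :
    biCocontinuous A B C (j ⋙ tensorRight x ⋙ F) := by
  let y := j.objPreimage x
  have e : tensorRight y ⋙ j ⋙ F ≅ j ⋙ tensorRight x ⋙ F := NatIso.ofComponents
    (fun z => F.mapIso ((Functor.Monoidal.μIso j z y).symm ≪≫
      whiskerLeftIso _ (j.objObjPreimageIso x))) fun f => by
        change F.map (j.map (f ▷ y)) ≫ F.map (δ j _ y ≫ _ ◁ (j.objObjPreimageIso x).hom) =
          F.map (δ j _ y ≫ _ ◁ (j.objObjPreimageIso x).hom) ≫ F.map (j.map f ▷ x)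
        rw [← F.map_comp, ← F.map_comp, Category.assoc, whisker_exchange,
          δ_natural_left_assoc]
  refine biCocontinuous.of_iso e ⟨fun a => ?_, fun b => ?_⟩
  · have := hF.1 (a ⊗ y.1)
    have : PreservesFiniteColimits ((tensorRight y.2 ⋙ Prod.sectR (a ⊗ y.1) B) ⋙ j ⋙ F) :=
      comp_preservesFiniteColimits (tensorRight y.2) (Prod.sectR (a ⊗ y.1) B ⋙ j ⋙ F)
    exact preservesFiniteColimits_of_natIso (Functor.isoWhiskerRight (sectRTensorRight a y) (j ⋙ F))
  · have := hF.2 (b ⊗ y.2)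
    have : PreservesFiniteColimits ((tensorRight y.1 ⋙ Prod.sectL A (b ⊗ y.2)) ⋙ j ⋙ F) :=
      comp_preservesFiniteColimits (tensorRight y.1) (Prod.sectL A (b ⊗ y.2) ⋙ j ⋙ F)
    exact preservesFiniteColimits_of_natIso (Functor.isoWhiskerRight (sectLTensorRight b y) (j ⋙ F))

/-- The tensor product of `E` extends to the completion. -/
theorem exists_tensorData : Nonempty (TensorData (toBiCompletion j)) := by
  let P := BiCompletion j
  let t := toBiCompletion j
  let Q : ObjectProperty (E ⥤ P) := fun F => biCocontinuous A B P (j ⋙ F)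
  have hQ₁ : Q.IsClosedUnderIsomorphisms := ⟨fun i h => h.of_iso (Functor.isoWhiskerLeft j i)⟩
  have hQ (J : Type v) [SmallCategory J] [FinCategory J] : Q.IsClosedUnderColimitsOfShape J := by
    refine ⟨?_⟩
    rintro F ⟨h⟩
    refine ⟨fun a => ?_, fun b => ?_⟩
    · have := isClosedUnderColimitsOfShape_comp P (Prod.sectR a B ⋙ j) J
      exact ObjectProperty.prop_of_isColimit ((ObjectProperty.preservesFiniteColimits).inverseImage
        ((Functor.whiskeringLeft B E P).obj (Prod.sectR a B ⋙ j))) h.isColimit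
        fun i => (h.prop_diag_obj i).1 a
    · have := isClosedUnderColimitsOfShape_comp P (Prod.sectL A b ⋙ j) J
      exact ObjectProperty.prop_of_isColimit ((ObjectProperty.preservesFiniteColimits).inverseImage
        ((Functor.whiskeringLeft A E P).obj (Prod.sectL A b ⋙ j))) h.isColimit
        fun i => (h.prop_diag_obj i).2 b
  have ht : biCocontinuous A B P (j ⋙ t) := biCocontinuous_toBiCompletion j
  obtain ⟨T, hl, hr, ⟨i⟩⟩ := exists_bifunctor (t := t)
    (fun G _ => denseFor_toBiCompletion j G) (generates_toBiCompletion j) Q hQ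
    (fun F hF => exists_extension_biCompletion j F hF)
    (fun G hG => ⟨fun a => by
      have := ht.1 a
      exact comp_preservesFiniteColimits (Prod.sectR a B ⋙ j ⋙ t) G, fun b => by
      have := ht.2 b
      exact comp_preservesFiniteColimits (Prod.sectL A b ⋙ j ⋙ t) G⟩)
    (curriedTensor E ⋙ (Functor.whiskeringRight _ _ _).obj t)
    (fun x => biCocontinuous_tensorLeft_comp j t ht x)
    (fun x => biCocontinuous_tensorRight_comp j t ht x)
  exact ⟨⟨T, hl, hr, i, fun G _ => denseFor_toBiCompletion j G⟩⟩

end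

/-! ### The universal property of `A ⊗_K B` -/

section

variable (K : Type v) [CommRing K]
  {A : Type u₁} [Category.{v} A] [Preadditive A] [Linear K A]
  {B : Type u₂} [Category.{v} B] [Preadditive B] [Linear K B]
  (C : Type u₃) [Category.{v} C] [Preadditive C] [Linear K C]

/-- The `K`-linear functors. -/
def linearFunctors : ObjectProperty (A ⥤ C) := fun F => F.Additive ∧ F.Linear K

variable (A B) in
/-- The functors on `A × B` that are `K`-linear in each variable. -/
def biLinear : ObjectProperty (A × B ⥤ C) := fun F =>
  (∀ a : A, linearFunctors K C (Prod.sectR a B ⋙ F)) ∧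
    ∀ b : B, linearFunctors K C (Prod.sectL A b ⋙ F)

variable {K C}

lemma linearFunctors.of_iso {F G : A ⥤ C} (i : F ≅ G) (h : linearFunctors K C F) :
    linearFunctors K C G := by
  obtain ⟨_, _⟩ := h
  refine ⟨⟨fun {X Y f g} => ?_⟩, ⟨fun {X Y} f r => ?_⟩⟩
  · rw [← cancel_epi (i.hom.app X)]
    simp [← NatTrans.naturality]
  · rw [← cancel_epi (i.hom.app X)]
    simp [← NatTrans.naturality]

lemma linearFunctors.comp {D : Type u₄} [Category.{v} D] [Preadditive D] [Linear K D]
    {F : A ⥤ C} {G : C ⥤ D} (hF : linearFunctors K C F) (hG : linearFunctors K D G) :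
    linearFunctors K D (F ⋙ G) := by
  obtain ⟨_, _⟩ := hF
  obtain ⟨_, _⟩ := hG
  exact ⟨inferInstance, inferInstance⟩

lemma map_mk_eq (F : A × B ⥤ C) {a a' : A} {b b' : B} (f : a ⟶ a') (g : b ⟶ b') :
    F.map (X := (a, b)) (Y := (a', b')) (f, g) =
      (Prod.sectL A b ⋙ F).map f ≫ (Prod.sectR a' B ⋙ F).map g := by
  refine Eq.trans ?_ (F.map_comp _ _)
  exact congrArg F.map (Prod.ext (Category.comp_id _).symm (Category.id_comp _).symm)

namespace LinProd

/-- The `K`-linear map on morphisms of `A ⊗_K B` induced by a bilinear functor on `A × B`. -/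
noncomputable def liftMap (F : A × B ⥤ C) (hF : biLinear K A B C F) (X Y : LinProd K A B) :
    (X ⟶ Y) →ₗ[K] (F.obj (X.fst, X.snd) ⟶ F.obj (Y.fst, Y.snd)) :=
  TensorProduct.lift (LinearMap.mk₂ K
    (fun f g => F.map (X := (X.fst, X.snd)) (Y := (Y.fst, Y.snd)) (f, g))
    (fun f f' g => by
      have := (hF.2 X.snd).1
      rw [map_mk_eq, map_mk_eq, map_mk_eq, Functor.map_add]
      exact Preadditive.add_comp _ _ _ _ _ _)
    (fun r f g => by
      have := (hF.2 X.snd).1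
      have := (hF.2 X.snd).2
      rw [map_mk_eq, map_mk_eq, Functor.map_smul]
      exact Linear.smul_comp _ _ _ _ _ _)
    (fun f g g' => by
      have := (hF.1 Y.fst).1
      rw [map_mk_eq, map_mk_eq, map_mk_eq, Functor.map_add]
      exact Preadditive.comp_add _ _ _ _ _ _)
    (fun r f g => by
      have := (hF.1 Y.fst).1
      have := (hF.1 Y.fst).2
      rw [map_mk_eq, map_mk_eq, Functor.map_smul]
      exact Linear.comp_smul _ _ _ _ _ _))

lemma liftMap_tmul (F : A × B ⥤ C) (hF : biLinear K A B C F) {X Y : LinProd K A B}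
    (f : X.fst ⟶ Y.fst) (g : X.snd ⟶ Y.snd) : liftMap F hF X Y (tmul K f g) =
      F.map (X := (X.fst, X.snd)) (Y := (Y.fst, Y.snd)) (f, g) :=
  TensorProduct.lift.tmul f g

/-- The `K`-linear functor on `A ⊗_K B` induced by a bilinear functor on `A × B`. -/
noncomputable def lift (F : A × B ⥤ C) (hF : biLinear K A B C F) : LinProd K A B ⥤ C where
  obj X := F.obj (X.fst, X.snd)
  map {X Y} f := liftMap F hF X Y f
  map_id X := (liftMap_tmul F hF (𝟙 X.fst) (𝟙 X.snd)).trans (F.map_id _)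
  map_comp {X Y Z} f g := by
    induction f using hom_induction with
    | zero => simp
    | add f f' h h' => rw [Preadditive.add_comp, map_add, h, h', map_add, Preadditive.add_comp]
    | tmul f f' =>
      induction g using hom_induction with
      | zero => simp
      | add g g' h h' => rw [Preadditive.comp_add, map_add, h, h', map_add, Preadditive.comp_add]
      | tmul g g' =>
        rw [tmul_comp, liftMap_tmul, liftMap_tmul, liftMap_tmul, ← F.map_comp]
        rfl

lemma linearFunctors_lift (F : A × B ⥤ C) (hF : biLinear K A B C F) :
    linearFunctors K C (lift F hF) :=
  ⟨⟨map_add _ _ _⟩, ⟨fun _ _ => map_smul _ _ _⟩⟩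

/-- The induced functor restricts to the given one. -/
noncomputable def toLinProdCompLift (F : A × B ⥤ C) (hF : biLinear K A B C F) :
    toLinProd K A B ⋙ lift F hF ≅ F :=
  NatIso.ofComponents (fun X => Iso.refl (F.obj X)) fun {X Y} f => by
    exact (Category.comp_id _).trans ((liftMap_tmul F hF (X := ⟨X.1, X.2⟩) (Y := ⟨Y.1, Y.2⟩)
      f.1 f.2).trans (Category.id_comp _).symm)

/-- Naturality in `A ⊗_K B` can be checked on pure tensors. -/
lemma bijective_whiskerLeft_toLinProd {F G : LinProd K A B ⥤ C} (hF : linearFunctors K C F)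
    (hG : linearFunctors K C G) :
    Function.Bijective (fun α : F ⟶ G => Functor.whiskerLeft (toLinProd K A B) α) := by
  obtain ⟨_, _⟩ := hF
  obtain ⟨_, _⟩ := hG
  refine ⟨fun α β h => ?_, fun α => ?_⟩
  · ext X
    exact congrArg (fun γ => NatTrans.app γ (X.fst, X.snd)) h
  · let β (X : LinProd K A B) : F.obj X ⟶ G.obj X := α.app (X.fst, X.snd)
    refine ⟨⟨β, fun X Y f => ?_⟩, rfl⟩
    induction f using hom_induction with
    | zero => simp
    | add f f' h h' => rw [F.map_add, G.map_add, Preadditive.comp_add, Preadditive.add_comp, h, h']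
    | tmul f g => exact α.naturality (X := (X.fst, X.snd)) (Y := (Y.fst, Y.snd)) (f, g)

instance : (toLinProd K A B).EssSurj := ⟨fun X => ⟨(X.fst, X.snd), ⟨Iso.refl X⟩⟩⟩

lemma biLinear_toLinProd_comp {F : LinProd K A B ⥤ C} (hF : linearFunctors K C F) :
    biLinear K A B C (toLinProd K A B ⋙ F) := by
  obtain ⟨_, _⟩ := hF
  refine ⟨fun a => ⟨⟨fun {X Y f g} => ?_⟩, ⟨fun {X Y} f r => ?_⟩⟩,
    fun b => ⟨⟨fun {X Y f g} => ?_⟩, ⟨fun {X Y} f r => ?_⟩⟩⟩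
  · exact (congrArg F.map (tmul_add_right (X := ⟨a, X⟩) (Y := ⟨a, Y⟩) (𝟙 a) f g)).trans F.map_add
  · exact (congrArg F.map (tmul_smul_right (X := ⟨a, X⟩) (Y := ⟨a, Y⟩) r (𝟙 a) f)).trans
      (F.map_smul r _)
  · exact (congrArg F.map (tmul_add_left (X := ⟨X, b⟩) (Y := ⟨Y, b⟩) f g (𝟙 b))).trans F.map_add
  · exact (congrArg F.map (tmul_smul_left (X := ⟨X, b⟩) (Y := ⟨Y, b⟩) r f (𝟙 b))).trans
      (F.map_smul r _)

end LinProd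

end

/-! ### Existence of `A ⊠ B` and `A ⊠_K B` -/

lemma DenseFor.bijective_whiskerLeft {E : Type u₁} [Category.{v} E] {P : Type u₂} [Category.{v} P]
    {C : Type u₃} [Category.{v} C] {t : E ⥤ P} {G : P ⥤ C} (h : DenseFor t G) (H : P ⥤ C) :
    Function.Bijective (fun α : G ⟶ H => Functor.whiskerLeft t α) :=
  (Function.bijective_iff_existsUnique _).2 h.existsUnique_natTrans

section

variable {A B P : Type (v + 1)} [Category.{v} A] [Category.{v} B] [Category.{v} P]
  (C : Type (v + 1)) [Category.{v} C]

lemma isEquivalence_restrictFc (t : A × B ⥤ P) (ht : biCocontinuous A B P t)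
    (hd : ∀ G H : P ⥤ C, PreservesFiniteColimits G → PreservesFiniteColimits H →
      Function.Bijective (fun α : G ⟶ H => Functor.whiskerLeft t α))
    (hext : ∀ F : A × B ⥤ C, biCocontinuous A B C F → ∃ G : P ⥤ C, PreservesFiniteColimits G ∧
      Nonempty (t ⋙ G ≅ F)) : (restrictFc C t ht).IsEquivalence where
  faithful := ⟨fun {G H} α β h => by
    ext : 1
    exact (hd _ _ G.property H.property).1 (congrArg (fun γ => γ.hom) h)⟩
  full := ⟨fun {G H} α => by
    obtain ⟨β, hβ⟩ := (hd _ _ G.property H.property).2 α.hom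
    exact ⟨⟨β⟩, by ext : 1; exact hβ⟩⟩
  essSurj := ⟨fun F => by
    obtain ⟨G, hG, ⟨i⟩⟩ := hext F.obj F.property
    exact ⟨⟨G, hG⟩, ⟨ObjectProperty.isoMk _ i⟩⟩⟩

lemma isEquivalence_restrictFcLinear {K : Type v} [CommRing K] [Preadditive A] [Linear K A]
    [Preadditive B] [Linear K B] [Preadditive P] [Linear K P] [Preadditive C] [Linear K C]
    (t : A × B ⥤ P) (ht : biFcLinear A B P K t)
    (hd : ∀ G H : P ⥤ C, fcLinear C K G → fcLinear C K H →
      Function.Bijective (fun α : G ⟶ H => Functor.whiskerLeft t α))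
    (hext : ∀ F : A × B ⥤ C, biFcLinear A B C K F → ∃ G : P ⥤ C, fcLinear C K G ∧
      Nonempty (t ⋙ G ≅ F)) : (restrictFcLinear C t ht).IsEquivalence where
  faithful := ⟨fun {G H} α β h => by
    ext : 1
    exact (hd _ _ G.property H.property).1 (congrArg (fun γ => γ.hom) h)⟩
  full := ⟨fun {G H} α => by
    obtain ⟨β, hβ⟩ := (hd _ _ G.property H.property).2 α.hom
    exact ⟨⟨β⟩, by ext : 1; exact hβ⟩⟩
  essSurj := ⟨fun F => by
    obtain ⟨G, hG, ⟨i⟩⟩ := hext F.obj F.property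
    exact ⟨⟨G, hG⟩, ⟨ObjectProperty.isoMk _ i⟩⟩⟩

end

instance {E : Type u₁} [Category.{v} E] [MonoidalCategory E] {P : Type u₂} [Category.{v} P]
    {t : E ⥤ P} (D : TensorData t) [HasFiniteColimits P] : HasFiniteColimits (Tensored D) :=
  inferInstanceAs (HasFiniteColimits P)

instance {E : Type u₁} [Category.{v} E] [MonoidalCategory E] {P : Type u₂} [Category.{v} P]
    {t : E ⥤ P} (D : TensorData t) [EssentiallySmall.{v} P] : EssentiallySmall.{v} (Tensored D) :=
  inferInstanceAs (EssentiallySmall.{v} P)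

theorem FcTensorCat.exists_isTensor (A B : FcTensorCat.{v}) : ∃ (P : FcTensorCat.{v})
    (t : A.toTensorCat.prod B.toTensorCat ⟶ P.toTensorCat), FcTensorCat.IsTensor t := by
  let j := 𝟭 (A.carrier × B.carrier)
  obtain ⟨D⟩ := exists_tensorData j
  let P : FcTensorCat.{v} := { carrier := Tensored D }
  let t : A.toTensorCat.prod B.toTensorCat ⟶ P.toTensorCat :=
    TensorFunctor.mk (A := A.toTensorCat.prod B.toTensorCat) (B := P.toTensorCat) (Tensored.of D)
      (braided := Tensored.ofBraided D)
  refine ⟨P, t, inferInstanceAs (EssentiallySmall.{v} (Tensored D)),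
    inferInstanceAs (HasFiniteColimits (Tensored D)), biCocontinuous_toBiCompletion j,
    fun C _ _ _ => ?_⟩
  refine isEquivalence_restrictFc C _ _ (fun G H hG _ => ?_) fun F hF => ?_
  · have h (G : BiCompletion j ⥤ C) (_ : PreservesFiniteColimits G) :
        DenseFor (toBiCompletion j) G := denseFor_toBiCompletion j G
    exact (h G hG).bijective_whiskerLeft H
  · exact exists_extension_biCompletion j F hF

section Linear

variable {K : Type v} [CommRing K]

lemma LinProd.zero_tmul {A : Type u₁} [Category.{v} A] [Preadditive A] [Linear K A]
    {B : Type u₂} [Category.{v} B] [Preadditive B] [Linear K B] {X Y : LinProd K A B}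
    (g : X.snd ⟶ Y.snd) : LinProd.tmul K 0 g = (0 : X ⟶ Y) := TensorProduct.zero_tmul _ g

/-- The tensor product is linear in the second variable: first for `p` in the image of `E`, where it
comes from `E`, then on the image of `E` for arbitrary `p` by density in the first variable, and
finally in general by density in the second. -/
lemma linearFunctors.tensorLeft_tensored {E : Type u₁} [Category.{v} E] [Preadditive E] [Linear K E]
    [MonoidalCategory E] [MonoidalPreadditive E] [MonoidalLinear K E] {P : Type u₂} [Category.{v} P]
    {t : E ⥤ P} (D : TensorData t) (S : DiagonalData (Tensored.of D)) (p : Tensored D) :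
    letI := S.preadditive
    letI := S.linear K
    linearFunctors K (Tensored D) (tensorLeft p) := by
  let := S.preadditive
  let := S.linear K
  have := S.additive
  have := S.functor_linear K
  have hd (q : Tensored D) : DenseFor (Tensored.of D) (tensorLeft q) :=
    D.dense _ (inferInstanceAs (PreservesFiniteColimits (tensorLeft q)))
  have hd' (q : Tensored D) : DenseFor (Tensored.of D) (tensorRight q) :=
    D.dense _ (inferInstanceAs (PreservesFiniteColimits (tensorRight q)))
  have h₁ (x : E) :
      linearFunctors K (Tensored D) (Tensored.of D ⋙ tensorLeft ((Tensored.of D).obj x)) := by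
    refine linearFunctors.of_iso (Functor.Monoidal.commTensorLeft (Tensored.of D) x).symm ⟨?_, ?_⟩
    · infer_instance
    · infer_instance
  have h₂ : linearFunctors K (Tensored D) (Tensored.of D ⋙ tensorLeft p) := by
    refine ⟨⟨fun {y z f g} => ?_⟩, ⟨fun {y z} f r => ?_⟩⟩
    · refine DenseFor.hom_ext (hd' _) fun x u => ?_
      have := (h₁ x).1.map_add (f := f) (g := g)
      dsimp at this ⊢
      rw [← whisker_exchange, this, Preadditive.comp_add, Preadditive.add_comp, whisker_exchange,
        whisker_exchange]
    · refine DenseFor.hom_ext (hd' _) fun x u => ?_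
      have := (h₁ x).2.map_smul f r
      dsimp at this ⊢
      rw [← whisker_exchange, this, Linear.comp_smul, Linear.smul_comp, whisker_exchange]
  have := h₂.1
  have := h₂.2
  exact ⟨S.additive_of_comp (hd p), S.linear_of_comp K (hd p)⟩

variable {A B : Type (v + 1)} [Category.{v} A] [EssentiallySmall.{v} A] [HasFiniteColimits A]
  [Preadditive A] [Linear K A]
  [Category.{v} B] [EssentiallySmall.{v} B] [HasFiniteColimits B] [Preadditive B] [Linear K B]

/-- The biproduct of `(a, b)` with itself in `A ⊗_K B` is `(a ⊞ a, b)`, and the pair of an initial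
object of `A` and `b` becomes initial, since the functor to the completion is cocontinuous in the
first variable. -/
noncomputable def diagonalDataBiCompletion : DiagonalData (toBiCompletion (toLinProd K A B)) :=
  have : HasBinaryBiproducts A := HasBinaryBiproducts.of_hasBinaryCoproducts
  have ht := biCocontinuous_toBiCompletion (toLinProd K A B)
  { bicone x :=
      { pt := ⟨x.fst ⊞ x.fst, x.snd⟩
        fst := LinProd.tmul K biprod.fst (𝟙 x.snd)
        snd := LinProd.tmul K biprod.snd (𝟙 x.snd)
        inl := LinProd.tmul K biprod.inl (𝟙 x.snd)
        inr := LinProd.tmul K biprod.inr (𝟙 x.snd)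
        inl_fst := by simp
        inl_snd := by simpa using LinProd.zero_tmul (Y := x) _
        inr_fst := by simpa using LinProd.zero_tmul (Y := x) _
        inr_snd := by simp }
    isColimit x :=
      have := ht.2 x.snd
      mapIsColimitOfPreservesOfIsColimit (Prod.sectL A x.snd ⋙ toLinProd K A B ⋙
        toBiCompletion (toLinProd K A B)) _ _ (BinaryBiproduct.isColimit x.fst x.fst)
    zero x := ⟨⊥_ A, x.snd⟩
    isInitial x :=
      have := ht.2 x.snd
      IsInitial.isInitialObj (Prod.sectL A x.snd ⋙ toLinProd K A B ⋙
        toBiCompletion (toLinProd K A B)) _ initialIsInitial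
    dense := denseFor_toBiCompletion _ _ }

theorem FcLinTensorCat.exists_isTensor (A B : FcLinTensorCat.{v} K) : ∃ (P : FcLinTensorCat.{v} K)
    (t : A.toTensorCat.prod B.toTensorCat ⟶ P.toTensorCat), FcLinTensorCat.IsTensor t := by
  let j := toLinProd K A.carrier B.carrier
  obtain ⟨D⟩ := exists_tensorData j
  let S : DiagonalData (Tensored.of D) := diagonalDataBiCompletion
  let := S.preadditive
  let := S.linear K
  have hl := linearFunctors.tensorLeft_tensored (K := K) D S
  have hr (p : Tensored D) : linearFunctors K (Tensored D) (tensorRight p) :=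
    (hl p).of_iso (BraidedCategory.tensorLeftIsoTensorRight p)
  have : MonoidalPreadditive (Tensored D) :=
    { whiskerLeft_zero := fun {p _ _} => have := (hl p).1; (tensorLeft p).map_zero _ _
      zero_whiskerRight := fun {p _ _} => have := (hr p).1; (tensorRight p).map_zero _ _
      whiskerLeft_add := fun {p _ _} f g => (hl p).1.map_add
      add_whiskerRight := fun {p _ _} f g => (hr p).1.map_add }
  have : MonoidalLinear K (Tensored D) :=
    { whiskerLeft_smul := fun p _ _ r f => (hl p).2.map_smul f r
      smul_whiskerRight := fun r _ _ f p => (hr p).2.map_smul f r }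
  let P : FcLinTensorCat.{v} K := { carrier := Tensored D }
  let t : A.toTensorCat.prod B.toTensorCat ⟶ P.toTensorCat :=
    LinTensorCat.toTensor K A.toLinTensorCat B.toLinTensorCat ≫
      TensorFunctor.mk (B := P.toTensorCat) (Tensored.of D) (braided := Tensored.ofBraided D)
  have ht := biCocontinuous_toBiCompletion j
  have hb : biLinear K A.carrier B.carrier (Tensored D) (j ⋙ Tensored.of D) :=
    LinProd.biLinear_toLinProd_comp ⟨S.additive, S.functor_linear K⟩
  refine ⟨P, t, inferInstanceAs (EssentiallySmall.{v} (Tensored D)),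
    inferInstanceAs (HasFiniteColimits (Tensored D)),
    ⟨fun a => ⟨ht.1 a, hb.1 a⟩, fun b => ⟨ht.2 b, hb.2 b⟩⟩, fun C _ _ _ _ _ => ?_⟩
  have hd (G : BiCompletion j ⥤ C) (hG : PreservesFiniteColimits G) : DenseFor (Tensored.of D) G :=
    denseFor_toBiCompletion j G
  have hs : linearFunctors K (Tensored D) (Tensored.of D) := ⟨S.additive, S.functor_linear K⟩
  refine isEquivalence_restrictFcLinear C _ _ (fun G H hG hH => ?_) fun F hF => ?_
  · have h₁ := LinProd.bijective_whiskerLeft_toLinProd (K := K) (F := Tensored.of D ⋙ G)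
      (G := Tensored.of D ⋙ H) (hs.comp hG.2) (hs.comp hH.2)
    exact h₁.comp ((hd G hG.1).bijective_whiskerLeft H)
  · have hF' : biLinear K A.carrier B.carrier C F :=
      ⟨fun a => (hF.1 a).2, fun b => (hF.2 b).2⟩
    obtain ⟨_, _⟩ := LinProd.linearFunctors_lift F hF'
    obtain ⟨G, hG, ⟨i⟩⟩ := exists_extension_biCompletion j (LinProd.lift F hF')
      (biCocontinuous.of_iso (LinProd.toLinProdCompLift F hF').symm
        ⟨fun a => (hF.1 a).1, fun b => (hF.2 b).1⟩)
    have hGl : linearFunctors K C (Tensored.of D ⋙ G) := by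
      refine linearFunctors.of_iso i.symm ⟨?_, ?_⟩
      · infer_instance
      · infer_instance
    obtain ⟨_, _⟩ := hGl
    exact ⟨G, ⟨hG, S.additive_of_comp (hd G hG), S.linear_of_comp K (hd G hG)⟩,
      ⟨Functor.isoWhiskerLeft j i ≪≫ LinProd.toLinProdCompLift F hF'⟩⟩

end Linear

/-! ### Extending tensor functors -/

section

variable {X : Type u₁} [Category.{v} X] [MonoidalCategory X]
  {P : Type u₂} [Category.{v} P] [MonoidalCategory P]
  {T : Type u₃} [Category.{v} T] [MonoidalCategory T]

/-- Natural transformations between functors with the property `R` correspond to their restrictions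
along `t`, and `R` is stable under composition with tensoring by an object on either side. The
stability makes it possible to use the correspondence one variable at a time. -/
structure Detects (t : X ⥤ P) (R : ObjectProperty (P ⥤ T)) : Prop where
  bijective : ∀ {G H : P ⥤ T}, R G → R H →
    Function.Bijective (fun α : G ⟶ H => Functor.whiskerLeft t α)
  tensorLeft_comp : ∀ {G : P ⥤ T}, R G → ∀ p, R (tensorLeft p ⋙ G)
  tensorRight_comp : ∀ {G : P ⥤ T}, R G → ∀ p, R (tensorRight p ⋙ G)
  comp_tensorLeft : ∀ {G : P ⥤ T}, R G → ∀ x, R (G ⋙ tensorLeft x)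
  comp_tensorRight : ∀ {G : P ⥤ T}, R G → ∀ x, R (G ⋙ tensorRight x)

namespace Detects

variable {t : X ⥤ P} {R : ObjectProperty (P ⥤ T)} (h : Detects t R)
include h

/-- Two families of morphisms, both natural, agree if they agree on the image of `t`. -/
lemma natTrans_ext {G H : P ⥤ T} (hG : R G) (hH : R H) {a b : ∀ p, G.obj p ⟶ H.obj p}
    (ha : ∀ {p q : P} (f : p ⟶ q), G.map f ≫ a q = a p ≫ H.map f)
    (hb : ∀ {p q : P} (f : p ⟶ q), G.map f ≫ b q = b p ≫ H.map f)
    (hab : ∀ x, a (t.obj x) = b (t.obj x)) (p : P) : a p = b p := by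
  have := (h.bijective hG hH).1 (a₁ := ⟨a, fun _ _ f => ha f⟩) (a₂ := ⟨b, fun _ _ f => hb f⟩)
    (by ext x; exact hab x)
  exact congrArg (fun γ => NatTrans.app γ p) this

/-- The correspondence for functors of two variables, restricted in the first variable. -/
lemma bijective_whiskerLeft_bifunctor {Q : Type*} [Category* Q] {F F' : P ⥤ Q ⥤ T}
    (hF : ∀ q, R (F.flip.obj q)) (hF' : ∀ q, R (F'.flip.obj q)) :
    Function.Bijective (fun α : F ⟶ F' => Functor.whiskerLeft t α) := by
  refine ⟨fun α β hαβ => ?_, fun α => ?_⟩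
  · ext p q
    refine h.natTrans_ext (hF q) (hF' q) (a := fun p => (α.app p).app q)
      (b := fun p => (β.app p).app q) (fun f => ?_) (fun f => ?_) (fun x => ?_) p
    · exact congrArg (fun γ => NatTrans.app γ q) (α.naturality f)
    · exact congrArg (fun γ => NatTrans.app γ q) (β.naturality f)
    · exact congrArg (fun γ => NatTrans.app (NatTrans.app γ x) q) hαβ
  · choose β hβ using fun q => (h.bijective (hF q) (hF' q)).2
      { app x := (α.app x).app q
        naturality _ _ f := congrArg (fun γ => NatTrans.app γ q) (α.naturality f) }
    have hβ' (q : Q) (x : X) : (β q).app (t.obj x) = (α.app x).app q :=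
      congrArg (fun γ => NatTrans.app γ x) (hβ q)
    refine ⟨⟨fun p => ⟨fun q => (β q).app p, fun q q' g => ?_⟩, fun p p' f => ?_⟩, ?_⟩
    · refine h.natTrans_ext (hF q) (hF' q') (a := fun p => (F.obj p).map g ≫ (β q').app p)
        (b := fun p => (β q).app p ≫ (F'.obj p).map g) (fun {p p'} f => ?_) (fun {p p'} f => ?_)
        (fun x => ?_) p
      · have := (β q').naturality f
        dsimp at this ⊢
        rw [← NatTrans.naturality_assoc, this, Category.assoc]
      · have := (β q).naturality f
        dsimp at this ⊢
        rw [reassoc_of% this, Category.assoc, (F'.map f).naturality]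
      · dsimp
        rw [hβ', hβ']
        exact (α.app x).naturality g
    · ext q
      exact (β q).naturality f
    · ext x q
      exact hβ' q x

/-- The correspondence for functors of two variables, restricted in both variables. -/
lemma bijective_whiskerLeft₂ {F F' : P ⥤ P ⥤ T}
    (hF : ∀ p, R (F.obj p)) (hF' : ∀ p, R (F'.obj p))
    (hF₂ : ∀ q, R (F.flip.obj q)) (hF₂' : ∀ q, R (F'.flip.obj q)) :
    Function.Bijective (fun α : F ⟶ F' => Functor.whiskerRight (Functor.whiskerLeft t α)
      ((Functor.whiskeringLeft X P T).obj t)) := by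
  have h₁ := h.bijective_whiskerLeft_bifunctor hF₂ hF₂'
  have h₂ := h.bijective_whiskerLeft_bifunctor (F := (t ⋙ F).flip) (F' := (t ⋙ F').flip)
    (fun x => hF (t.obj x)) (fun x => hF' (t.obj x))
  refine Function.Bijective.comp (g := fun β : t ⋙ F ⟶ t ⋙ F' => Functor.whiskerRight β
      ((Functor.whiskeringLeft X P T).obj t)) ⟨fun α β hαβ => ?_, fun α => ?_⟩ h₁
  · have hflip : (flipFunctor _ _ _).map α = (flipFunctor _ _ _).map β := by
      refine h₂.1 ?_
      ext y x
      exact congrArg (fun γ => NatTrans.app (NatTrans.app γ x) y) hαβ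
    ext x p
    exact congrArg (fun γ => NatTrans.app (NatTrans.app γ p) x) hflip
  · obtain ⟨β, hβ⟩ := h₂.2 ((flipFunctor _ _ _).map α)
    refine ⟨(flipFunctor _ _ _).map β, ?_⟩
    ext x y
    exact congrArg (fun γ => NatTrans.app (NatTrans.app γ y) x) hβ

/-- Isomorphisms between functors of two variables extend from the image of `t`. -/
lemma exists_iso₂ {F F' : P ⥤ P ⥤ T}
    (hF : ∀ p, R (F.obj p)) (hF' : ∀ p, R (F'.obj p))
    (hF₂ : ∀ q, R (F.flip.obj q)) (hF₂' : ∀ q, R (F'.flip.obj q))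
    (θ : t ⋙ F ⋙ (Functor.whiskeringLeft X P T).obj t ≅
      t ⋙ F' ⋙ (Functor.whiskeringLeft X P T).obj t) :
    ∃ Θ : F ≅ F', ∀ x y, (Θ.hom.app (t.obj x)).app (t.obj y) = (θ.hom.app x).app y := by
  obtain ⟨α, hα⟩ := (h.bijective_whiskerLeft₂ hF hF' hF₂ hF₂').2 θ.hom
  obtain ⟨β, hβ⟩ := (h.bijective_whiskerLeft₂ hF' hF hF₂' hF₂).2 θ.inv
  have hα' (x y) : (α.app (t.obj x)).app (t.obj y) = (θ.hom.app x).app y :=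
    congrArg (fun γ => NatTrans.app (NatTrans.app γ x) y) hα
  have hβ' (x y) : (β.app (t.obj x)).app (t.obj y) = (θ.inv.app x).app y :=
    congrArg (fun γ => NatTrans.app (NatTrans.app γ x) y) hβ
  refine ⟨⟨α, β, (h.bijective_whiskerLeft₂ hF hF hF₂ hF₂).1 ?_,
    (h.bijective_whiskerLeft₂ hF' hF' hF₂' hF₂').1 ?_⟩, hα'⟩
  · ext x y
    change (α.app (t.obj x)).app (t.obj y) ≫ (β.app (t.obj x)).app (t.obj y) = 𝟙 _
    rw [hα', hβ', ← NatTrans.comp_app, ← NatTrans.comp_app, θ.hom_inv_id]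
    rfl
  · ext x y
    change (β.app (t.obj x)).app (t.obj y) ≫ (α.app (t.obj x)).app (t.obj y) = 𝟙 _
    rw [hα', hβ', ← NatTrans.comp_app, ← NatTrans.comp_app, θ.inv_hom_id]
    rfl

/-- A strong monoidal structure on `t ⋙ G` comes from one on `G`. The structure isomorphism extends
as an isomorphism of functors of two variables, and the coherence laws, being equalities of natural
transformations in each variable, need only be checked on the image of `t`. -/
lemma exists_coreMonoidal [t.Monoidal] {G : P ⥤ T} (hG : R G) (M : (t ⋙ G).CoreMonoidal) :
    ∃ N : G.CoreMonoidal, N.εIso.hom ≫ G.map (Functor.LaxMonoidal.ε t) = M.εIso.hom ∧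
      ∀ x y, (N.μIso (t.obj x) (t.obj y)).hom ≫ G.map (Functor.LaxMonoidal.μ t x y) =
        (M.μIso x y).hom := by
  obtain ⟨Θ, hΘ⟩ := h.exists_iso₂ (F := curriedTensorPre G)
    (F' := curriedTensorPost G) (fun p => h.comp_tensorLeft hG (G.obj p))
    (fun p => h.tensorLeft_comp hG p) (fun q => h.comp_tensorRight hG (G.obj q))
    (fun q => h.tensorRight_comp hG q)
    (NatIso.ofComponents (fun x => NatIso.ofComponents
      (fun y => M.μIso x y ≪≫ G.mapIso (Functor.Monoidal.μIso t x y).symm)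
      (fun {y z} f => by
        have := M.μIso_hom_natural_right x f
        dsimp at this ⊢
        rw [reassoc_of% this, Category.assoc, ← G.map_comp, ← G.map_comp]
        simp))
      (fun {y z} f => by
        ext x
        have := M.μIso_hom_natural_left f x
        dsimp at this ⊢
        rw [reassoc_of% this, Category.assoc, ← G.map_comp, ← G.map_comp]
        simp))
  let m (p q : P) : G.obj p ⊗ G.obj q ≅ G.obj (p ⊗ q) := (Θ.app p).app q
  have hm (x y : X) : (m (t.obj x) (t.obj y)).hom ≫ G.map (Functor.LaxMonoidal.μ t x y) =
      (M.μIso x y).hom := by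
    refine (congrArg (fun k => k ≫ G.map (Functor.LaxMonoidal.μ t x y)) (hΘ x y)).trans ?_
    simp [← G.map_comp]
  have hl {p p' : P} (f : p ⟶ p') (q : P) : G.map f ▷ G.obj q ≫ (m p' q).hom =
      (m p q).hom ≫ G.map (f ▷ q) := congrArg (fun γ => NatTrans.app γ q) (Θ.hom.naturality f)
  have hr (p : P) {q q' : P} (f : q ⟶ q') : G.obj p ◁ G.map f ≫ (m p q').hom =
      (m p q).hom ≫ G.map (p ◁ f) := (Θ.hom.app p).naturality f
  clear_value m
  let e : 𝟙_ T ≅ G.obj (𝟙_ P) := M.εIso ≪≫ G.mapIso (Functor.Monoidal.εIso t).symm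
  have he : e.hom ≫ G.map (Functor.LaxMonoidal.ε t) = M.εIso.hom := by
    simp [e, ← G.map_comp]
  clear_value e
  refine ⟨
    { εIso := e
      μIso := m
      μIso_hom_natural_left := hl
      μIso_hom_natural_right := fun p f => hr p f
      associativity := fun p q r => ?_
      left_unitality := fun q => ?_
      right_unitality := fun q => ?_ }, he, hm⟩
  · refine h.natTrans_ext (h.comp_tensorRight (h.comp_tensorRight hG (G.obj q)) (G.obj r))
      (h.tensorRight_comp hG (q ⊗ r))
      (a := fun p => (m p q).hom ▷ G.obj r ≫ (m (p ⊗ q) r).hom ≫ G.map (α_ p q r).hom)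
      (b := fun p => (α_ (G.obj p) (G.obj q) (G.obj r)).hom ≫ G.obj p ◁ (m q r).hom ≫
        (m p (q ⊗ r)).hom) ?_ ?_ (fun x => ?_) p
    · intro p p' f
      dsimp
      rw [← comp_whiskerRight_assoc, hl, comp_whiskerRight_assoc, reassoc_of% (hl (f ▷ q) r),
        Category.assoc, Category.assoc, ← G.map_comp, ← G.map_comp, associator_naturality_left]
    · intro p p' f
      dsimp
      rw [associator_naturality_left_assoc, ← whisker_exchange_assoc, hl, Category.assoc,
        Category.assoc]
    refine h.natTrans_ext
      (h.comp_tensorRight (h.comp_tensorLeft hG (G.obj (t.obj x))) (G.obj r))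
      (h.tensorRight_comp (h.tensorLeft_comp hG (t.obj x)) r)
      (a := fun q => (m (t.obj x) q).hom ▷ G.obj r ≫ (m (t.obj x ⊗ q) r).hom ≫
        G.map (α_ (t.obj x) q r).hom)
      (b := fun q => (α_ (G.obj (t.obj x)) (G.obj q) (G.obj r)).hom ≫
        G.obj (t.obj x) ◁ (m q r).hom ≫ (m (t.obj x) (q ⊗ r)).hom) ?_ ?_ (fun y => ?_) q
    · intro q q' f
      dsimp
      rw [← comp_whiskerRight_assoc, hr, comp_whiskerRight_assoc,
        reassoc_of% (hl (t.obj x ◁ f) r), Category.assoc, Category.assoc, ← G.map_comp,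
        ← G.map_comp, associator_naturality_middle]
    · intro q q' f
      dsimp
      rw [associator_naturality_middle_assoc, ← MonoidalCategory.whiskerLeft_comp_assoc, hl,
        MonoidalCategory.whiskerLeft_comp_assoc, hr, Category.assoc, Category.assoc]
    refine h.natTrans_ext (h.comp_tensorLeft hG (G.obj (t.obj x) ⊗ G.obj (t.obj y)))
      (h.tensorLeft_comp (h.tensorLeft_comp hG (t.obj x)) (t.obj y))
      (a := fun r => (m (t.obj x) (t.obj y)).hom ▷ G.obj r ≫ (m (t.obj x ⊗ t.obj y) r).hom ≫
        G.map (α_ (t.obj x) (t.obj y) r).hom)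
      (b := fun r => (α_ (G.obj (t.obj x)) (G.obj (t.obj y)) (G.obj r)).hom ≫
        G.obj (t.obj x) ◁ (m (t.obj y) r).hom ≫ (m (t.obj x) (t.obj y ⊗ r)).hom) ?_ ?_
        (fun z => ?_) r
    · intro r r' f
      dsimp
      rw [whisker_exchange_assoc, reassoc_of% (hr (t.obj x ⊗ t.obj y) f),
        Category.assoc, Category.assoc, ← G.map_comp,
        ← G.map_comp, associator_naturality_right]
    · intro r r' f
      dsimp
      rw [associator_naturality_right_assoc, ← MonoidalCategory.whiskerLeft_comp_assoc, hr,
        MonoidalCategory.whiskerLeft_comp_assoc, hr, Category.assoc, Category.assoc]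
    have := M.associativity x y z
    rw [← hm, ← hm, ← hm, ← hm] at this
    dsimp at this
    rw [← cancel_mono (G.map (t.obj x ◁ Functor.LaxMonoidal.μ t y z)),
      ← cancel_mono (G.map (Functor.LaxMonoidal.μ t x (y ⊗ z)))]
    simp only [Category.assoc]
    rw [← G.map_comp_assoc, ← G.map_comp, Category.assoc,
      ← Functor.LaxMonoidal.associativity, G.map_comp, G.map_comp, ← reassoc_of% (hl _ (t.obj z)),
      ← reassoc_of% (hr (t.obj x) (Functor.LaxMonoidal.μ t y z))]
    simpa using this
  · refine h.natTrans_ext (h.comp_tensorLeft hG (𝟙_ T)) hG (a := fun q => (λ_ (G.obj q)).hom)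
      (b := fun q => e.hom ▷ G.obj q ≫ (m (𝟙_ P) q).hom ≫ G.map (λ_ q).hom) ?_ ?_ (fun x => ?_) q
    · intro q q' f
      simp
    · intro q q' f
      dsimp
      rw [whisker_exchange_assoc, reassoc_of% (hr (𝟙_ P) f), Category.assoc, Category.assoc,
        ← G.map_comp, ← G.map_comp, leftUnitor_naturality]
    · have := M.left_unitality x
      rw [← hm, ← he] at this
      dsimp at this ⊢
      rw [this, comp_whiskerRight_assoc, Category.assoc,
        reassoc_of% (hl (Functor.LaxMonoidal.ε t) (t.obj x)), Functor.LaxMonoidal.left_unitality,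
        G.map_comp, G.map_comp]
  · refine h.natTrans_ext (h.comp_tensorRight hG (𝟙_ T)) hG (a := fun q => (ρ_ (G.obj q)).hom)
      (b := fun q => G.obj q ◁ e.hom ≫ (m q (𝟙_ P)).hom ≫ G.map (ρ_ q).hom) ?_ ?_ (fun x => ?_) q
    · intro q q' f
      simp
    · intro q q' f
      dsimp
      rw [← whisker_exchange_assoc, reassoc_of% (hl f (𝟙_ P)), Category.assoc, Category.assoc,
        ← G.map_comp, ← G.map_comp, rightUnitor_naturality]
    · have := M.right_unitality x
      rw [← hm, ← he] at this
      dsimp at this ⊢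
      rw [this, MonoidalCategory.whiskerLeft_comp_assoc, Category.assoc,
        reassoc_of% (hr (t.obj x) (Functor.LaxMonoidal.ε t))]
      rw [Functor.LaxMonoidal.right_unitality, G.map_comp, G.map_comp]

/-- A natural transformation is monoidal if its restriction along `t` is. -/
lemma isMonoidal_of_whiskerLeft [t.Monoidal] {G H : P ⥤ T} (hG : R G) (hH : R H) [G.Monoidal]
    [H.Monoidal] (α : G ⟶ H) [NatTrans.IsMonoidal (Functor.whiskerLeft t α)] :
    NatTrans.IsMonoidal α where
  unit := by
    have := NatTrans.IsMonoidal.unit (τ := Functor.whiskerLeft t α)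
    rw [← cancel_mono (H.map (Functor.LaxMonoidal.ε t)), Category.assoc, ← α.naturality]
    simpa using this
  tensor p q := by
    refine h.natTrans_ext (h.comp_tensorRight hG (G.obj q)) (h.tensorRight_comp hH q)
      (a := fun p => Functor.LaxMonoidal.μ G p q ≫ α.app (p ⊗ q))
      (b := fun p => (α.app p ⊗ₘ α.app q) ≫ Functor.LaxMonoidal.μ H p q) ?_ ?_ (fun x => ?_) p
    · intro p p' f
      simp
    · intro p p' f
      dsimp
      rw [tensorHom_def_assoc, tensorHom_def_assoc, ← comp_whiskerRight_assoc, α.naturality,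
        comp_whiskerRight_assoc, Category.assoc, Category.assoc,
        ← Functor.LaxMonoidal.μ_natural_left, whisker_exchange_assoc]
    refine h.natTrans_ext (h.comp_tensorLeft hG (G.obj (t.obj x))) (h.tensorLeft_comp hH (t.obj x))
      (a := fun q => Functor.LaxMonoidal.μ G (t.obj x) q ≫ α.app (t.obj x ⊗ q))
      (b := fun q => (α.app (t.obj x) ⊗ₘ α.app q) ≫ Functor.LaxMonoidal.μ H (t.obj x) q) ?_ ?_
      (fun y => ?_) q
    · intro q q' f
      simp
    · intro q q' f
      dsimp
      rw [tensorHom_def'_assoc, tensorHom_def'_assoc, ← MonoidalCategory.whiskerLeft_comp_assoc,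
        α.naturality, MonoidalCategory.whiskerLeft_comp_assoc, Category.assoc, Category.assoc,
        ← Functor.LaxMonoidal.μ_natural_right, whisker_exchange_assoc]
    have := NatTrans.IsMonoidal.tensor (τ := Functor.whiskerLeft t α) x y
    rw [← cancel_mono (H.map (Functor.LaxMonoidal.μ t x y)), Category.assoc, ← α.naturality]
    simpa using this

/-- A monoidal functor is compatible with the symmetry if its restriction along `t` is. -/
lemma map_braiding [BraidedCategory X] [BraidedCategory P] [BraidedCategory T] [t.Braided]
    {G : P ⥤ T} (hG : R G) [G.Monoidal]
    (hb : ∀ x y, Functor.LaxMonoidal.μ (t ⋙ G) x y ≫ (t ⋙ G).map (β_ x y).hom =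
      (β_ _ _).hom ≫ Functor.LaxMonoidal.μ (t ⋙ G) y x) (p q : P) :
    Functor.LaxMonoidal.μ G p q ≫ G.map (β_ p q).hom =
      (β_ (G.obj p) (G.obj q)).hom ≫ Functor.LaxMonoidal.μ G q p := by
  refine h.natTrans_ext (h.comp_tensorRight hG (G.obj q)) (h.tensorLeft_comp hG q)
    (a := fun p => Functor.LaxMonoidal.μ G p q ≫ G.map (β_ p q).hom)
    (b := fun p => (β_ (G.obj p) (G.obj q)).hom ≫ Functor.LaxMonoidal.μ G q p) ?_ ?_
    (fun x => ?_) p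
  · intro p p' f
    dsimp
    rw [Functor.LaxMonoidal.μ_natural_left_assoc, Category.assoc, ← G.map_comp, ← G.map_comp,
      BraidedCategory.braiding_naturality_left]
  · intro p p' f
    simp
  refine h.natTrans_ext (h.comp_tensorLeft hG (G.obj (t.obj x))) (h.tensorRight_comp hG (t.obj x))
    (a := fun q => Functor.LaxMonoidal.μ G (t.obj x) q ≫ G.map (β_ (t.obj x) q).hom)
    (b := fun q => (β_ (G.obj (t.obj x)) (G.obj q)).hom ≫ Functor.LaxMonoidal.μ G q (t.obj x))
    ?_ ?_ (fun y => ?_) q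
  · intro q q' f
    dsimp
    rw [Functor.LaxMonoidal.μ_natural_right_assoc, Category.assoc, ← G.map_comp, ← G.map_comp,
      BraidedCategory.braiding_naturality_right]
  · intro q q' f
    simp
  have := hb x y
  rw [← cancel_mono (G.map (Functor.LaxMonoidal.μ t y x)), Category.assoc, ← G.map_comp,
    ← Functor.LaxBraided.braided]
  simpa using this

end Detects

end

section

variable {X P T : TensorCat.{v}} {t : X ⟶ P}

open Bicategory

/-- Monoidal natural transformations correspond to their restrictions along `t`. -/
theorem Detects.bijective_whiskerLeft_tensorTrans {R : ObjectProperty (P.carrier ⥤ T.carrier)}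
    (h : Detects t.functor R) {G H : P ⟶ T} (hG : R G.functor) (hH : R H.functor) :
    Function.Bijective (fun α : G ⟶ H => t ◁ α) := by
  refine ⟨fun α β hαβ => ?_, fun α => ?_⟩
  · exact TensorFunctor.hom_ext ((h.bijective hG hH).1 (congrArg TensorTrans.natTrans hαβ))
  · obtain ⟨β, hβ⟩ := (h.bijective hG hH).2 α.natTrans
    have : NatTrans.IsMonoidal (Functor.whiskerLeft t.functor β) := by
      have := α.isMonoidal
      dsimp only at hβ
      rw [hβ]
      exact this
    have := h.isMonoidal_of_whiskerLeft hG hH β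
    exact ⟨⟨β⟩, TensorFunctor.hom_ext hβ⟩

/-- A functor whose restriction along `t` is isomorphic to a tensor functor is itself a tensor
functor. -/
theorem Detects.exists_tensorFunctor {R : ObjectProperty (P.carrier ⥤ T.carrier)}
    (h : Detects t.functor R) {G : P.carrier ⥤ T.carrier} (hG : R G) (F : X ⟶ T)
    (i : t.functor ⋙ G ≅ F.functor) :
    ∃ G' : P ⟶ T, G'.functor = G ∧ Nonempty (t ≫ G' ≅ F) := by
  obtain ⟨N, hε, hμ⟩ := h.exists_coreMonoidal hG (Functor.Monoidal.coreMonoidalTransport i.symm)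
  let : G.Monoidal := N.toMonoidal
  have hε' : Functor.LaxMonoidal.ε (t.functor ⋙ G) =
      Functor.LaxMonoidal.ε F.functor ≫ i.inv.app _ := hε
  have hμ' (x y) : Functor.LaxMonoidal.μ (t.functor ⋙ G) x y =
      (i.hom.app x ⊗ₘ i.hom.app y) ≫ Functor.LaxMonoidal.μ F.functor x y ≫ i.inv.app _ := hμ x y
  let : G.Braided :=
    { braided := h.map_braiding hG fun x y => by
        rw [hμ', hμ', Category.assoc, Category.assoc, ← i.inv.naturality,
          Functor.LaxBraided.braided_assoc]
        simp }
  have : NatTrans.IsMonoidal i.hom :=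
    { unit := (congrArg (fun k => k ≫ i.hom.app _) hε').trans (by simp)
      tensor x y := (congrArg (fun k => k ≫ i.hom.app _) (hμ' x y)).trans (by simp) }
  exact ⟨⟨G⟩, rfl, ⟨TensorFunctor.isoMk i⟩⟩

end

/-! ### The coproduct of tensor categories -/

section

open Functor.LaxMonoidal (ε μ)
open Functor.OplaxMonoidal (η)

variable {T : Type u₃} [Category.{v} T] [MonoidalCategory T] [SymmetricCategory T]

/-- The tensor product functor of a symmetric monoidal category respects the symmetry; this is where
the braiding of `T` has to be a symmetry. -/
lemma tensorμ_tensorHom_braiding (X₁ X₂ Y₁ Y₂ : T) :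
    tensorμ X₁ X₂ Y₁ Y₂ ≫ ((β_ X₁ Y₁).hom ⊗ₘ (β_ X₂ Y₂).hom) =
      (β_ (X₁ ⊗ X₂) (Y₁ ⊗ Y₂)).hom ≫ tensorμ Y₁ Y₂ X₁ X₂ := by
  simp only [tensorμ, BraidedCategory.braiding_tensor_left_hom,
    BraidedCategory.braiding_tensor_right_hom, MonoidalCategory.tensorHom_def]
  calc
    _ = 𝟙 _ ⊗≫ X₁ ◁ (β_ X₂ Y₁).hom ▷ Y₂ ⊗≫ (β_ X₁ Y₁).hom ▷ (X₂ ⊗ Y₂) ⊗≫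
        (Y₁ ⊗ X₁) ◁ (β_ X₂ Y₂).hom ⊗≫
          Y₁ ◁ ((β_ X₁ Y₂).hom ≫ (β_ Y₂ X₁).hom) ▷ X₂ ⊗≫ 𝟙 _ := by
      rw [SymmetricCategory.symmetry]
      monoidal
    _ = _ := by monoidal

/-- The tensor product functor `T × T ⥤ T` is a tensor functor. -/
instance tensorBraided : (tensor T).Braided where
  braided X Y := tensorμ_tensorHom_braiding _ _ _ _

variable {A : Type u₁} [Category.{v} A] [MonoidalCategory A] [SymmetricCategory A]
  {B : Type u₂} [Category.{v} B] [MonoidalCategory B] [SymmetricCategory B]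

/-- The product of two tensor functors is a tensor functor. -/
instance prodBraided (G : A ⥤ T) (H : B ⥤ T) [G.Braided] [H.Braided] : (G.prod H).Braided where
  braided X Y := Prod.ext (Functor.LaxBraided.braided X.1 Y.1) (Functor.LaxBraided.braided X.2 Y.2)

/-- The isomorphism `(a, 1) ⊗ (1, b) ≅ (a, b)`. -/
def pairIso (X : A × B) : (Prod.sectL A (𝟙_ B)).obj X.1 ⊗ (Prod.sectR (𝟙_ A) B).obj X.2 ≅ X :=
  Iso.prod (ρ_ X.1) (λ_ X.2)

lemma pairIso_naturality {X Y : A × B} (f : X ⟶ Y) :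
    ((Prod.sectL A (𝟙_ B)).map f.1 ⊗ₘ (Prod.sectR (𝟙_ A) B).map f.2) ≫ (pairIso Y).hom =
      (pairIso X).hom ≫ f := by
  refine Prod.ext ?_ ?_
  · change (f.1 ⊗ₘ 𝟙 (𝟙_ A)) ≫ (ρ_ Y.1).hom = (ρ_ X.1).hom ≫ f.1
    simp
  · change (𝟙 (𝟙_ B) ⊗ₘ f.2) ≫ (λ_ Y.2).hom = (λ_ X.2).hom ≫ f.2
    simp

lemma tensorμ_pairIso (X Y : A × B) :
    tensorμ ((Prod.sectL A (𝟙_ B)).obj X.1) ((Prod.sectR (𝟙_ A) B).obj X.2)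
      ((Prod.sectL A (𝟙_ B)).obj Y.1) ((Prod.sectR (𝟙_ A) B).obj Y.2) ≫
      (μ (Prod.sectL A (𝟙_ B)) X.1 Y.1 ⊗ₘ μ (Prod.sectR (𝟙_ A) B) X.2 Y.2) ≫
        (pairIso (X ⊗ Y)).hom = ((pairIso X).hom ⊗ₘ (pairIso Y).hom) := by
  refine Prod.ext ?_ ?_
  · change tensorμ X.1 (𝟙_ A) Y.1 (𝟙_ A) ≫ (𝟙 _ ⊗ₘ (λ_ (𝟙_ A)).hom) ≫ (ρ_ _).hom =
      (ρ_ X.1).hom ⊗ₘ (ρ_ Y.1).hom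
    rw [rightUnitor_monoidal, id_tensorHom]
  · change tensorμ (𝟙_ B) X.2 (𝟙_ B) Y.2 ≫ ((λ_ (𝟙_ B)).hom ⊗ₘ 𝟙 _) ≫ (λ_ _).hom =
      (λ_ X.2).hom ⊗ₘ (λ_ Y.2).hom
    rw [leftUnitor_monoidal, tensorHom_id]

/-- The isomorphism `F (a, 1) ⊗ F (1, b) ≅ F (a, b)`, natural in `(a, b)`. -/
def decompose (F : A × B ⥤ T) [F.Monoidal] :
    (Prod.sectL A (𝟙_ B) ⋙ F).prod (Prod.sectR (𝟙_ A) B ⋙ F) ⋙ tensor T ≅ F :=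
  NatIso.ofComponents (fun X => Functor.Monoidal.μIso F _ _ ≪≫ F.mapIso (pairIso X))
    fun {X Y} f => by
      change (F.map _ ⊗ₘ F.map _) ≫ μ F _ _ ≫ F.map _ = (μ F _ _ ≫ F.map _) ≫ F.map f
      rw [Functor.LaxMonoidal.μ_natural_assoc, Category.assoc, ← F.map_comp, ← F.map_comp]
      exact congrArg (fun k => _ ≫ F.map k) (pairIso_naturality f)

instance (F : A × B ⥤ T) [F.Braided] : NatTrans.IsMonoidal (decompose F).hom where
  unit := by
    change ((λ_ (𝟙_ T)).inv ≫ ((ε F ≫ F.map (𝟙 _)) ⊗ₘ (ε F ≫ F.map (𝟙 _)))) ≫ μ F _ _ ≫ F.map _ =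
      ε F
    have h : (pairIso (𝟙_ (A × B))).hom = (λ_ (𝟙_ (A × B))).hom :=
      Prod.ext unitors_equal.symm rfl
    rw [CategoryTheory.Functor.map_id, Category.comp_id, h]
    rw [tensorHom_def', Category.assoc, Category.assoc]
    refine (congrArg (fun k => _ ≫ _ ≫ k)
      (Functor.LaxMonoidal.left_unitality F (𝟙_ (A × B))).symm).trans ?_
    rw [leftUnitor_naturality, Iso.inv_hom_id_assoc]
  tensor X Y := by
    change (tensorμ _ _ _ _ ≫ ((μ F _ _ ≫ F.map _) ⊗ₘ (μ F _ _ ≫ F.map _))) ≫ μ F _ _ ≫ F.map _ =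
      ((μ F _ _ ≫ F.map _) ⊗ₘ (μ F _ _ ≫ F.map _)) ≫ μ F _ _
    rw [← tensorHom_comp_tensorHom, ← tensorHom_comp_tensorHom, Category.assoc, Category.assoc,
      Category.assoc, Functor.LaxMonoidal.μ_natural_assoc, Functor.LaxMonoidal.μ_natural]
    rw [reassoc_of% (tensorμ_comp_μ_tensorHom_μ_comp_μ F), ← F.map_comp, ← F.map_comp]
    exact congrArg (fun k => _ ≫ _ ≫ F.map k) (tensorμ_pairIso X Y)

/-- The isomorphism `G a ⊗ H 1 ≅ G a`. -/
def sectLProdTensor (G : A ⥤ T) (H : B ⥤ T) [H.Monoidal] :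
    Prod.sectL A (𝟙_ B) ⋙ G.prod H ⋙ tensor T ≅ G :=
  NatIso.ofComponents (fun a => whiskerLeftIso (G.obj a) (Functor.Monoidal.εIso H).symm ≪≫
    ρ_ (G.obj a)) fun {a a'} f => by
      change (G.map f ⊗ₘ H.map (𝟙 _)) ≫ _ ◁ η H ≫ (ρ_ _).hom = (_ ◁ η H ≫ (ρ_ _).hom) ≫ G.map f
      rw [CategoryTheory.Functor.map_id, tensorHom_id, ← whisker_exchange_assoc,
        rightUnitor_naturality, Category.assoc]

/-- The isomorphism `G 1 ⊗ H b ≅ H b`. -/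
def sectRProdTensor (G : A ⥤ T) (H : B ⥤ T) [G.Monoidal] :
    Prod.sectR (𝟙_ A) B ⋙ G.prod H ⋙ tensor T ≅ H :=
  NatIso.ofComponents (fun b => whiskerRightIso (Functor.Monoidal.εIso G).symm (H.obj b) ≪≫
    λ_ (H.obj b)) fun {a a'} f => by
      change (G.map (𝟙 _) ⊗ₘ H.map f) ≫ η G ▷ _ ≫ (λ_ _).hom = (η G ▷ _ ≫ (λ_ _).hom) ≫ H.map f
      rw [CategoryTheory.Functor.map_id, id_tensorHom, whisker_exchange_assoc,
        leftUnitor_naturality, Category.assoc]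

instance (G : A ⥤ T) (H : B ⥤ T) [G.Monoidal] [H.Monoidal] :
    NatTrans.IsMonoidal (sectLProdTensor G H).hom where
  unit := by
    change (((λ_ (𝟙_ T)).inv ≫ (ε G ⊗ₘ ε H)) ≫ (G.map (𝟙 _) ⊗ₘ H.map (𝟙 _))) ≫
      _ ◁ η H ≫ (ρ_ _).hom = ε G
    rw [CategoryTheory.Functor.map_id, CategoryTheory.Functor.map_id, id_tensorHom_id,
      Category.comp_id, Category.assoc, tensorHom_def_assoc, ← whiskerLeft_comp_assoc,
      Functor.Monoidal.ε_η, whiskerLeft_id, Category.id_comp, rightUnitor_naturality,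
      ← unitors_equal, Iso.inv_hom_id_assoc]
  tensor a a' := by
    change ((tensorμ _ _ _ _ ≫ (μ G _ _ ⊗ₘ μ H _ _)) ≫ (G.map (𝟙 _) ⊗ₘ H.map (λ_ (𝟙_ B)).hom)) ≫
      _ ◁ η H ≫ (ρ_ _).hom = ((_ ◁ η H ≫ (ρ_ _).hom) ⊗ₘ (_ ◁ η H ≫ (ρ_ _).hom)) ≫ μ G _ _
    have h : μ H (𝟙_ B) (𝟙_ B) ≫ H.map (λ_ (𝟙_ B)).hom ≫ η H = (η H ⊗ₘ η H) ≫ (λ_ (𝟙_ T)).hom := by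
      rw [MonoidalCategory.tensorHom_def, Category.assoc, leftUnitor_naturality,
        Functor.LaxMonoidal.left_unitality, Category.assoc, Category.assoc,
        ← comp_whiskerRight_assoc, Functor.Monoidal.η_ε,
        id_whiskerRight, Category.id_comp]
    rw [CategoryTheory.Functor.map_id, ← id_tensorHom, ← tensorHom_comp_tensorHom, ← id_tensorHom,
      ← id_tensorHom, rightUnitor_monoidal, Category.assoc, Category.assoc, Category.assoc,
      Category.assoc, Category.assoc, tensorμ_natural_assoc]
    simp only [tensorHom_comp_tensorHom_assoc, Category.comp_id, h]
    simp only [tensorHom_def', rightUnitor_naturality,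
      whiskerLeft_comp_assoc, whiskerLeft_id, id_whiskerRight, Category.id_comp, Category.assoc]

instance (G : A ⥤ T) (H : B ⥤ T) [G.Monoidal] [H.Monoidal] :
    NatTrans.IsMonoidal (sectRProdTensor G H).hom where
  unit := by
    change (((λ_ (𝟙_ T)).inv ≫ (ε G ⊗ₘ ε H)) ≫ (G.map (𝟙 _) ⊗ₘ H.map (𝟙 _))) ≫
      η G ▷ _ ≫ (λ_ _).hom = ε H
    rw [CategoryTheory.Functor.map_id, CategoryTheory.Functor.map_id, id_tensorHom_id,
      Category.comp_id, Category.assoc, tensorHom_def'_assoc, ← comp_whiskerRight_assoc,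
      Functor.Monoidal.ε_η, id_whiskerRight, Category.id_comp, leftUnitor_naturality,
      Iso.inv_hom_id_assoc]
  tensor a a' := by
    change ((tensorμ _ _ _ _ ≫ (μ G _ _ ⊗ₘ μ H _ _)) ≫ (G.map (λ_ (𝟙_ A)).hom ⊗ₘ H.map (𝟙 _))) ≫
      η G ▷ _ ≫ (λ_ _).hom = ((η G ▷ _ ≫ (λ_ _).hom) ⊗ₘ (η G ▷ _ ≫ (λ_ _).hom)) ≫ μ H _ _
    have h : μ G (𝟙_ A) (𝟙_ A) ≫ G.map (λ_ (𝟙_ A)).hom ≫ η G = (η G ⊗ₘ η G) ≫ (λ_ (𝟙_ T)).hom := by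
      rw [MonoidalCategory.tensorHom_def, Category.assoc, leftUnitor_naturality,
        Functor.LaxMonoidal.left_unitality, Category.assoc, Category.assoc,
        ← comp_whiskerRight_assoc, Functor.Monoidal.η_ε, id_whiskerRight, Category.id_comp]
    rw [CategoryTheory.Functor.map_id, ← tensorHom_id, ← tensorHom_comp_tensorHom, ← tensorHom_id,
      ← tensorHom_id, leftUnitor_monoidal, Category.assoc, Category.assoc, Category.assoc,
      Category.assoc, Category.assoc, tensorμ_natural_assoc]
    simp only [tensorHom_comp_tensorHom_assoc, Category.comp_id, h]
    simp only [MonoidalCategory.tensorHom_def, leftUnitor_naturality, comp_whiskerRight_assoc, whiskerLeft_id, id_whiskerRight,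
      Category.id_comp, Category.assoc]
    rw [← comp_whiskerRight_assoc (𝟙_ T ◁ η G), leftUnitor_naturality, comp_whiskerRight_assoc]

lemma decompose_hom_naturality {F G : A × B ⥤ T} [F.Monoidal] [G.Monoidal] (α : F ⟶ G)
    [NatTrans.IsMonoidal α] (X : A × B) : (decompose F).hom.app X ≫ α.app X =
      (α.app ((Prod.sectL A (𝟙_ B)).obj X.1) ⊗ₘ α.app ((Prod.sectR (𝟙_ A) B).obj X.2)) ≫
        (decompose G).hom.app X := by
  change (μ F _ _ ≫ F.map _) ≫ α.app X = _ ≫ μ G _ _ ≫ G.map _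
  rw [Category.assoc, α.naturality, ← Category.assoc, ← Category.assoc, NatTrans.IsMonoidal.tensor]

lemma natTrans_app_tensorUnit_η {G G' : A ⥤ T} [G.Monoidal] [G'.Monoidal] (γ : G ⟶ G')
    [NatTrans.IsMonoidal γ] : γ.app (𝟙_ A) ≫ η G' = η G := by
  rw [← cancel_epi (ε G), CategoryTheory.NatTrans.IsMonoidal.unit_assoc, Functor.Monoidal.ε_η,
    Functor.Monoidal.ε_η]

lemma sectLProdTensor_hom_naturality {G G' : A ⥤ T} {H H' : B ⥤ T} [H.Monoidal] [H'.Monoidal]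
    (γ : G ⟶ G') (δ : H ⟶ H') [NatTrans.IsMonoidal δ] (a : A) :
    (γ.app a ⊗ₘ δ.app (𝟙_ B)) ≫ (sectLProdTensor G' H').hom.app a =
      (sectLProdTensor G H).hom.app a ≫ γ.app a := by
  change (γ.app a ⊗ₘ δ.app (𝟙_ B)) ≫ _ ◁ η H' ≫ (ρ_ _).hom =
    (_ ◁ η H ≫ (ρ_ _).hom) ≫ γ.app a
  rw [MonoidalCategory.tensorHom_def_assoc, ← MonoidalCategory.whiskerLeft_comp_assoc,
    natTrans_app_tensorUnit_η, ← whisker_exchange_assoc, rightUnitor_naturality,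
    Category.assoc]

lemma sectRProdTensor_hom_naturality {G G' : A ⥤ T} {H H' : B ⥤ T} [G.Monoidal] [G'.Monoidal]
    (γ : G ⟶ G') (δ : H ⟶ H') [NatTrans.IsMonoidal γ] (b : B) :
    (γ.app (𝟙_ A) ⊗ₘ δ.app b) ≫ (sectRProdTensor G' H').hom.app b =
      (sectRProdTensor G H).hom.app b ≫ δ.app b := by
  change (γ.app (𝟙_ A) ⊗ₘ δ.app b) ≫ η G' ▷ _ ≫ (λ_ _).hom =
    (η G ▷ _ ≫ (λ_ _).hom) ≫ δ.app b
  rw [MonoidalCategory.tensorHom_def'_assoc, ← comp_whiskerRight_assoc,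
    natTrans_app_tensorUnit_η, whisker_exchange_assoc, leftUnitor_naturality,
    Category.assoc]

end

section

variable (A B : TensorCat.{v})

/-- The functor sending tensor functors `G` and `H` to the tensor functor `(a, b) ↦ G a ⊗ H b`. -/
def TensorCat.prodLift (T : TensorCat.{v}) : (A ⟶ T) × (B ⟶ T) ⥤ (A.prod B ⟶ T) where
  obj X := TensorFunctor.mk (A := A.prod B) (X.1.functor.prod X.2.functor ⋙ tensor T.carrier)
    (braided := inferInstanceAs (X.1.functor.prod X.2.functor ⋙ tensor T.carrier).Braided)
  map {X Y} f := TensorTrans.mk (A := A.prod B)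
    (Functor.whiskerRight (NatTrans.prod f.1.natTrans f.2.natTrans) (tensor T.carrier))
    (isMonoidal := by
      have := f.1.isMonoidal
      have := f.2.isMonoidal
      have : NatTrans.IsMonoidal (NatTrans.prod f.1.natTrans f.2.natTrans) :=
        { unit := Prod.ext (NatTrans.IsMonoidal.unit (τ := f.1.natTrans))
            (NatTrans.IsMonoidal.unit (τ := f.2.natTrans))
          tensor X Y := Prod.ext (NatTrans.IsMonoidal.tensor (τ := f.1.natTrans) _ _)
            (NatTrans.IsMonoidal.tensor (τ := f.2.natTrans) _ _) }
      exact inferInstanceAs (NatTrans.IsMonoidal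
        (Functor.whiskerRight (NatTrans.prod f.1.natTrans f.2.natTrans) (tensor T.carrier))))
  map_id X := TensorFunctor.hom_ext (by
    ext Y
    exact id_tensorHom_id _ _)
  map_comp f g := TensorFunctor.hom_ext (by
    ext Y
    exact (tensorHom_comp_tensorHom _ _ _ _).symm)

variable {A B} {T : TensorCat.{v}}

/-- A tensor functor `F` on `A × B` is isomorphic to `(a, b) ↦ F (a, 1) ⊗ F (1, b)`. -/
def TensorCat.prodLiftRestrict (F : A.prod B ⟶ T) :
    (TensorCat.prodLift A B T).obj (A.inl B ≫ F, A.inr B ≫ F) ≅ F :=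
  letI F' : A.carrier × B.carrier ⥤ T.carrier := F.functor
  letI : F'.Braided := F.braided
  @TensorFunctor.isoMk (A.prod B) T ((TensorCat.prodLift A B T).obj (A.inl B ≫ F, A.inr B ≫ F)) F
    (decompose F') (inferInstanceAs (NatTrans.IsMonoidal (decompose F').hom))

/-- The functor `(a, b) ↦ G a ⊗ H b` restricts to `G` on `A`. -/
def TensorCat.inlProdLift (G : A ⟶ T) (H : B ⟶ T) :
    A.inl B ≫ (TensorCat.prodLift A B T).obj (G, H) ≅ G :=
  letI : Functor.Braided G.functor := G.braided
  letI : Functor.Braided H.functor := H.braided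
  @TensorFunctor.isoMk A T (A.inl B ≫ (TensorCat.prodLift A B T).obj (G, H)) G
    (sectLProdTensor G.functor H.functor)
    (inferInstanceAs (NatTrans.IsMonoidal (sectLProdTensor G.functor H.functor).hom))

/-- The functor `(a, b) ↦ G a ⊗ H b` restricts to `H` on `B`. -/
def TensorCat.inrProdLift (G : A ⟶ T) (H : B ⟶ T) :
    A.inr B ≫ (TensorCat.prodLift A B T).obj (G, H) ≅ H :=
  letI : Functor.Braided G.functor := G.braided
  letI : Functor.Braided H.functor := H.braided
  @TensorFunctor.isoMk B T (A.inr B ≫ (TensorCat.prodLift A B T).obj (G, H)) H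
    (sectRProdTensor G.functor H.functor)
    (inferInstanceAs (NatTrans.IsMonoidal (sectRProdTensor G.functor H.functor).hom))

variable (A B) in
theorem TensorCat.isBicategoricalCoproduct_prod :
    IsBicategoricalCoproduct (TensorCat.inl A B) (TensorCat.inr A B) := by
  intro T
  let Φ := (Bicategory.precomp T (TensorCat.inl A B)).prod'
    (Bicategory.precomp T (TensorCat.inr A B))
  refine (CategoryTheory.Equivalence.mk Φ (TensorCat.prodLift A B T)
    (NatIso.ofComponents (F := 𝟭 (A.prod B ⟶ T)) (G := Φ ⋙ TensorCat.prodLift A B T)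
      (fun F => (TensorCat.prodLiftRestrict F).symm) ?_)
    (NatIso.ofComponents (F := TensorCat.prodLift A B T ⋙ Φ)
      (G := 𝟭 ((A ⟶ T) × (B ⟶ T))) (fun X => Iso.prod (TensorCat.inlProdLift X.1 X.2)
      (TensorCat.inrProdLift X.1 X.2)) ?_)).isEquivalence_functor
  · intro F G α
    refine (Iso.eq_inv_comp (TensorCat.prodLiftRestrict F)).2 ((Category.assoc _ _ _).symm.trans
      ((Iso.comp_inv_eq (TensorCat.prodLiftRestrict G)).2 ?_))
    refine TensorFunctor.hom_ext (NatTrans.ext (funext fun X => ?_))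
    let F' : A.carrier × B.carrier ⥤ T.carrier := F.functor
    let G' : A.carrier × B.carrier ⥤ T.carrier := G.functor
    let : F'.Braided := F.braided
    let : G'.Braided := G.braided
    let α' : F' ⟶ G' := α.natTrans
    have : NatTrans.IsMonoidal α' := α.isMonoidal
    exact decompose_hom_naturality α' X
  · intro X Y f
    have := f.1.isMonoidal
    have := f.2.isMonoidal
    exact Prod.ext (TensorFunctor.hom_ext (NatTrans.ext (funext fun a =>
        sectLProdTensor_hom_naturality f.1.natTrans f.2.natTrans a)))
      (TensorFunctor.hom_ext (NatTrans.ext (funext fun b =>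
        sectRProdTensor_hom_naturality f.1.natTrans f.2.natTrans b)))

end

/-! ### Coproducts in locally full sub-2-categories -/

section

/-- Let the morphisms of a locally full sub-2-category of tensor categories be stable under
isomorphism. A tensor functor `t : A × B ⟶ P` makes `P` a coproduct in it if restriction along `t`
is fully faithful on morphisms, and every tensor functor on `A × B` whose restrictions to `A` and
`B` are morphisms extends to a morphism on `P`. -/
theorem LocallyFull.isBicategoricalCoproduct {S : Type w} (D : LocallyFull TensorCat.{v} S)
    (iso_mem : ∀ {X Y : S} {f g : D.obj X ⟶ D.obj Y}, (f ≅ g) → D.mor f → D.mor g)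
    {A B P : S} (t : (D.obj A).prod (D.obj B) ⟶ D.obj P)
    (hi : D.mor ((D.obj A).inl (D.obj B) ≫ t)) (hj : D.mor ((D.obj A).inr (D.obj B) ≫ t))
    (ff : ∀ {T : S} {G H : D.obj P ⟶ D.obj T}, D.mor G → D.mor H →
      Function.Bijective (fun α : G ⟶ H => Bicategory.whiskerLeft t α))
    (ex : ∀ {T : S} (H : (D.obj A).prod (D.obj B) ⟶ D.obj T),
      D.mor ((D.obj A).inl (D.obj B) ≫ H) → D.mor ((D.obj A).inr (D.obj B) ≫ H) →
        ∃ G : D.obj P ⟶ D.obj T, D.mor G ∧ Nonempty (t ≫ G ≅ H)) :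
    @IsBicategoricalCoproduct S D.bicategory A B P ⟨_, hi⟩ ⟨_, hj⟩ := by
  intro T
  have h := TensorCat.isBicategoricalCoproduct_prod (D.obj A) (D.obj B) (D.obj T)
  refine { faithful := ⟨fun {G H} α β hαβ => ?_⟩, full := ⟨fun {G H} γ => ?_⟩,
           essSurj := ⟨fun F => ?_⟩ }
  · refine LocallyFull.hom_ext ((ff G.mem H.mem).1 (h.faithful.map_injective ?_))
    have h₁ := congrArg (fun γ => γ.1.hom.natTrans) hαβ
    have h₂ := congrArg (fun γ => γ.2.hom.natTrans) hαβ
    exact Prod.ext (TensorFunctor.hom_ext h₁) (TensorFunctor.hom_ext h₂)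
  · obtain ⟨α, hα⟩ := h.full.map_surjective (X := t ≫ G.hom) (Y := t ≫ H.hom)
      ((Bicategory.associator _ _ _).inv ≫ γ.1.hom ≫ (Bicategory.associator _ _ _).hom,
        (Bicategory.associator _ _ _).inv ≫ γ.2.hom ≫ (Bicategory.associator _ _ _).hom)
    obtain ⟨β, hβ⟩ := (ff G.mem H.mem).2 α
    subst hβ
    have h₁ := congrArg (fun γ => γ.1.natTrans) hα
    have h₂ := congrArg (fun γ => γ.2.natTrans) hα
    refine ⟨⟨β⟩, Prod.ext (LocallyFull.hom_ext (TensorFunctor.hom_ext (h₁.trans ?_)))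
      (LocallyFull.hom_ext (TensorFunctor.hom_ext (h₂.trans ?_)))⟩
    · exact (Category.id_comp _).trans (Category.comp_id _)
    · exact (Category.id_comp _).trans (Category.comp_id _)
  · obtain ⟨H, ⟨e⟩⟩ := h.essSurj.mem_essImage (F.1.hom, F.2.hom)
    let e₁ : (D.obj A).inl (D.obj B) ≫ H ≅ F.1.hom := (CategoryTheory.Prod.fst _ _).mapIso e
    let e₂ : (D.obj A).inr (D.obj B) ≫ H ≅ F.2.hom := (CategoryTheory.Prod.snd _ _).mapIso e
    obtain ⟨G, hG, ⟨i⟩⟩ := ex H (iso_mem e₁.symm F.1.mem) (iso_mem e₂.symm F.2.mem)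
    exact ⟨⟨G, hG⟩, ⟨Iso.prod
      (LocallyFull.isoMk (Bicategory.associator _ _ _ ≪≫ Bicategory.whiskerLeftIso _ i ≪≫ e₁))
      (LocallyFull.isoMk (Bicategory.associator _ _ _ ≪≫ Bicategory.whiskerLeftIso _ i ≪≫ e₂))⟩⟩

end

section

variable {T : Type u₃} [Category.{v} T] [MonoidalCategory T] [SymmetricCategory T]
  {A : Type u₁} [Category.{v} A] [MonoidalCategory A] [SymmetricCategory A]
  {B : Type u₂} [Category.{v} B] [MonoidalCategory B] [SymmetricCategory B]

/-- The isomorphism `F (a, 1) ⊗ F (1, b) ≅ F (a, b)`, natural in `b`. -/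
def sectRCompIso (F : A × B ⥤ T) [F.Monoidal] (a : A) :
    (Prod.sectR (𝟙_ A) B ⋙ F) ⋙ tensorLeft (F.obj (a, 𝟙_ B)) ≅ Prod.sectR a B ⋙ F :=
  NatIso.ofComponents (fun b => (decompose F).app (a, b)) fun {b b'} f =>
    (congrArg (fun k => k ≫ _) ((id_tensorHom _ _).symm.trans
      (congrArg (fun k => k ⊗ₘ _) (F.map_id _).symm))).trans
        ((decompose F).hom.naturality (X := (a, b)) (Y := (a, b')) (𝟙 a, f))

/-- The isomorphism `F (a, 1) ⊗ F (1, b) ≅ F (a, b)`, natural in `a`. -/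
def sectLCompIso (F : A × B ⥤ T) [F.Monoidal] (b : B) :
    (Prod.sectL A (𝟙_ B) ⋙ F) ⋙ tensorRight (F.obj (𝟙_ A, b)) ≅ Prod.sectL A b ⋙ F :=
  NatIso.ofComponents (fun a => (decompose F).app (a, b)) fun {a a'} f =>
    (congrArg (fun k => k ≫ _) ((tensorHom_id _ _).symm.trans
      (congrArg (fun k => _ ⊗ₘ k) (F.map_id _).symm))).trans
        ((decompose F).hom.naturality (X := (a, b)) (Y := (a', b)) (f, 𝟙 b))

end

section

/-- The natural isomorphism underlying an isomorphism of tensor functors. -/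
def TensorFunctor.toNatIso {A B : TensorCat.{v}} {F G : A ⟶ B} (e : F ≅ G) :
    F.functor ≅ G.functor where
  hom := e.hom.natTrans
  inv := e.inv.natTrans
  hom_inv_id := congrArg TensorTrans.natTrans e.hom_inv_id
  inv_hom_id := congrArg TensorTrans.natTrans e.inv_hom_id

lemma preservesFiniteColimits_of_tensorFunctorIso {A B : TensorCat.{v}} {F G : A ⟶ B} (e : F ≅ G)
    (h : PreservesFiniteColimits F.functor) : PreservesFiniteColimits G.functor :=
  preservesFiniteColimits_of_natIso (TensorFunctor.toNatIso e)

/-- The universal property of `A ⊠ B` is used here for the target `T` only through full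
faithfulness. -/
lemma detects_preservesFiniteColimits {A B P : FcTensorCat.{v}}
    (t : A.toTensorCat.prod B.toTensorCat ⟶ P.toTensorCat) (ht : FcTensorCat.IsTensor t)
    (T : FcTensorCat.{v}) :
    Detects t.functor fun G : P.carrier ⥤ T.carrier => PreservesFiniteColimits G where
  bijective {G H} hG hH := by
    have := ht.universal T.carrier
    let G' : P.carrier ⥤ᵣ T.carrier := ⟨G, hG⟩
    let H' : P.carrier ⥤ᵣ T.carrier := ⟨H, hH⟩
    refine ⟨fun α β h => ?_, fun α => ?_⟩
    · refine congrArg (fun k => k.hom) ((restrictFc T.carrier t.functor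
        ht.biCocontinuous).map_injective (X := G') (Y := H') (a₁ := ⟨α⟩) (a₂ := ⟨β⟩) ?_)
      ext : 1
      exact h
    · obtain ⟨β, hβ⟩ := (restrictFc T.carrier t.functor
        ht.biCocontinuous).map_surjective (X := G') (Y := H') ⟨α⟩
      exact ⟨β.hom, congrArg (fun k => k.hom) hβ⟩
  tensorLeft_comp _ p := comp_preservesFiniteColimits (tensorLeft p) _
  tensorRight_comp _ p := comp_preservesFiniteColimits (tensorRight p) _
  comp_tensorLeft _ x := comp_preservesFiniteColimits _ (tensorLeft x)
  comp_tensorRight _ x := comp_preservesFiniteColimits _ (tensorRight x)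

/-- A monoidal functor on `A × B` is cocontinuous in each variable if its restrictions to `A` and
`B` are cocontinuous, because `F (a, b) ≅ F (a, 1) ⊗ F (1, b)` and the tensor product of `T` is
cocontinuous in each variable. -/
lemma biCocontinuous_of_sect {A B T : FcTensorCat.{v}} (F : A.carrier × B.carrier ⥤ T.carrier)
    [F.Monoidal] (h₁ : PreservesFiniteColimits (Prod.sectL A.carrier (𝟙_ B.carrier) ⋙ F))
    (h₂ : PreservesFiniteColimits (Prod.sectR (𝟙_ A.carrier) B.carrier ⋙ F)) :
    biCocontinuous A.carrier B.carrier T.carrier F :=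
  ⟨fun a =>
    have := comp_preservesFiniteColimits (Prod.sectR (𝟙_ A.carrier) B.carrier ⋙ F)
      (tensorLeft (F.obj (a, 𝟙_ _)))
    preservesFiniteColimits_of_natIso (sectRCompIso F a),
  fun b =>
    have := comp_preservesFiniteColimits (Prod.sectL A.carrier (𝟙_ B.carrier) ⋙ F)
      (tensorRight (F.obj (𝟙_ _, b)))
    preservesFiniteColimits_of_natIso (sectLCompIso F b)⟩

theorem FcTensorCat.isBicategoricalCoproduct {A B P : FcTensorCat.{v}}
    (t : A.toTensorCat.prod B.toTensorCat ⟶ P.toTensorCat) (ht : FcTensorCat.IsTensor t) :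
    IsBicategoricalCoproduct (FcTensorCat.inl t ht) (FcTensorCat.inr t ht) := by
  refine FcTensorCat.locallyFull.isBicategoricalCoproduct (A := A) (B := B) (P := P)
    (fun {X Y f g} e h => ?_) t _ _
    (fun {T G H} hG hH =>
      (detects_preservesFiniteColimits t ht T).bijective_whiskerLeft_tensorTrans hG hH)
    fun {T} H h₁ h₂ => ?_
  · exact preservesFiniteColimits_of_tensorFunctorIso e h
  · let F : A.carrier × B.carrier ⥤ T.carrier := H.functor
    let : F.Braided := H.braided
    have := ht.universal T.carrier
    obtain ⟨G, ⟨i⟩⟩ := this.essSurj.mem_essImage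
      ⟨F, biCocontinuous_of_sect F h₁ h₂⟩
    obtain ⟨G', hG', h⟩ := (detects_preservesFiniteColimits t ht T).exists_tensorFunctor
      G.property H ((ObjectProperty.ι _).mapIso i)
    refine ⟨G', ?_, h⟩
    change PreservesFiniteColimits G'.functor
    rw [hG']
    exact G.property

end

section Linear

variable {K : Type v} [CommRing K]

lemma linearFunctors_tensorLeft {T : Type u₃} [Category.{v} T] [Preadditive T] [Linear K T]
    [MonoidalCategory T] [MonoidalPreadditive T] [MonoidalLinear K T] (x : T) :
    linearFunctors K T (tensorLeft x) := ⟨inferInstance, inferInstance⟩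

lemma linearFunctors_tensorRight {T : Type u₃} [Category.{v} T] [Preadditive T] [Linear K T]
    [MonoidalCategory T] [MonoidalPreadditive T] [MonoidalLinear K T] (x : T) :
    linearFunctors K T (tensorRight x) := ⟨inferInstance, inferInstance⟩

/-- The linear analogue of `biCocontinuous_of_sect`. -/
lemma biLinear_of_sect {A B T : LinTensorCat.{v} K} (F : A.carrier × B.carrier ⥤ T.carrier)
    [F.Monoidal] (h₁ : linearFunctors K T.carrier (Prod.sectL A.carrier (𝟙_ B.carrier) ⋙ F))
    (h₂ : linearFunctors K T.carrier (Prod.sectR (𝟙_ A.carrier) B.carrier ⋙ F)) :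
    biLinear K A.carrier B.carrier T.carrier F :=
  ⟨fun a => (h₂.comp (linearFunctors_tensorLeft _)).of_iso (sectRCompIso F a),
    fun b => (h₁.comp (linearFunctors_tensorRight _)).of_iso (sectLCompIso F b)⟩

lemma detects_linearFunctors (A B T : LinTensorCat.{v} K) :
    Detects (toLinProd K A.carrier B.carrier)
      (linearFunctors K T.carrier (A := LinProd K A.carrier B.carrier)) where
  bijective hG hH := LinProd.bijective_whiskerLeft_toLinProd hG hH
  tensorLeft_comp h p :=
    (linearFunctors_tensorLeft (T := LinProd K A.carrier B.carrier) p).comp h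
  tensorRight_comp h p :=
    (linearFunctors_tensorRight (T := LinProd K A.carrier B.carrier) p).comp h
  comp_tensorLeft h x := h.comp (linearFunctors_tensorLeft x)
  comp_tensorRight h x := h.comp (linearFunctors_tensorRight x)

theorem LinTensorCat.isBicategoricalCoproduct (A B : LinTensorCat.{v} K) :
    IsBicategoricalCoproduct (LinTensorCat.inl K A B) (LinTensorCat.inr K A B) := by
  refine (LinTensorCat.locallyFull K).isBicategoricalCoproduct (A := A) (B := B)
    (P := LinTensorCat.tensor K A B) (fun {X Y f g} e h => ?_) (LinTensorCat.toTensor K A B) _ _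
    (fun {T G H} hG hH => (detects_linearFunctors A B T).bijective_whiskerLeft_tensorTrans
      (t := LinTensorCat.toTensor K A B) hG hH)
    fun {T} H h₁ h₂ => ?_
  · exact linearFunctors.of_iso (A := X.carrier) (C := Y.carrier) (TensorFunctor.toNatIso e) h
  · let F : A.carrier × B.carrier ⥤ T.carrier := H.functor
    let : F.Braided := H.braided
    have hF := biLinear_of_sect F h₁ h₂
    obtain ⟨G', hG', h⟩ := (detects_linearFunctors A B T).exists_tensorFunctor
      (t := LinTensorCat.toTensor K A B) (LinProd.linearFunctors_lift F hF) H
      (LinProd.toLinProdCompLift F hF)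
    refine ⟨G', ?_, h⟩
    change linearFunctors K T.carrier G'.functor
    rw [hG']
    exact LinProd.linearFunctors_lift F hF

lemma detects_fcLinear {A B P : FcLinTensorCat.{v} K}
    (t : A.toTensorCat.prod B.toTensorCat ⟶ P.toTensorCat) (ht : FcLinTensorCat.IsTensor t)
    (T : FcLinTensorCat.{v} K) :
    Detects t.functor (fcLinear (P := P.carrier) T.carrier K) where
  bijective {G H} hG hH := by
    have := ht.universal T.carrier
    let G' : (fcLinear (P := P.carrier) T.carrier K).FullSubcategory := ⟨G, hG⟩
    let H' : (fcLinear (P := P.carrier) T.carrier K).FullSubcategory := ⟨H, hH⟩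
    refine ⟨fun α β h => ?_, fun α => ?_⟩
    · refine congrArg (fun k => k.hom) ((restrictFcLinear T.carrier t.functor
        ht.biFcLinear).map_injective (X := G') (Y := H') (a₁ := ⟨α⟩) (a₂ := ⟨β⟩) ?_)
      ext : 1
      exact h
    · obtain ⟨β, hβ⟩ := (restrictFcLinear T.carrier t.functor
        ht.biFcLinear).map_surjective (X := G') (Y := H') ⟨α⟩
      exact ⟨β.hom, congrArg (fun k => k.hom) hβ⟩
  tensorLeft_comp h p :=
    have := h.1
    ⟨comp_preservesFiniteColimits (tensorLeft p) _, (linearFunctors_tensorLeft p).comp h.2⟩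
  tensorRight_comp h p :=
    have := h.1
    ⟨comp_preservesFiniteColimits (tensorRight p) _, (linearFunctors_tensorRight p).comp h.2⟩
  comp_tensorLeft {G} h x :=
    have := h.1
    ⟨comp_preservesFiniteColimits G (tensorLeft x),
      linearFunctors.comp h.2 (linearFunctors_tensorLeft x)⟩
  comp_tensorRight {G} h x :=
    have := h.1
    ⟨comp_preservesFiniteColimits G (tensorRight x),
      linearFunctors.comp h.2 (linearFunctors_tensorRight x)⟩

theorem FcLinTensorCat.isBicategoricalCoproduct {A B P : FcLinTensorCat.{v} K}
    (t : A.toTensorCat.prod B.toTensorCat ⟶ P.toTensorCat) (ht : FcLinTensorCat.IsTensor t) :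
    IsBicategoricalCoproduct (FcLinTensorCat.inl t ht) (FcLinTensorCat.inr t ht) := by
  refine (FcLinTensorCat.locallyFull K).isBicategoricalCoproduct (A := A) (B := B) (P := P)
    (fun {X Y f g} e h => ?_) t _ _
    (fun {T G H} hG hH => (detects_fcLinear t ht T).bijective_whiskerLeft_tensorTrans hG hH)
    fun {T} H h₁ h₂ => ?_
  · exact ⟨preservesFiniteColimits_of_tensorFunctorIso e h.1,
      linearFunctors.of_iso (A := X.carrier) (C := Y.carrier) (TensorFunctor.toNatIso e) h.2⟩
  · let F : A.carrier × B.carrier ⥤ T.carrier := H.functor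
    let : F.Braided := H.braided
    have := ht.universal T.carrier
    have hc := biCocontinuous_of_sect (A := A.toFcTensorCat) (B := B.toFcTensorCat)
      (T := T.toFcTensorCat) F h₁.1 h₂.1
    have hl := biLinear_of_sect (A := A.toLinTensorCat) (B := B.toLinTensorCat)
      (T := T.toLinTensorCat) F h₁.2 h₂.2
    obtain ⟨G, ⟨i⟩⟩ := this.essSurj.mem_essImage
      ⟨F, fun a => ⟨hc.1 a, hl.1 a⟩, fun b => ⟨hc.2 b, hl.2 b⟩⟩
    obtain ⟨G', hG', h⟩ := (detects_fcLinear t ht T).exists_tensorFunctor G.property H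
      ((ObjectProperty.ι _).mapIso i)
    refine ⟨G', ?_, h⟩
    change fcLinear T.carrier K G'.functor
    rw [hG']
    exact G.property

end Linear

end TensorCats

theorem mainTheorem7 (K : Type v) [CommRing K] :
    -- the four 2-categories have binary bicategorical coproducts
    (TensorCats.HasBinaryBicategoricalCoproducts TensorCats.TensorCat.{v} ∧
      TensorCats.HasBinaryBicategoricalCoproducts TensorCats.FcTensorCat.{v} ∧
      TensorCats.HasBinaryBicategoricalCoproducts (TensorCats.LinTensorCat.{v} K) ∧
      TensorCats.HasBinaryBicategoricalCoproducts (TensorCats.FcLinTensorCat.{v} K)) ∧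
    -- tensor categories: the product `A × B`
    (∀ A B : TensorCats.TensorCat.{v},
      TensorCats.IsBicategoricalCoproduct
        (TensorCats.TensorCat.inl A B) (TensorCats.TensorCat.inr A B)) ∧
    -- finitely cocomplete tensor categories: `A ⊠ B` exists as a tensor category and is a coproduct
    (∀ A B : TensorCats.FcTensorCat.{v},
      (∃ (P : TensorCats.FcTensorCat.{v})
        (t : A.toTensorCat.prod B.toTensorCat ⟶ P.toTensorCat),
        TensorCats.FcTensorCat.IsTensor t) ∧
      ∀ (P : TensorCats.FcTensorCat.{v})
        (t : A.toTensorCat.prod B.toTensorCat ⟶ P.toTensorCat)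
        (ht : TensorCats.FcTensorCat.IsTensor t),
        TensorCats.IsBicategoricalCoproduct
          (TensorCats.FcTensorCat.inl t ht) (TensorCats.FcTensorCat.inr t ht)) ∧
    -- `K`-linear tensor categories: the tensor product `A ⊗_K B`
    (∀ A B : TensorCats.LinTensorCat.{v} K,
      TensorCats.IsBicategoricalCoproduct
        (TensorCats.LinTensorCat.inl K A B) (TensorCats.LinTensorCat.inr K A B)) ∧
    -- finitely cocomplete `K`-linear tensor categories: `A ⊠_K B` exists as a tensor category and
    -- is a coproduct
    (∀ A B : TensorCats.FcLinTensorCat.{v} K,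
      (∃ (P : TensorCats.FcLinTensorCat.{v} K)
        (t : A.toTensorCat.prod B.toTensorCat ⟶ P.toTensorCat),
        TensorCats.FcLinTensorCat.IsTensor t) ∧
      ∀ (P : TensorCats.FcLinTensorCat.{v} K)
        (t : A.toTensorCat.prod B.toTensorCat ⟶ P.toTensorCat)
        (ht : TensorCats.FcLinTensorCat.IsTensor t),
        TensorCats.IsBicategoricalCoproduct
          (TensorCats.FcLinTensorCat.inl t ht) (TensorCats.FcLinTensorCat.inr t ht)) := by
  have h₁ := TensorCats.TensorCat.isBicategoricalCoproduct_prod.{v}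
  have h₃ := TensorCats.LinTensorCat.isBicategoricalCoproduct (K := K)
  refine ⟨⟨fun A B => ⟨_, _, _, h₁ A B⟩, fun A B => ?_, fun A B => ⟨_, _, _, h₃ A B⟩,
    fun A B => ?_⟩, h₁, fun A B => ⟨TensorCats.FcTensorCat.exists_isTensor A B, fun P t ht =>
      TensorCats.FcTensorCat.isBicategoricalCoproduct t ht⟩, h₃, fun A B =>
        ⟨TensorCats.FcLinTensorCat.exists_isTensor A B, fun P t ht =>
          TensorCats.FcLinTensorCat.isBicategoricalCoproduct t ht⟩⟩
  · obtain ⟨P, t, ht⟩ := TensorCats.FcTensorCat.exists_isTensor A B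
    exact ⟨P, _, _, TensorCats.FcTensorCat.isBicategoricalCoproduct t ht⟩
  · obtain ⟨P, t, ht⟩ := TensorCats.FcLinTensorCat.exists_isTensor A B
    exact ⟨P, _, _, TensorCats.FcLinTensorCat.isBicategoricalCoproduct t ht⟩
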